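/- Let $p>3$ be a prime, let $w$ be a generator of $\mathbb F_p^*$, and let $G=C_p^3=\langle a_1,a_2,a_3\rangle$, so that $\mathrm{Aut}(G)=GL(3,p)$. Write $[h,g]=h^{-1}g^{-1}hg$. For a group $H$ put $\gamma_0(H)=H$ and $\gamma_{i+1}(H)=[\gamma_i(H),H]\,\gamma_i(H)^p$; the $p$-class of a finite $p$-group $H$ is the least $c$ with $\gamma_c(H)=1$. A finite $p$-group $H$ is an immediate descendant of $G$ (which has $p$-class $1$) if $H/\gamma_1(H)\cong G$, $H$ has the same minimal number of generators as $G$, and $H$ has $p$-class $2$. Let $F$ be the free group on $a_1,a_2,a_3$, let $R$ be the kernel of the natural map $F\to G$, and put $R^*=[R,F]R^p$, $P(G)=F/R^*$ (the $p$-cover) and $M(G)=R/R^*$ (the multiplicator). In $P(G)$ put $a_4=[a_2,a_1]$, $a_5=[a_3,a_1]$, $a_6=[a_3,a_2]$, $a_7=a_1^p$, $a_8=a_2^p$, $a_9=a_3^p$. A subgroup $U\le M(G)$ is admissible if $P(G)/U$ is an immediate descendant of $G$. The group $\mathrm{Aut}(G)$ acts on $M(G)$ via extension automorphisms: for $\alpha\in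 \mathrm{Aut}(G)$ choose words $u_i\in F$ representing $\alpha(a_i)$; then $\alpha^*$ is the automorphism $w(a_1,a_2,a_3)R^*\mapsto w(u_1,u_2,u_3)R^*$ of $P(G)$, whose restriction to $M(G)$ depends only on $\alpha$. An exponent in $\mathbb F_p$ is read as its representative in $\{0,\dots,p-1\}$. **(1)** $M(G)$ is central in $P(G)$ and elementary abelian of order $p^6$, and each of its subgroups of order $p^4$ (that is, each 4-dimensional subspace of $M(G)\cong\mathbb F_p^6$) is admissible. Under the action of $\mathrm{Aut}(G)=GL(3,p)$ via extension automorphisms the admissible subgroups of order $p^4$ form exactly $14+p$ orbits, and the following list is a system of representatives of these orbits, where $k$ runs through $\{1,\dots,\frac{p-1}2\}$: - $M_1=\langle a_6,a_7,a_8,a_9\rangle$, - $M_2=\langle a_5,a_6,a_7,a_8\rangle$, - $M_3=\langle a_5,a_6a_9^{-1},a_7,a_8\rangle$, - $M_4=\langle a_4,a_5,a_7,a_8\rangle$, - $M_5=\langle a_4,a_5a_9^{-1},a_7,a_8\rangle$, - $M_6=\langle a_4a_9^{-1},a_5,a_7,a_8\rangle$, - $M_7=\langle a_4,a_5,a_6a_9^{-1},a_7\rangle$,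 - $M_8=\langle a_4,a_5a_8^{-1},a_6a_9^{-1},a_7\rangle$, - $M_9=\langle a_4a_8^{-1},a_5,a_6a_9^{-1},a_7\rangle$, - $M_{10}=\langle a_4,a_5,a_6,a_7\rangle$, - $M_{11}=\langle a_4a_8^{-1},a_5a_9^{-1},a_6,a_7\rangle$, - $M_{12}=\langle a_4a_9^{-1},a_5,a_6,a_7\rangle$, - $M_{13}=\langle a_4a_8^{-1}a_9^{-1},a_5a_9^{-1},a_6,a_7\rangle$, - $M_{14}=\langle a_4,a_5a_9^{-1},a_6,a_7\rangle$, - $M_{15}^k=\langle a_4a_8^{-1},a_5a_9^{-w^k},a_6,a_7\rangle$, - $M_{16}=\langle a_4a_9^{-w},a_5a_8^{-1},a_6,a_7\rangle$, - $M_{17}^k=\langle a_4a_8^{-1}a_9^{-w^k},a_5a_8^{-w^{k-1}}a_9^{-1},a_6,a_7\rangle$. **(2)** A group of order $p^5$ is an immediate descendant of $C_p^3$ if and only if its minimal number of generators is $3$ and its $p$-class is $2$. The immediate descendants of $C_p^3$ of order $p^5$ fall into exactly $14+p$ isomorphism classes. A system of representatives is given by the following groups with generators $g_1,\dots,g_5$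 and the displayed relations, together with $g_i^p=1$ and $[g_j,g_i]=1$ $(i<j)$ for every power and every commutator that is not displayed; each of them has order $p^5$, and $k$ runs through $\{1,\dots,\frac{p-1}2\}$: - $G_1$: $[g_2,g_1]=g_4,\ [g_3,g_1]=g_5$, - $G_2$: $[g_2,g_1]=g_4,\ g_3^p=g_5$, - $G_3$: $[g_2,g_1]=g_4,\ [g_3,g_2]=g_5,\ g_3^p=g_5$, - $G_4$: $[g_3,g_2]=g_4,\ g_3^p=g_5$, - $G_5$: $[g_3,g_1]=g_4,\ [g_3,g_2]=g_5,\ g_3^p=g_5$, - $G_6$: $[g_2,g_1]=g_4,\ [g_3,g_2]=g_5,\ g_3^p=g_4$, - $G_7$: $[g_3,g_2]=g_5,\ g_2^p=g_4,\ g_3^p=g_5$, - $G_8$: $[g_3,g_1]=g_4,\ [g_3,g_2]=g_5,\ g_2^p=g_4,\ g_3^p=g_5$, - $G_9$: $[g_2,g_1]=g_4,\ [g_3,g_2]=g_5,\ g_2^p=g_4,\ g_3^p=g_5$, - $G_{10}$: $g_2^p=g_4,\ g_3^p=g_5$, - $G_{11}$: $[g_2,g_1]=g_4,\ [g_3,g_1]=g_5,\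 g_2^p=g_4,\ g_3^p=g_5$, - $G_{12}$: $[g_2,g_1]=g_5,\ g_2^p=g_4,\ g_3^p=g_5$, - $G_{13}$: $[g_2,g_1]=g_4g_5,\ [g_3,g_1]=g_5,\ g_2^p=g_4,\ g_3^p=g_5$, - $G_{14}$: $[g_3,g_1]=g_5,\ g_2^p=g_4,\ g_3^p=g_5$, - $G_{15}^k$: $[g_2,g_1]=g_4,\ [g_3,g_1]=g_5^{w^k},\ g_2^p=g_4,\ g_3^p=g_5$, - $G_{16}$: $[g_2,g_1]=g_5^{w},\ [g_3,g_1]=g_4,\ g_2^p=g_4,\ g_3^p=g_5$, - $G_{17}^k$: $[g_2,g_1]=g_4g_5^{w^k},\ [g_3,g_1]=g_4^{w^{k-1}}g_5,\ g_2^p=g_4,\ g_3^p=g_5$. -/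

import Mathlib

universe u

/-- The commutator in the convention `[h, g] = h⁻¹ g⁻¹ h g`. -/
def pcomm {H : Type*} [Group H] (h g : H) : H := h⁻¹ * g⁻¹ * h * g

/-- `[N, H] N^p = ⟨[h, g] k^p | h, k ∈ N, g ∈ H⟩`. -/
def pStep (p : ℕ) {H : Type*} [Group H] (N : Subgroup H) : Subgroup H :=
  Subgroup.closure {x | ∃ h ∈ N, ∃ k ∈ N, ∃ g : H, x = pcomm h g * k ^ p}

instance pStep_normal (p : ℕ) {H : Type*} [Group H] (N : Subgroup H) [hN : N.Normal] :
    (pStep p N).Normal := by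
  refine ⟨fun n hn g => ?_⟩
  have hle : pStep p N ≤ (pStep p N).comap (MulAut.conj g).toMonoidHom := by
    refine (Subgroup.closure_le _).2 ?_
    rintro x ⟨h, hh, k, hk, y, rfl⟩
    refine Subgroup.subset_closure ⟨g * h * g⁻¹, hN.conj_mem h hh g, g * k * g⁻¹,
      hN.conj_mem k hk g, g * y * g⁻¹, ?_⟩
    simp only [MulEquiv.toMonoidHom_eq_coe, MonoidHom.coe_coe, MulAut.conj_apply, pcomm, conj_pow]
    group
  simpa using hle hn

/-- The lower exponent-`p` central series: `γ₀(H) = H` and `γᵢ₊₁(H) = [γᵢ(H), H] γᵢ(H)^p`. -/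
def lowerPSeries (p : ℕ) (H : Type*) [Group H] : ℕ → Subgroup H
  | 0 => ⊤
  | i + 1 => pStep p (lowerPSeries p H i)

instance lowerPSeries_normal (p : ℕ) (H : Type*) [Group H] (i : ℕ) :
    (lowerPSeries p H i).Normal := by
  induction i with
  | zero => exact (inferInstance : (⊤ : Subgroup H).Normal)
  | succ i ih => exact pStep_normal p (lowerPSeries p H i)

/-- `c` is the `p`-class of `H`, the least `c` with `γ_c(H) = 1`. -/
def HasPClass (p : ℕ) (H : Type*) [Group H] (c : ℕ) : Prop :=
  IsLeast {i | lowerPSeries p H i = ⊥} c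

/-- The finite `p`-group `H` is an immediate descendant of the finite `p`-group `G`: if `c` is the
`p`-class of `G`, then `H / γ_c(H) ≅ G`, the minimal numbers of generators of `H` and `G` agree,
and `H` has `p`-class `c + 1`. -/
def IsImmediateDescendant (p : ℕ) (G H : Type*) [Group G] [Group H] : Prop :=
  ∃ (_ : Finite G) (_ : Finite H), IsPGroup p G ∧ IsPGroup p H ∧
    Group.rank H = Group.rank G ∧
    ∃ c, HasPClass p G c ∧ Nonempty (H ⧸ lowerPSeries p H c ≃* G) ∧ HasPClass p H (c + 1)

/-- The elementary abelian group `C_p³`, written multiplicatively. Its automorphism group is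
`GL(3, p)`. -/
abbrev Cp3 (p : ℕ) : Type := Multiplicative (Fin 3 → ZMod p)

/-- The standard generators of `C_p³`. -/
def stdGen (p : ℕ) (i : Fin 3) : Cp3 p := Multiplicative.ofAdd (Pi.single i 1)

section Cover

variable {d : ℕ} {G : Type*} [Group G]

/-- The `p`-cover `P(G) = F / [R, F] R^p`, where `F` is free of rank `d` and `R` is the kernel of
the map `F → G` given by the tuple `a` of generators of `G`. -/
abbrev PCover (p : ℕ) (a : Fin d → G) : Type :=
  FreeGroup (Fin d) ⧸ pStep p (FreeGroup.lift a).ker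

/-- The multiplicator `M(G) = R / [R, F] R^p`, a subgroup of `P(G)`. -/
def multiplicator (p : ℕ) (a : Fin d → G) : Subgroup (PCover p a) :=
  (FreeGroup.lift a).ker.map (QuotientGroup.mk' (pStep p (FreeGroup.lift a).ker))

/-- `U ≤ M(G)` is admissible if `P(G) / U` is an immediate descendant of `G`. (The subgroups of
`M(G)` are central in `P(G)`, hence normal.) -/
def IsAdmissible (p : ℕ) (a : Fin d → G) (U : Subgroup (PCover p a)) : Prop :=
  U ≤ multiplicator p a ∧ ∃ _ : U.Normal, IsImmediateDescendant p G (PCover p a ⧸ U)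

/-- `β` is an extension automorphism of `α ∈ Aut(G)`: there are words `uᵢ ∈ F` representing
`α (aᵢ)` such that `β` maps the class of `w(a₁, …, a_d)` to the class of `w(u₁, …, u_d)`. -/
def IsExtensionAut (p : ℕ) (a : Fin d → G) (α : MulAut G) (β : MulAut (PCover p a)) : Prop :=
  ∃ v : Fin d → FreeGroup (Fin d), (∀ i, FreeGroup.lift a (v i) = α (a i)) ∧
    ∀ x : FreeGroup (Fin d), β (QuotientGroup.mk x) = QuotientGroup.mk (FreeGroup.lift v x)

/-- The orbit of a subgroup `U` of `M(G)` under `Aut(G)`, acting via extension automorphisms. -/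
def extOrbit (p : ℕ) (a : Fin d → G) (U : Subgroup (PCover p a)) : Set (Subgroup (PCover p a)) :=
  {V | ∃ (α : MulAut G) (β : MulAut (PCover p a)), IsExtensionAut p a α β ∧
    V = U.map β.toMonoidHom}

end Cover

/-- The labels of the members of both lists; `l15` and `l17` are families. -/
inductive DescLabel (p : ℕ) : Type
  | l1 | l2 | l3 | l4 | l5 | l6 | l7 | l8 | l9 | l10 | l11 | l12 | l13 | l14
  | l15 (k : Set.Icc (1 : ℕ) ((p - 1) / 2))
  | l16
  | l17 (k : Set.Icc (1 : ℕ) ((p - 1) / 2))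

/-- The `p`-cover of `C_p³` with respect to the standard generators. -/
abbrev P3 (p : ℕ) : Type := PCover p (stdGen p)

/-- The generators `a₁, a₂, a₃` of `P(C_p³)` (numbered `0, 1, 2`). -/
def coverGen (p : ℕ) (i : Fin 3) : P3 p := QuotientGroup.mk (FreeGroup.of i)

/-- `a₄ = [a₂, a₁]` -/
def a4 (p : ℕ) : P3 p := pcomm (coverGen p 1) (coverGen p 0)
/-- `a₅ = [a₃, a₁]` -/
def a5 (p : ℕ) : P3 p := pcomm (coverGen p 2) (coverGen p 0)
/-- `a₆ = [a₃, a₂]` -/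
def a6 (p : ℕ) : P3 p := pcomm (coverGen p 2) (coverGen p 1)
/-- `a₇ = a₁^p` -/
def a7 (p : ℕ) : P3 p := coverGen p 0 ^ p
/-- `a₈ = a₂^p` -/
def a8 (p : ℕ) : P3 p := coverGen p 1 ^ p
/-- `a₉ = a₃^p` -/
def a9 (p : ℕ) : P3 p := coverGen p 2 ^ p

/-- The exponent `w^k`, read as its representative in `{0, …, p - 1}`. -/
def wexp {p : ℕ} (w : (ZMod p)ˣ) (k : ℕ) : ℕ := ((w : ZMod p) ^ k).val

/-- The list of representatives of the orbits of admissible subgroups of order `p⁴`. -/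
def repSubgroup (p : ℕ) (w : (ZMod p)ˣ) : DescLabel p → Subgroup (P3 p)
  | .l1 => .closure {a6 p, a7 p, a8 p, a9 p}
  | .l2 => .closure {a5 p, a6 p, a7 p, a8 p}
  | .l3 => .closure {a5 p, a6 p * (a9 p)⁻¹, a7 p, a8 p}
  | .l4 => .closure {a4 p, a5 p, a7 p, a8 p}
  | .l5 => .closure {a4 p, a5 p * (a9 p)⁻¹, a7 p, a8 p}
  | .l6 => .closure {a4 p * (a9 p)⁻¹, a5 p, a7 p, a8 p}
  | .l7 => .closure {a4 p, a5 p, a6 p * (a9 p)⁻¹, a7 p}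
  | .l8 => .closure {a4 p, a5 p * (a8 p)⁻¹, a6 p * (a9 p)⁻¹, a7 p}
  | .l9 => .closure {a4 p * (a8 p)⁻¹, a5 p, a6 p * (a9 p)⁻¹, a7 p}
  | .l10 => .closure {a4 p, a5 p, a6 p, a7 p}
  | .l11 => .closure {a4 p * (a8 p)⁻¹, a5 p * (a9 p)⁻¹, a6 p, a7 p}
  | .l12 => .closure {a4 p * (a9 p)⁻¹, a5 p, a6 p, a7 p}
  | .l13 => .closure {a4 p * (a8 p)⁻¹ * (a9 p)⁻¹, a5 p * (a9 p)⁻¹, a6 p, a7 p}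
  | .l14 => .closure {a4 p, a5 p * (a9 p)⁻¹, a6 p, a7 p}
  | .l15 k => .closure {a4 p * (a8 p)⁻¹, a5 p * (a9 p ^ wexp w k)⁻¹, a6 p, a7 p}
  | .l16 => .closure {a4 p * (a9 p ^ wexp w 1)⁻¹, a5 p * (a8 p)⁻¹, a6 p, a7 p}
  | .l17 k => .closure {a4 p * (a8 p)⁻¹ * (a9 p ^ wexp w k)⁻¹,
      a5 p * (a8 p ^ wexp w (k - 1))⁻¹ * (a9 p)⁻¹, a6 p, a7 p}

/-- The relators of the power-commutator presentation with generators `g i`, power relations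
`(g i)^p = pw i`, and commutator relations `[g j, g i] = cw j i` for `i < j`. -/
def pcRels {n : ℕ} (p : ℕ) (pw : Fin n → FreeGroup (Fin n))
    (cw : Fin n → Fin n → FreeGroup (Fin n)) : Set (FreeGroup (Fin n)) :=
  {r | ∃ i, r = FreeGroup.of i ^ p * (pw i)⁻¹} ∪
  {r | ∃ i j, i < j ∧ r = pcomm (FreeGroup.of j) (FreeGroup.of i) * (cw j i)⁻¹}

/-- The power-commutator presentation on `g₁, …, g₅` (numbered `0, …, 4`) with
`[g₂, g₁] = c21`, `[g₃, g₁] = c31`, `[g₃, g₂] = c32`, `g₂^p = q2`, `g₃^p = q3`; all the other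
powers `gᵢ^p` and commutators `[gⱼ, gᵢ]` are trivial. -/
def descRels (p : ℕ) (c21 c31 c32 q2 q3 : FreeGroup (Fin 5)) : Set (FreeGroup (Fin 5)) :=
  pcRels p ![1, q2, q3, 1, 1]
    ![![1, 1, 1, 1, 1],
      ![c21, 1, 1, 1, 1],
      ![c31, c32, 1, 1, 1],
      ![1, 1, 1, 1, 1],
      ![1, 1, 1, 1, 1]]

/-- The generator `g₄`. -/
def g4 : FreeGroup (Fin 5) := FreeGroup.of 3
/-- The generator `g₅`. -/
def g5 : FreeGroup (Fin 5) := FreeGroup.of 4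

/-- The relators of the listed groups. The arguments of `descRels` are, in this order, the values
of `[g₂, g₁]`, `[g₃, g₁]`, `[g₃, g₂]`, `g₂^p`, `g₃^p`. -/
def repRels (p : ℕ) (w : (ZMod p)ˣ) : DescLabel p → Set (FreeGroup (Fin 5))
  | .l1 => descRels p g4 g5 1 1 1
  | .l2 => descRels p g4 1 1 1 g5
  | .l3 => descRels p g4 1 g5 1 g5
  | .l4 => descRels p 1 1 g4 1 g5
  | .l5 => descRels p 1 g4 g5 1 g5
  | .l6 => descRels p g4 1 g5 1 g4
  | .l7 => descRels p 1 1 g5 g4 g5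
  | .l8 => descRels p 1 g4 g5 g4 g5
  | .l9 => descRels p g4 1 g5 g4 g5
  | .l10 => descRels p 1 1 1 g4 g5
  | .l11 => descRels p g4 g5 1 g4 g5
  | .l12 => descRels p g5 1 1 g4 g5
  | .l13 => descRels p (g4 * g5) g5 1 g4 g5
  | .l14 => descRels p 1 g5 1 g4 g5
  | .l15 k => descRels p g4 (g5 ^ wexp w k) 1 g4 g5
  | .l16 => descRels p (g5 ^ wexp w 1) g4 1 g4 g5
  | .l17 k => descRels p (g4 * g5 ^ wexp w k) (g4 ^ wexp w (k - 1) * g5) 1 g4 g5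

/-- The group with label `l` in the list. -/
abbrev RepGroup (p : ℕ) (w : (ZMod p)ˣ) (l : DescLabel p) : Type :=
  PresentedGroup (repRels p w l)

/-- The immediate descendants of `C_p³` of order `p⁵`. -/
def Desc5 (p : ℕ) : Type (u + 1) :=
  {H : GrpCat.{u} // IsImmediateDescendant p (Cp3 p) H ∧ Nat.card H = p ^ 5}

/-- Isomorphism of immediate descendants. -/
def desc5Setoid (p : ℕ) : Setoid (Desc5.{u} p) where
  r H K := Nonempty (H.1 ≃* K.1)
  iseqv := ⟨fun _ => ⟨MulEquiv.refl _⟩, fun ⟨e⟩ => ⟨e.symm⟩, fun ⟨e⟩ ⟨f⟩ => ⟨e.trans f⟩⟩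

/-- The isomorphism classes of immediate descendants of `C_p³` of order `p⁵`. -/
def Desc5Classes (p : ℕ) : Type (u + 1) := Quotient (desc5Setoid.{u} p)

/-!
The proof translates the problem into linear algebra over `𝔽_p` and solves it there.

**The `p`-cover.** Let `V = C_p³`, viewed as a vector space. The free group maps to an explicit
central extension of `ℤ³` by `𝔽_p³` (`CoverModel`) in such a way that the elements of `M(G)` receive
six coordinates: three exponents of `a₄, a₅, a₆` and, after division by `p`, three exponents of
`a₇, a₈, a₉`. The coordinates are well defined because `p` is odd, and they turn `M(G)` into
`Λ² V ⊕ V`: the commutator of two elements has the coordinates `(x ∧ y, 0)`, and the `p`-th power of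
an element has the coordinates `(0, x)` (`coverCoord_pcomm`, `coverCoord_pow`). In particular
`M(G)` has order `p⁶`. A subgroup `U` of order `p⁴` is the same as a plane `W`, the quotient of
`M(G)` by `U`, together with an alternating map `c : V × V → W` and a linear map `q : V → W` whose
values jointly span `W`. Moreover `α ∈ GL(3, p)` carries the listed subgroup with label `l` onto `U`
exactly if the images `u₁, u₂, u₃` of the standard basis satisfy the relations of that label,
read as equations between values of `c` and `q` (`map_repSubgroup_le_iff`). All that remains to be
shown is that each pair `(c, q)` satisfies the relations of exactly one label for some basis of `V`.

**Linear algebra.** If `q = 0`, then some basis has `c u₃ u₂ = 0`, because every element of the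
exterior square of a three-dimensional space is decomposable; this is the first label. If `q` has
rank one, five labels arise, distinguished by the values of `c` on the kernel of `q` and by vectors
that pair trivially with this kernel or with everything. If `q` is surjective, its kernel is a line
spanned by some `u₁`, and `c · u₁` induces an endomorphism `T` of `V / ⟨u₁⟩ ≅ W`. When the values of
`c` are all in the image of `T`, the basis can be chosen with `c u₃ u₂ = 0`, and the pair is
determined by `T` up to conjugation and scaling (`u₁` may be multiplied by a scalar). Apart from
scalar matrices this amounts to the pair `(tr T, det T)` up to `(s tr T, s² det T)`, and the listed
labels are normal forms, sorted by whether the determinant, the trace and the discriminant vanish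
and whether the discriminant is a square. Otherwise `T` is zero, nilpotent or of rank one with a
nonzero eigenvalue, and each of these gives one label. The existence and the uniqueness of the label
are `exists_label` and `LabelRel.unique`.

**Descendants.** A group of class `2` with three generators is a quotient of `P(G)`, since the
defining relations of `C_p³` hold in it modulo the central subgroup `γ₁` of exponent `p`. A subgroup
that together with `γ₁` generates such a group contains `γ₁` (`pStep_top_le_of_supplement`); this
form of the Burnside basis theorem shows that endomorphisms of `P(G)` given by a basis of `V` are
automorphisms, and that for rank `3` the kernel of the quotient map lies in `M(G)`. Isomorphisms
between quotients of `P(G)` lift to words, hence to extension automorphisms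
(`mem_extOrbit_of_equiv`), so that isomorphism classes correspond to orbits. Finally, the quotients
of `P(G)` by the listed subgroups have the listed presentations: homomorphisms in both directions
are read off from the relations (`nonempty_quotient_equiv_repGroup`). Only for `l5` do the two lists
match after an exchange of the first two generators.
-/

/-! ### Spanning triples and pairs -/

section Spans

variable {K V W : Type*} [Field K] [AddCommGroup V] [Module K V] [AddCommGroup W] [Module K W]

/-- Every vector is a linear combination of `u₁, u₂, u₃`. -/
def Spans3 (K : Type*) {V : Type*} [Field K] [AddCommGroup V] [Module K V] (u₁ u₂ u₃ : V) : Prop :=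
  ∀ v, ∃ x y z : K, v = x • u₁ + y • u₂ + z • u₃

/-- Every vector is a linear combination of `a, b`. -/
def Spans2 (K : Type*) {W : Type*} [Field K] [AddCommGroup W] [Module K W] (a b : W) : Prop :=
  ∀ v, ∃ x y : K, v = x • a + y • b

namespace Spans3

variable {u₁ u₂ u₃ : V}

lemma swap₁₂ (h : Spans3 K u₁ u₂ u₃) : Spans3 K u₂ u₁ u₃ := fun v => by
  obtain ⟨x, y, z, rfl⟩ := h v
  exact ⟨y, x, z, by module⟩

lemma swap₂₃ (h : Spans3 K u₁ u₂ u₃) : Spans3 K u₁ u₃ u₂ := fun v => by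
  obtain ⟨x, y, z, rfl⟩ := h v
  exact ⟨x, z, y, by module⟩

lemma smul₁ (h : Spans3 K u₁ u₂ u₃) {s : K} (hs : s ≠ 0) : Spans3 K (s • u₁) u₂ u₃ := fun v => by
  obtain ⟨x, y, z, rfl⟩ := h v
  exact ⟨x * s⁻¹, y, z, by rw [smul_smul, inv_mul_cancel_right₀ hs]⟩

lemma add₃ (h : Spans3 K u₁ u₂ u₃) (s t : K) : Spans3 K u₁ u₂ (u₃ + s • u₁ + t • u₂) := fun v => by
  obtain ⟨x, y, z, rfl⟩ := h v
  exact ⟨x - z * s, y - z * t, z, by module⟩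

lemma smul₂ (h : Spans3 K u₁ u₂ u₃) {s : K} (hs : s ≠ 0) : Spans3 K u₁ (s • u₂) u₃ :=
  (h.swap₁₂.smul₁ hs).swap₁₂

lemma add₂ (h : Spans3 K u₁ u₂ u₃) (s t : K) : Spans3 K u₁ (u₂ + s • u₁ + t • u₃) u₃ :=
  (h.swap₂₃.add₃ s t).swap₂₃

/-- Replace the last two vectors by combinations with an invertible matrix of coefficients. -/
lemma comb₂₃ (h : Spans3 K u₁ u₂ u₃) {x y z v : K} (hD : x * v - y * z ≠ 0) :
    Spans3 K u₁ (x • u₂ + y • u₃) (z • u₂ + v • u₃) := fun t => by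
  obtain ⟨a, b, d, rfl⟩ := h t
  refine ⟨a, (b * v - d * z) / (x * v - y * z), (d * x - b * y) / (x * v - y * z), ?_⟩
  have h1 : (b * v - d * z) / (x * v - y * z) * x + (d * x - b * y) / (x * v - y * z) * z = b := by
    rw [div_mul_eq_mul_div, div_mul_eq_mul_div, ← add_div, div_eq_iff hD]; ring
  have h2 : (b * v - d * z) / (x * v - y * z) * y + (d * x - b * y) / (x * v - y * z) * v = d := by
    rw [div_mul_eq_mul_div, div_mul_eq_mul_div, ← add_div, div_eq_iff hD]; ring
  generalize (b * v - d * z) / (x * v - y * z) = i at *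
  generalize (d * x - b * y) / (x * v - y * z) = j at *
  subst h1 h2
  module

lemma comb₁₂ (h : Spans3 K u₁ u₂ u₃) {x y z v : K} (hD : x * v - y * z ≠ 0) :
    Spans3 K (x • u₁ + y • u₂) (z • u₁ + v • u₂) u₃ :=
  (h.swap₂₃.swap₁₂.comb₂₃ hD).swap₁₂.swap₂₃

lemma span_eq_top (h : Spans3 K u₁ u₂ u₃) : Submodule.span K {u₁, u₂, u₃} = ⊤ := by
  refine eq_top_iff.2 fun v _ => ?_
  obtain ⟨x, y, z, rfl⟩ := h v
  exact Submodule.mem_span_triple.2 ⟨x, y, z, rfl⟩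

lemma indep (h : Spans3 K u₁ u₂ u₃) (hV : Module.finrank K V = 3) {x y z : K}
    (hxyz : x • u₁ + y • u₂ + z • u₃ = 0) : x = 0 ∧ y = 0 ∧ z = 0 := by
  have h1 : LinearIndependent K ![u₁, u₂, u₃] := by
    refine linearIndependent_of_top_le_span_of_card_eq_finrank ?_ (by simp [hV])
    rw [Matrix.range_cons, Matrix.range_cons, Matrix.range_cons, Matrix.range_empty,
      Set.union_empty, Set.singleton_union, Set.singleton_union, h.span_eq_top]
  have h2 := Fintype.linearIndependent_iff.1 h1 ![x, y, z]
    (by simpa [Fin.sum_univ_three] using hxyz)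
  exact ⟨h2 0, h2 1, h2 2⟩

lemma ne_zero₁ (h : Spans3 K u₁ u₂ u₃) (hV : Module.finrank K V = 3) : u₁ ≠ 0 := by
  rintro rfl
  exact one_ne_zero (h.indep hV (x := 1) (y := 0) (z := 0) (by simp)).1

/-- A nonzero vector is the first vector of a spanning triple. -/
lemma exists_of_ne_zero (h : Spans3 K u₁ u₂ u₃) {v : V} (hv : v ≠ 0) :
    ∃ v₂ v₃, Spans3 K v v₂ v₃ := by
  have key : ∀ {a b d : V} {x y z : K}, Spans3 K a b d → v = x • a + y • b + z • d → x ≠ 0 →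
      Spans3 K v b d := by
    rintro a b d x y z hs rfl hx t
    obtain ⟨i, j, k, rfl⟩ := hs t
    refine ⟨i / x, j - i / x * y, k - i / x * z, ?_⟩
    nth_rw 1 [← div_mul_cancel₀ i hx]
    module
  obtain ⟨x, y, z, hxyz⟩ := h v
  by_cases hx : x = 0
  · by_cases hy : y = 0
    · refine ⟨_, _, key (x := z) (y := y) (z := x) h.swap₂₃.swap₁₂.swap₂₃.swap₁₂.swap₁₂
        (by rw [hxyz]; module) fun hz => hv ?_⟩
      rw [hxyz, hx, hy, hz]; simp
    · exact ⟨_, _, key (x := y) (y := x) (z := z) h.swap₁₂ (by rw [hxyz]; module) hy⟩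
  · exact ⟨_, _, key h hxyz hx⟩

end Spans3

namespace Spans2

variable {a b : W}

lemma span_eq_top (h : Spans2 K a b) : Submodule.span K {a, b} = ⊤ := by
  refine eq_top_iff.2 fun v _ => ?_
  obtain ⟨x, y, rfl⟩ := h v
  exact Submodule.mem_span_pair.2 ⟨x, y, rfl⟩

lemma swap (h : Spans2 K a b) : Spans2 K b a := fun v => by
  obtain ⟨x, y, rfl⟩ := h v
  exact ⟨y, x, by module⟩

lemma indep (h : Spans2 K a b) (hW : Module.finrank K W = 2) {x y : K}
    (hxy : x • a + y • b = 0) : x = 0 ∧ y = 0 := by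
  have h1 : LinearIndependent K ![a, b] :=
    linearIndependent_of_top_le_span_of_card_eq_finrank
      (by simp [Set.pair_comm b a, h.span_eq_top]) (by simp [hW])
  exact LinearIndependent.pair_iff.1 h1 x y hxy

lemma coeff_eq (h : Spans2 K a b) (hW : Module.finrank K W = 2) {x y x' y' : K}
    (hxy : x • a + y • b = x' • a + y' • b) : x = x' ∧ y = y' := by
  have h1 : (x - x') • a + (y - y') • b = 0 := by
    rw [← sub_eq_zero] at hxy
    rw [← hxy]
    module
  have h2 := h.indep hW h1
  exact ⟨sub_eq_zero.1 h2.1, sub_eq_zero.1 h2.2⟩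

end Spans2

lemma dependent_or_spans2 (hW : Module.finrank K W = 2) (a b : W) :
    (∃ x y : K, (x ≠ 0 ∨ y ≠ 0) ∧ x • a + y • b = 0) ∨ Spans2 K a b := by
  by_cases h : LinearIndependent K ![a, b]
  · right
    have : Module.Finite K W := Module.finite_of_finrank_pos (by omega)
    have h1 := h.span_eq_top_of_card_eq_finrank' (by simp [hW])
    intro v
    have h2 : v ∈ Submodule.span K (Set.range ![a, b]) := h1 ▸ Submodule.mem_top
    rw [Matrix.range_cons, Matrix.range_cons, Matrix.range_empty, Set.union_empty,
      Set.singleton_union, Submodule.mem_span_pair] at h2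
    obtain ⟨x, y, hxy⟩ := h2
    exact ⟨x, y, hxy.symm⟩
  · left
    rw [LinearIndependent.pair_iff] at h
    push Not at h
    obtain ⟨x, y, hxy, hne⟩ := h
    refine ⟨x, y, ?_, hxy⟩
    by_cases hx : x = 0
    · exact Or.inr (hne hx)
    · exact Or.inl hx

lemma exists_spans2_of_ne_zero (hW : Module.finrank K W = 2) {a : W} (ha : a ≠ 0) :
    ∃ b, Spans2 K a b := by
  by_contra! hcon
  have h : ∀ b, b ∈ Submodule.span K {a} := fun b => by
    obtain ⟨x, y, hne, hxy⟩ := (dependent_or_spans2 (K := K) hW a b).resolve_right (hcon b)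
    have hy : y ≠ 0 := by
      rintro rfl
      rw [zero_smul, add_zero] at hxy
      exact (hne.resolve_right (by simp)) ((smul_eq_zero.1 hxy).resolve_right ha)
    refine Submodule.mem_span_singleton.2 ⟨-(y⁻¹ * x), ?_⟩
    have : y⁻¹ • (x • a + y • b) = 0 := by rw [hxy, smul_zero]
    rw [smul_add, smul_smul, inv_smul_smul₀ hy] at this
    rw [neg_smul]
    exact neg_eq_of_add_eq_zero_right this
  have h1 : Submodule.span K {a} = ⊤ := eq_top_iff.2 fun b _ => h b
  have h2 := finrank_span_singleton (K := K) ha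
  rw [h1, finrank_top] at h2
  omega

/-- A combination of three vectors of a plane vanishes. -/
lemma exists_relation₃ (hW : Module.finrank K W = 2) (a b d : W) :
    ∃ x y z : K, (x ≠ 0 ∨ y ≠ 0 ∨ z ≠ 0) ∧ x • a + y • b + z • d = 0 := by
  rcases dependent_or_spans2 (K := K) hW a b with ⟨x, y, hne, h⟩ | h
  · exact ⟨x, y, 0, by tauto, by simp [h]⟩
  · obtain ⟨x, y, rfl⟩ := h d
    exact ⟨x, y, -1, by simp, by module⟩

end Spans

/-! ### Alternating maps and linear maps from a space of dimension three to a plane -/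

section Classification

variable {p : ℕ} {V W : Type*} [AddCommGroup V] [Module (ZMod p) V]
  [AddCommGroup W] [Module (ZMod p) W]

/-- The relations that the `l`-th subgroup of the list imposes on a triple of vectors: commutators
are read as values of the alternating map `c`, and `p`-th powers as values of the linear
map `q`. -/
def LabelRel (w : (ZMod p)ˣ) (c : V →ₗ[ZMod p] V →ₗ[ZMod p] W) (q : V →ₗ[ZMod p] W)
    (u₁ u₂ u₃ : V) : DescLabel p → Prop
  | .l1 => c u₃ u₂ = 0 ∧ q u₁ = 0 ∧ q u₂ = 0 ∧ q u₃ = 0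
  | .l2 => c u₃ u₁ = 0 ∧ c u₃ u₂ = 0 ∧ q u₁ = 0 ∧ q u₂ = 0
  | .l3 => c u₃ u₁ = 0 ∧ c u₃ u₂ = q u₃ ∧ q u₁ = 0 ∧ q u₂ = 0
  | .l4 => c u₂ u₁ = 0 ∧ c u₃ u₁ = 0 ∧ q u₁ = 0 ∧ q u₂ = 0
  | .l5 => c u₂ u₁ = 0 ∧ c u₃ u₁ = q u₃ ∧ q u₁ = 0 ∧ q u₂ = 0
  | .l6 => c u₂ u₁ = q u₃ ∧ c u₃ u₁ = 0 ∧ q u₁ = 0 ∧ q u₂ = 0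
  | .l7 => c u₂ u₁ = 0 ∧ c u₃ u₁ = 0 ∧ c u₃ u₂ = q u₃ ∧ q u₁ = 0
  | .l8 => c u₂ u₁ = 0 ∧ c u₃ u₁ = q u₂ ∧ c u₃ u₂ = q u₃ ∧ q u₁ = 0
  | .l9 => c u₂ u₁ = q u₂ ∧ c u₃ u₁ = 0 ∧ c u₃ u₂ = q u₃ ∧ q u₁ = 0
  | .l10 => c u₂ u₁ = 0 ∧ c u₃ u₁ = 0 ∧ c u₃ u₂ = 0 ∧ q u₁ = 0
  | .l11 => c u₂ u₁ = q u₂ ∧ c u₃ u₁ = q u₃ ∧ c u₃ u₂ = 0 ∧ q u₁ = 0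
  | .l12 => c u₂ u₁ = q u₃ ∧ c u₃ u₁ = 0 ∧ c u₃ u₂ = 0 ∧ q u₁ = 0
  | .l13 => c u₂ u₁ = q u₂ + q u₃ ∧ c u₃ u₁ = q u₃ ∧ c u₃ u₂ = 0 ∧ q u₁ = 0
  | .l14 => c u₂ u₁ = 0 ∧ c u₃ u₁ = q u₃ ∧ c u₃ u₂ = 0 ∧ q u₁ = 0
  | .l15 k => c u₂ u₁ = q u₂ ∧ c u₃ u₁ = (w : ZMod p) ^ (k : ℕ) • q u₃ ∧ c u₃ u₂ = 0 ∧ q u₁ = 0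
  | .l16 => c u₂ u₁ = (w : ZMod p) • q u₃ ∧ c u₃ u₁ = q u₂ ∧ c u₃ u₂ = 0 ∧ q u₁ = 0
  | .l17 k => c u₂ u₁ = q u₂ + (w : ZMod p) ^ (k : ℕ) • q u₃ ∧
      c u₃ u₁ = (w : ZMod p) ^ ((k : ℕ) - 1) • q u₂ + q u₃ ∧ c u₃ u₂ = 0 ∧ q u₁ = 0

/-- The values of the alternating map `c` and of the linear map `q` span the target. -/
def JointlySpan (c : V →ₗ[ZMod p] V →ₗ[ZMod p] W) (q : V →ₗ[ZMod p] W) : Prop :=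
  ∀ S : Submodule (ZMod p) W, (∀ x y, c x y ∈ S) → (∀ x, q x ∈ S) → S = ⊤

variable [Fact p.Prime] {w : (ZMod p)ˣ} {c : V →ₗ[ZMod p] V →ₗ[ZMod p] W} {q : V →ₗ[ZMod p] W}
  {u₁ u₂ u₃ : V}

lemma alt_swap (hc : ∀ x, c x x = 0) (x y : V) : c x y = -c y x := by
  have h := hc (x + y)
  simp only [map_add, LinearMap.add_apply, hc, zero_add, add_zero] at h
  exact eq_neg_of_add_eq_zero_right h

/-- A submodule that contains the values of `c` and `q` on a spanning triple is everything. -/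
lemma eq_top_of_triple (hc : ∀ x, c x x = 0) (hcq : JointlySpan c q)
    (hu : Spans3 (ZMod p) u₁ u₂ u₃) {S : Submodule (ZMod p) W} (h₂₁ : c u₂ u₁ ∈ S)
    (h₃₁ : c u₃ u₁ ∈ S) (h₃₂ : c u₃ u₂ ∈ S) (h₁ : q u₁ ∈ S) (h₂ : q u₂ ∈ S) (h₃ : q u₃ ∈ S) :
    S = ⊤ := by
  refine hcq S (fun x y => ?_) fun x => ?_
  · obtain ⟨a, b, d, rfl⟩ := hu x
    obtain ⟨a', b', d', rfl⟩ := hu y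
    have h : c (a • u₁ + b • u₂ + d • u₃) (a' • u₁ + b' • u₂ + d' • u₃) =
        (b * a' - a * b') • c u₂ u₁ + (d * a' - a * d') • c u₃ u₁ +
          (d * b' - b * d') • c u₃ u₂ := by
      simp only [map_add, map_smul, LinearMap.add_apply, LinearMap.smul_apply, hc]
      rw [alt_swap hc u₁ u₂, alt_swap hc u₁ u₃, alt_swap hc u₂ u₃]
      module
    rw [h]
    exact S.add_mem (S.add_mem (S.smul_mem _ h₂₁) (S.smul_mem _ h₃₁)) (S.smul_mem _ h₃₂)
  · obtain ⟨a, b, d, rfl⟩ := hu x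
    simp only [map_add, map_smul]
    exact S.add_mem (S.add_mem (S.smul_mem _ h₁) (S.smul_mem _ h₂)) (S.smul_mem _ h₃)

end Classification

/-! ### Powers of a primitive root -/

section PrimitiveRoot

variable {p : ℕ} [Fact p.Prime] {w : (ZMod p)ˣ}

lemma orderOf_primitiveRoot (hw : ∀ x : (ZMod p)ˣ, x ∈ Subgroup.zpowers w) :
    orderOf w = p - 1 := by
  rw [orderOf_eq_card_of_forall_mem_zpowers hw, Nat.card_eq_fintype_card, ZMod.card_units]

lemma primitiveRoot_pow_inj (hw : ∀ x : (ZMod p)ˣ, x ∈ Subgroup.zpowers w) {i j : ℕ}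
    (h : (w : ZMod p) ^ i = (w : ZMod p) ^ j) : i ≡ j [MOD (p - 1)] := by
  rw [← orderOf_primitiveRoot hw, ← pow_eq_pow_iff_modEq]
  exact_mod_cast h

lemma exists_primitiveRoot_pow (hw : ∀ x : (ZMod p)ˣ, x ∈ Subgroup.zpowers w) {a : ZMod p}
    (ha : a ≠ 0) : ∃ m < p - 1, (w : ZMod p) ^ m = a := by
  have h := mem_zpowers_iff_mem_range_orderOf.1 (hw (Units.mk0 a ha))
  rw [orderOf_primitiveRoot hw, Finset.mem_image] at h
  obtain ⟨m, hm, h⟩ := h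
  exact ⟨m, Finset.mem_range.1 hm, by simpa using congrArg Units.val h⟩

lemma two_ne_zero_of_three_lt (hp : 3 < p) : (2 : ZMod p) ≠ 0 := by
  intro h
  have h1 : p ∣ 2 := (ZMod.natCast_eq_zero_iff 2 p).1 (by exact_mod_cast h)
  exact absurd (Nat.le_of_dvd (by norm_num) h1) (by omega)

lemma sub_one_eq_two_mul (hp : 3 < p) : p - 1 = 2 * ((p - 1) / 2) := by
  have := (Fact.out : p.Prime).eq_two_or_odd
  omega

/-- The odd powers of a primitive root are not squares. -/
lemma primitiveRoot_odd_pow_ne_sq (hp : 3 < p) (hw : ∀ x : (ZMod p)ˣ, x ∈ Subgroup.zpowers w)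
    (k : ℕ) (r : ZMod p) : (w : ZMod p) ^ (2 * k + 1) ≠ r ^ 2 := by
  intro h
  have hr : r ≠ 0 := by
    rintro rfl
    simp at h
  obtain ⟨m, -, rfl⟩ := exists_primitiveRoot_pow hw hr
  rw [← pow_mul] at h
  have h1 := primitiveRoot_pow_inj hw h
  rw [sub_one_eq_two_mul hp] at h1
  have h2 := (h1.of_dvd (Dvd.intro _ rfl) : _ ≡ _ [MOD 2])
  unfold Nat.ModEq at h2
  omega

/-- Every nonsquare is one of the powers `w ^ (2 k - 1)` with `1 ≤ k ≤ (p - 1) / 2`. -/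
lemma exists_eq_odd_pow_of_not_sq (hp : 3 < p) (hw : ∀ x : (ZMod p)ˣ, x ∈ Subgroup.zpowers w)
    {a : ZMod p} (ha : ∀ r, a ≠ r ^ 2) :
    ∃ k ∈ Set.Icc 1 ((p - 1) / 2), a = (w : ZMod p) ^ (2 * k - 1) := by
  obtain ⟨m, hm, rfl⟩ := exists_primitiveRoot_pow hw (a := a) (by simpa using ha 0)
  have h2 := sub_one_eq_two_mul hp
  rcases Nat.even_or_odd' m with ⟨j, rfl | rfl⟩
  · exact absurd (by rw [← pow_mul, mul_comm]) (ha ((w : ZMod p) ^ j))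
  · exact ⟨j + 1, ⟨by omega, by omega⟩, by congr 1⟩

lemma primitiveRoot_pow_ne_one (hw : ∀ x : (ZMod p)ˣ, x ∈ Subgroup.zpowers w) (hp : 3 < p)
    {k : ℕ} (hk : k ∈ Set.Icc 1 ((p - 1) / 2)) : (w : ZMod p) ^ k ≠ 1 := by
  intro h
  have h1 := primitiveRoot_pow_inj (j := 0) hw (by simpa using h)
  rw [Nat.modEq_zero_iff_dvd] at h1
  have h2 := Nat.le_of_dvd hk.1 h1
  have := hk.2
  omega

/-- Up to inversion, every element other than `0` and `1` is one of the powers `w ^ k` with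
`1 ≤ k ≤ (p - 1) / 2`. -/
lemma exists_eq_pow_or_inv (hp : 3 < p) (hw : ∀ x : (ZMod p)ˣ, x ∈ Subgroup.zpowers w)
    {a : ZMod p} (ha : a ≠ 0) (ha1 : a ≠ 1) :
    ∃ k ∈ Set.Icc 1 ((p - 1) / 2), (w : ZMod p) ^ k = a ∨ (w : ZMod p) ^ k * a = 1 := by
  obtain ⟨m, hm, rfl⟩ := exists_primitiveRoot_pow hw ha
  have h2 := sub_one_eq_two_mul hp
  have hm0 : m ≠ 0 := by
    rintro rfl
    simp at ha1
  by_cases h : m ≤ (p - 1) / 2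
  · exact ⟨m, ⟨by omega, h⟩, Or.inl rfl⟩
  · refine ⟨p - 1 - m, ⟨by omega, by omega⟩, Or.inr ?_⟩
    rw [← pow_add, Nat.sub_add_cancel hm.le, ← orderOf_primitiveRoot hw, ← Units.val_pow_eq_pow_val,
      pow_orderOf_eq_one, Units.val_one]

lemma primitiveRoot_pow_half (hp : 3 < p) (hw : ∀ x : (ZMod p)ˣ, x ∈ Subgroup.zpowers w) :
    (w : ZMod p) ^ ((p - 1) / 2) = -1 := by
  have h2 := sub_one_eq_two_mul hp
  have h3 : ((w : ZMod p) ^ ((p - 1) / 2)) ^ 2 = 1 := by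
    rw [← pow_mul, mul_comm, ← h2, ← orderOf_primitiveRoot hw, ← Units.val_pow_eq_pow_val,
      pow_orderOf_eq_one, Units.val_one]
  exact (sq_eq_one_iff.1 h3).resolve_left
    (primitiveRoot_pow_ne_one hw hp ⟨by omega, le_rfl⟩)

end PrimitiveRoot

/-! ### Existence of a label -/

section Existence

variable {p : ℕ} {V W : Type*} [AddCommGroup V] [Module (ZMod p) V]
  [AddCommGroup W] [Module (ZMod p) W]
  [Fact p.Prime] {w : (ZMod p)ˣ} {c : V →ₗ[ZMod p] V →ₗ[ZMod p] W} {q : V →ₗ[ZMod p] W}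
  {u₁ u₂ u₃ : V}

/-- Some spanning triple satisfies the relations of some label. -/
def HasLabel (w : (ZMod p)ˣ) (c : V →ₗ[ZMod p] V →ₗ[ZMod p] W) (q : V →ₗ[ZMod p] W) : Prop :=
  ∃ l u₁ u₂ u₃, Spans3 (ZMod p) u₁ u₂ u₃ ∧ LabelRel w c q u₁ u₂ u₃ l

lemma hasLabel_of_q_eq_zero (hc : ∀ x, c x x = 0) (hW : Module.finrank (ZMod p) W = 2)
    (hu : Spans3 (ZMod p) u₁ u₂ u₃) (hq : ∀ x, q x = 0) : HasLabel w c q := by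
  suffices h : ∃ u₁ u₂ u₃, Spans3 (ZMod p) u₁ u₂ u₃ ∧ c u₃ u₂ = 0 by
    obtain ⟨u₁, u₂, u₃, hu, h⟩ := h
    exact ⟨.l1, u₁, u₂, u₃, hu, h, hq _, hq _, hq _⟩
  -- every element of the exterior square of a three-dimensional space is decomposable
  have key : ∀ {u₁ u₂ u₃ : V} {x y z : ZMod p}, Spans3 (ZMod p) u₁ u₂ u₃ → z ≠ 0 →
      x • c u₂ u₁ + y • c u₃ u₁ + z • c u₃ u₂ = 0 →
      ∃ u₁ u₂ u₃, Spans3 (ZMod p) u₁ u₂ u₃ ∧ c u₃ u₂ = 0 := by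
    intro u₁ u₂ u₃ x y z hu hz h
    refine ⟨u₁, _, _, (hu.add₂ (y / z) 0).add₃ (-(x / z)) 0, ?_⟩
    have h1 : z⁻¹ • (x • c u₂ u₁ + y • c u₃ u₁ + z • c u₃ u₂) = 0 := by rw [h, smul_zero]
    simp only [map_add, map_smul, LinearMap.add_apply, LinearMap.smul_apply, hc, zero_smul,
      smul_zero, add_zero]
    rw [alt_swap hc u₁ u₂]
    refine Eq.trans ?_ h1
    rw [smul_add, inv_smul_smul₀ hz]
    simp only [div_eq_inv_mul]
    module
  obtain ⟨x, y, z, hne, h⟩ := exists_relation₃ (K := ZMod p) hW (c u₂ u₁) (c u₃ u₁) (c u₃ u₂)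
  by_cases hz : z = 0
  · by_cases hy : y = 0
    · refine key (x := -y) (y := -z) (z := x) hu.swap₂₃.swap₁₂ (by simp_all) ?_
      rw [alt_swap hc u₁ u₃, alt_swap hc u₂ u₃, ← h]
      module
    · refine key (x := -x) (y := z) (z := y) hu.swap₁₂ hy ?_
      rw [alt_swap hc u₁ u₂, ← h]
      module
  · exact key hu hz h

/-- The case of a power map of rank one in which `u₃`, outside the kernel of `q`, is in the radical
of `c` modulo the image of `q`. -/
lemma hasLabel_of_radical_not_le (hu : Spans3 (ZMod p) u₁ u₂ u₃)
    (h₁ : q u₁ = 0) (h₂ : q u₂ = 0) {x y : ZMod p} (hx : c u₃ u₁ = x • q u₃)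
    (hy : c u₃ u₂ = y • q u₃) : HasLabel w c q := by
  have key : ∀ {u₁ u₂ u₃ : V} {x y : ZMod p}, Spans3 (ZMod p) u₁ u₂ u₃ → q u₁ = 0 → q u₂ = 0 →
      c u₃ u₁ = x • q u₃ → c u₃ u₂ = y • q u₃ → y ≠ 0 → HasLabel w c q := by
    intro u₁ u₂ u₃ x y hu h₁ h₂ hx hy hy0
    refine ⟨.l3, _, _, u₃, hu.comb₁₂ (x := y) (y := -x) (z := 0) (v := y⁻¹) ?_, ?_⟩
    · simp [hy0]
    · refine ⟨?_, ?_, by simp [h₁, h₂], by simp [h₂]⟩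
      · simp only [map_add, map_smul, hx, hy]
        module
      · simp only [map_add, map_smul, hx, hy]
        rw [zero_smul, zero_add, inv_smul_smul₀ hy0]
  by_cases hy0 : y = 0
  · by_cases hx0 : x = 0
    · exact ⟨.l2, u₁, u₂, u₃, hu, by simp [hx, hx0], by simp [hy, hy0], h₁, h₂⟩
    · exact key hu.swap₁₂ h₂ h₁ hy hx hx0
  · exact key hu h₁ h₂ hx hy hy0

/-- The case of a power map of rank one in which `u₁`, inside the kernel of `q`, is in the radical
of `c` modulo the image of `q`. -/
lemma hasLabel_of_radical_le (hu : Spans3 (ZMod p) u₁ u₂ u₃)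
    (h₁ : q u₁ = 0) (h₂ : q u₂ = 0) {x y : ZMod p} (hx : c u₂ u₁ = x • q u₃)
    (hy : c u₃ u₁ = y • q u₃) : HasLabel w c q := by
  by_cases hx0 : x = 0
  · by_cases hy0 : y = 0
    · exact ⟨.l4, u₁, u₂, u₃, hu, by simp [hx, hx0], by simp [hy, hy0], h₁, h₂⟩
    · refine ⟨.l5, _, u₂, u₃, hu.smul₁ (inv_ne_zero hy0), ?_, ?_, ?_, h₂⟩
      · simp [hx, hx0]
      · rw [map_smul, hy, inv_smul_smul₀ hy0]
      · simp [h₁]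
  · refine ⟨.l6, _, u₂, _, (hu.smul₁ (inv_ne_zero hx0)).add₃ 0 (-(y / x)), ?_, ?_, ?_, h₂⟩
    · simp [hx, h₂, hx0]
    · simp [hx, hy, hx0, smul_smul]
    · simp [h₁]

/-- Modulo the line spanned by `q u₃`, the map `c` is a nonzero alternating form on a
three-dimensional space, so its radical is a line. -/
lemma hasLabel_of_rank_one (hc : ∀ x, c x x = 0) (hcq : JointlySpan c q)
    (hW : Module.finrank (ZMod p) W = 2) (hu : Spans3 (ZMod p) u₁ u₂ u₃)
    (h₁ : q u₁ = 0) (h₂ : q u₂ = 0) (h₃ : q u₃ ≠ 0) : HasLabel w c q := by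
  -- complete `q u₃` to a basis; the coordinates along `g` define an alternating form
  obtain ⟨g, hg⟩ := exists_spans2_of_ne_zero (K := ZMod p) hW h₃
  obtain ⟨x₄, m₄, h₄⟩ := hg (c u₂ u₁)
  obtain ⟨x₅, m₅, h₅⟩ := hg (c u₃ u₁)
  obtain ⟨x₆, m₆, h₆⟩ := hg (c u₃ u₂)
  by_cases hm₄ : m₄ = 0
  · have key : ∀ {u₁ u₂ : V} {x₄ x₅ x₆ m₅ m₆ : ZMod p}, Spans3 (ZMod p) u₁ u₂ u₃ → q u₁ = 0 →
        q u₂ = 0 → c u₂ u₁ = x₄ • q u₃ → c u₃ u₁ = x₅ • q u₃ + m₅ • g →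
        c u₃ u₂ = x₆ • q u₃ + m₆ • g → m₆ ≠ 0 → HasLabel w c q := by
      intro u₁ u₂ x₄ x₅ x₆ m₅ m₆ hu h₁ h₂ h₄ h₅ h₆ hm
      have hsp := hu.comb₁₂ (x := 1) (y := -(m₅ / m₆)) (z := 0) (v := 1) (by simp)
      refine hasLabel_of_radical_le hsp (x := x₄) (y := x₅ - m₅ / m₆ * x₆) ?_ ?_ ?_ ?_
      · simp [h₁, h₂]
      · simp [h₂]
      · simp [h₄, hc]
      · simp only [map_add, map_smul, h₅, h₆, smul_add, smul_smul, one_smul, neg_mul,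
          div_mul_cancel₀ _ hm]
        module
    have h₄' : c u₂ u₁ = x₄ • q u₃ := by rw [h₄, hm₄, zero_smul, add_zero]
    by_cases hm₆ : m₆ = 0
    · by_cases hm₅ : m₅ = 0
      · have htop := eq_top_of_triple (S := Submodule.span (ZMod p) {q u₃}) hc hcq hu
          (Submodule.mem_span_singleton.2 ⟨x₄, by simp [h₄']⟩)
          (Submodule.mem_span_singleton.2 ⟨x₅, by simp [h₅, hm₅]⟩)
          (Submodule.mem_span_singleton.2 ⟨x₆, by simp [h₆, hm₆]⟩)
          (by simp [h₁]) (by simp [h₂]) (Submodule.mem_span_singleton_self _)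
        have hfin := finrank_span_singleton (K := ZMod p) h₃
        rw [htop, finrank_top] at hfin
        omega
      · exact key (x₄ := -x₄) hu.swap₁₂ h₂ h₁ (by rw [alt_swap hc, h₄', neg_smul]) h₆ h₅ hm₅
    · exact key hu h₁ h₂ h₄' h₅ h₆ hm₆
  · refine hasLabel_of_radical_not_le (hu.add₃ (m₆ / m₄) (-(m₅ / m₄))) h₁ h₂
      (x := x₅ - m₅ / m₄ * x₄) (y := x₆ - m₆ / m₄ * x₄) ?_ ?_
    · simp only [map_add, map_smul, LinearMap.add_apply, LinearMap.smul_apply, hc, h₁, h₂, h₄, h₅,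
        smul_add, smul_smul, neg_mul, div_mul_cancel₀ _ hm₄]
      module
    · simp only [map_add, map_smul, LinearMap.add_apply, LinearMap.smul_apply, hc, h₁, h₂, h₆,
        alt_swap hc u₁ u₂, h₄, smul_add, smul_neg, smul_smul, div_mul_cancel₀ _ hm₄]
      module

/-- The triple spans, `q` kills its first vector, `c` kills the pair of the other two, and
`c · u₁` has the matrix with rows `(α, β)`, `(γ, δ)` with respect to `q u₂`, `q u₃`. -/
structure HasMatrix (c : V →ₗ[ZMod p] V →ₗ[ZMod p] W) (q : V →ₗ[ZMod p] W) (u₁ u₂ u₃ : V)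
    (α β γ δ : ZMod p) : Prop where
  spans : Spans3 (ZMod p) u₁ u₂ u₃
  q₁ : q u₁ = 0
  c₃₂ : c u₃ u₂ = 0
  c₂₁ : c u₂ u₁ = α • q u₂ + β • q u₃
  c₃₁ : c u₃ u₁ = γ • q u₂ + δ • q u₃

lemma HasMatrix.scale {α β γ δ : ZMod p} (h : HasMatrix c q u₁ u₂ u₃ α β γ δ) {s : ZMod p}
    (hs : s ≠ 0) : HasMatrix c q (s • u₁) u₂ u₃ (s * α) (s * β) (s * γ) (s * δ) where
  spans := h.spans.smul₁ hs
  q₁ := by simp [h.q₁]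
  c₃₂ := h.c₃₂
  c₂₁ := by simp [h.c₂₁, smul_smul]
  c₃₁ := by simp [h.c₃₁, smul_smul]

/-- A change of the last two vectors conjugates the matrix. -/
lemma HasMatrix.conj (hc : ∀ x, c x x = 0) {α β γ δ α' β' γ' δ' x y z v : ZMod p}
    (h : HasMatrix c q u₁ u₂ u₃ α β γ δ) (hD : x * v - y * z ≠ 0)
    (h₁ : α' * x + β' * z = x * α + y * γ) (h₂ : α' * y + β' * v = x * β + y * δ)
    (h₃ : γ' * x + δ' * z = z * α + v * γ) (h₄ : γ' * y + δ' * v = z * β + v * δ) :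
    HasMatrix c q u₁ (x • u₂ + y • u₃) (z • u₂ + v • u₃) α' β' γ' δ' where
  spans := h.spans.comb₂₃ hD
  q₁ := h.q₁
  c₃₂ := by
    simp only [map_add, map_smul, LinearMap.add_apply, LinearMap.smul_apply, hc, h.c₃₂,
      alt_swap hc u₂ u₃]
    simp
  c₂₁ := by
    simp only [map_add, map_smul, LinearMap.add_apply, LinearMap.smul_apply, h.c₂₁, h.c₃₁]
    have e : x • (α • q u₂ + β • q u₃) + y • (γ • q u₂ + δ • q u₃) =
        (x * α + y * γ) • q u₂ + (x * β + y * δ) • q u₃ := by module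
    rw [e, ← h₁, ← h₂]
    module
  c₃₁ := by
    simp only [map_add, map_smul, LinearMap.add_apply, LinearMap.smul_apply, h.c₂₁, h.c₃₁]
    have e : z • (α • q u₂ + β • q u₃) + v • (γ • q u₂ + δ • q u₃) =
        (z * α + v * γ) • q u₂ + (z * β + v * δ) • q u₃ := by module
    rw [e, ← h₃, ← h₄]
    module

/-- A matrix that is not scalar can be brought into companion form. -/
lemma HasMatrix.exists_companion (hc : ∀ x, c x x = 0) {α β γ δ : ZMod p}
    (h : HasMatrix c q u₁ u₂ u₃ α β γ δ) (hns : ¬(β = 0 ∧ γ = 0 ∧ α = δ)) :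
    ∃ v₂ v₃, HasMatrix c q u₁ v₂ v₃ 0 1 (-(α * δ - β * γ)) (α + δ) := by
  -- `(x, y)` is a cyclic row vector
  obtain ⟨x, y, hxy⟩ : ∃ x y : ZMod p, x * (x * β + y * δ) - y * (x * α + y * γ) ≠ 0 := by
    by_cases hβ : β = 0
    · by_cases hγ : γ = 0
      · refine ⟨1, 1, ?_⟩
        have : α ≠ δ := fun e => hns ⟨hβ, hγ, e⟩
        intro e
        apply this
        rw [hβ, hγ] at e
        linear_combination -e
      · exact ⟨0, 1, by simpa using hγ⟩
    · exact ⟨1, 0, by simpa using hβ⟩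
  exact ⟨_, _, h.conj hc hxy (by ring) (by ring) (by ring) (by ring)⟩

/-- Up to scaling, trace and determinant determine a matrix that is not scalar. -/
lemma HasMatrix.exists_of_trace_det (hc : ∀ x, c x x = 0) {α β γ δ α' β' γ' δ' s : ZMod p}
    (h : HasMatrix c q u₁ u₂ u₃ α β γ δ) (hns : ¬(β = 0 ∧ γ = 0 ∧ α = δ)) (hs : s ≠ 0)
    (htr : α' + δ' = s * (α + δ)) (hdet : α' * δ' - β' * γ' = s ^ 2 * (α * δ - β * γ))
    (hns' : β' ≠ 0 ∨ (β' = 0 ∧ γ' = 0 ∧ α' ≠ δ')) :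
    ∃ v₁ v₂ v₃, HasMatrix c q v₁ v₂ v₃ α' β' γ' δ' := by
  obtain ⟨v₂, v₃, hv⟩ := (h.scale hs).exists_companion hc (by simpa [hs] using hns)
  have htr' : s * α + s * δ = α' + δ' := by linear_combination -htr
  have hdet' : -(s * α * (s * δ) - s * β * (s * γ)) = -(α' * δ' - β' * γ') := by
    linear_combination hdet
  rw [htr', hdet'] at hv
  rcases hns' with hβ | ⟨hβ, hγ, hne⟩
  · refine ⟨_, _, _, hv.conj hc (x := 1) (y := 0) (z := -(α' / β')) (v := 1 / β')
      (by simpa using hβ) ?_ ?_ ?_ ?_⟩ <;> field_simp <;> ring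
  · subst hβ hγ
    refine ⟨_, _, _, hv.conj hc (x := -δ') (y := 1) (z := -α') (v := 1)
      (fun e => hne (by linear_combination e)) ?_ ?_ ?_ ?_⟩ <;> ring

/-- The pairs (trace, determinant) of the listed matrices that are not scalar represent all such
pairs up to scaling. -/
lemma HasMatrix.hasLabel (hp : 3 < p) (hw : ∀ x : (ZMod p)ˣ, x ∈ Subgroup.zpowers w)
    (hc : ∀ x, c x x = 0) {α β γ δ : ZMod p} (h : HasMatrix c q u₁ u₂ u₃ α β γ δ) :
    HasLabel w c q := by
  have h2 := two_ne_zero_of_three_lt hp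
  by_cases hns : β = 0 ∧ γ = 0 ∧ α = δ
  · obtain ⟨rfl, rfl, rfl⟩ := hns
    by_cases hα : α = 0
    · subst hα
      exact ⟨.l10, u₁, u₂, u₃, h.spans, by simp [h.c₂₁], by simp [h.c₃₁], h.c₃₂, h.q₁⟩
    · have h' := h.scale (inv_ne_zero hα)
      exact ⟨.l11, _, u₂, u₃, h'.spans, by simp [h.c₂₁, smul_smul, hα],
        by simp [h.c₃₁, smul_smul, hα], h'.c₃₂, h'.q₁⟩
  have key : ∀ (α' β' γ' δ' s : ZMod p), s ≠ 0 → α' + δ' = s * (α + δ) →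
      α' * δ' - β' * γ' = s ^ 2 * (α * δ - β * γ) →
      (β' ≠ 0 ∨ (β' = 0 ∧ γ' = 0 ∧ α' ≠ δ')) →
      ∃ v₁ v₂ v₃, HasMatrix c q v₁ v₂ v₃ α' β' γ' δ' := fun α' β' γ' δ' s hs htr hdet hns' =>
    h.exists_of_trace_det hc hns hs htr hdet hns'
  generalize α + δ = t at key
  generalize α * δ - β * γ = d at key
  clear h hns
  by_cases hd : d = 0
  · subst hd
    by_cases ht : t = 0
    · subst ht
      obtain ⟨v₁, v₂, v₃, hv⟩ := key 0 1 0 0 1 one_ne_zero (by simp) (by simp) (by simp)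
      exact ⟨.l12, v₁, v₂, v₃, hv.spans, by simp [hv.c₂₁], by simp [hv.c₃₁], hv.c₃₂, hv.q₁⟩
    · obtain ⟨v₁, v₂, v₃, hv⟩ := key 0 0 0 1 t⁻¹ (by simpa) (by simp [ht]) (by simp) (by simp)
      exact ⟨.l14, v₁, v₂, v₃, hv.spans, by simp [hv.c₂₁], by simp [hv.c₃₁], hv.c₃₂, hv.q₁⟩
  have key₁₅ : ∀ (k : ℕ) (hk : k ∈ Set.Icc 1 ((p - 1) / 2)) (s : ZMod p), s ≠ 0 →
      1 + (w : ZMod p) ^ k = s * t → (w : ZMod p) ^ k = s ^ 2 * d → HasLabel w c q := by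
    intro k hk s hs ht hd
    obtain ⟨v₁, v₂, v₃, hv⟩ := key 1 0 0 ((w : ZMod p) ^ k) s hs ht (by rw [← hd]; ring)
      (Or.inr ⟨rfl, rfl, (primitiveRoot_pow_ne_one hw hp hk).symm⟩)
    exact ⟨.l15 ⟨k, hk⟩, v₁, v₂, v₃, hv.spans, by simp [hv.c₂₁], by simp [hv.c₃₁], hv.c₃₂, hv.q₁⟩
  by_cases ht : t = 0
  · subst ht
    by_cases hsq : ∃ r, -d = r ^ 2
    · -- the matrix is diagonalizable with eigenvalues `r` and `-r`
      obtain ⟨r, hr⟩ := hsq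
      have hr0 : r ≠ 0 := by
        rintro rfl
        exact hd (by linear_combination -hr)
      have h3 := sub_one_eq_two_mul hp
      refine key₁₅ ((p - 1) / 2) ⟨by omega, le_rfl⟩ r⁻¹ (inv_ne_zero hr0) ?_ ?_
      · rw [primitiveRoot_pow_half hp hw]; ring
      · rw [primitiveRoot_pow_half hp hw, inv_pow, eq_inv_mul_iff_mul_eq₀ (pow_ne_zero 2 hr0)]
        linear_combination hr
    · push Not at hsq
      obtain ⟨k, hk, hkd⟩ := exists_eq_odd_pow_of_not_sq hp hw hsq
      have hw0 : (w : ZMod p) ^ (k - 1) ≠ 0 := pow_ne_zero _ w.ne_zero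
      have hkd' : -d = w * ((w : ZMod p) ^ (k - 1)) ^ 2 := by
        rw [hkd, ← pow_mul, ← pow_succ']
        congr 1
        have := hk.1
        omega
      obtain ⟨v₁, v₂, v₃, hv⟩ := key 0 w 1 0 ((w : ZMod p) ^ (k - 1))⁻¹ (inv_ne_zero hw0)
        (by simp) (by
          rw [inv_pow, eq_inv_mul_iff_mul_eq₀ (pow_ne_zero 2 hw0)]
          linear_combination hkd') (by simp)
      exact ⟨.l16, v₁, v₂, v₃, hv.spans, by simp [hv.c₂₁], by simp [hv.c₃₁], hv.c₃₂, hv.q₁⟩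
  -- scale the trace to `2`; then `e` is a quarter of the discriminant
  obtain ⟨s, hs, hst⟩ : ∃ s : ZMod p, s ≠ 0 ∧ s * t = 2 :=
    ⟨2 / t, div_ne_zero h2 ht, div_mul_cancel₀ _ ht⟩
  obtain ⟨e, he⟩ : ∃ e, e = 1 - s ^ 2 * d := ⟨_, rfl⟩
  by_cases hsq : ∃ r, e = r ^ 2
  · obtain ⟨r, hr⟩ := hsq
    by_cases hr0 : r = 0
    · subst hr0
      obtain ⟨v₁, v₂, v₃, hv⟩ := key 1 1 0 1 s hs (by rw [hst]; norm_num)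
        (by linear_combination hr - he) (by simp)
      exact ⟨.l13, v₁, v₂, v₃, hv.spans, by simp [hv.c₂₁], by simp [hv.c₃₁], hv.c₃₂, hv.q₁⟩
    · -- the scaled matrix is diagonalizable with eigenvalues `1 + r` and `1 - r`
      have hprod : (1 + r) * (1 - r) = s ^ 2 * d := by linear_combination hr - he
      have hprod0 : (1 + r) * (1 - r) ≠ 0 := by
        rw [hprod]
        exact mul_ne_zero (pow_ne_zero 2 hs) hd
      have hp1 := left_ne_zero_of_mul hprod0
      have hm1 := right_ne_zero_of_mul hprod0
      obtain ⟨k, hk, hkr | hkr⟩ := exists_eq_pow_or_inv hp hw (a := (1 - r) / (1 + r))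
        (div_ne_zero hm1 hp1) (by
          rw [Ne, div_eq_one_iff_eq hp1]
          intro h
          exact hr0 ((mul_eq_zero.1 (show 2 * r = 0 by linear_combination -h)).resolve_left h2))
      · rw [eq_div_iff hp1] at hkr
        refine key₁₅ k hk (s / (1 + r)) (div_ne_zero hs hp1) ?_ ?_
        · rw [div_mul_eq_mul_div, hst, eq_div_iff hp1]
          linear_combination hkr
        · rw [div_pow, div_mul_eq_mul_div, ← hprod, eq_div_iff (pow_ne_zero 2 hp1)]
          linear_combination (1 + r) * hkr
      · rw [mul_div_assoc', div_eq_one_iff_eq hp1] at hkr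
        refine key₁₅ k hk (s / (1 - r)) (div_ne_zero hs hm1) ?_ ?_
        · rw [div_mul_eq_mul_div, hst, eq_div_iff hm1]
          linear_combination hkr
        · rw [div_pow, div_mul_eq_mul_div, ← hprod, eq_div_iff (pow_ne_zero 2 hm1)]
          linear_combination (1 - r) * hkr
  · push Not at hsq
    obtain ⟨k, hk, hke⟩ := exists_eq_odd_pow_of_not_sq hp hw hsq
    have hmul : (w : ZMod p) ^ k * (w : ZMod p) ^ (k - 1) = (w : ZMod p) ^ (2 * k - 1) := by
      rw [← pow_add]
      congr 1
      have := hk.1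
      omega
    obtain ⟨v₁, v₂, v₃, hv⟩ := key 1 ((w : ZMod p) ^ k) ((w : ZMod p) ^ (k - 1)) 1 s hs
      (by rw [hst]; norm_num) (by rw [hmul, ← hke, he]; ring)
      (Or.inl (pow_ne_zero _ w.ne_zero))
    exact ⟨.l17 ⟨k, hk⟩, v₁, v₂, v₃, hv.spans, by simp [hv.c₂₁], by simp [hv.c₃₁], hv.c₃₂, hv.q₁⟩

lemma hasLabel_of_nilpotent (hu : Spans3 (ZMod p) u₁ u₂ u₃) (h₁ : q u₁ = 0) (h₂₁ : c u₂ u₁ = 0)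
    {γ ζ : ZMod p} (hγ : γ ≠ 0) (hζ : ζ ≠ 0) (h₃₁ : c u₃ u₁ = γ • q u₂)
    (h₃₂ : c u₃ u₂ = ζ • q u₃) : HasLabel w c q := by
  refine ⟨.l8, (γ * ζ)⁻¹ • u₁, ζ⁻¹ • u₂, u₃,
    (hu.smul₁ (inv_ne_zero (mul_ne_zero hγ hζ))).smul₂ (inv_ne_zero hζ), ?_, ?_, ?_, ?_⟩
  · simp [h₂₁]
  · rw [map_smul, h₃₁, map_smul, smul_smul, mul_inv, mul_right_comm, inv_mul_cancel₀ hγ, one_mul]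
  · rw [map_smul, h₃₂, inv_smul_smul₀ hζ]
  · simp [h₁]

lemma hasLabel_of_idempotent (hu : Spans3 (ZMod p) u₁ u₂ u₃) (h₁ : q u₁ = 0) (h₃₁ : c u₃ u₁ = 0)
    {α ζ : ZMod p} (hα : α ≠ 0) (hζ : ζ ≠ 0) (h₂₁ : c u₂ u₁ = α • q u₂)
    (h₃₂ : c u₃ u₂ = ζ • q u₃) : HasLabel w c q := by
  refine ⟨.l9, α⁻¹ • u₁, ζ⁻¹ • u₂, u₃,
    (hu.smul₁ (inv_ne_zero hα)).smul₂ (inv_ne_zero hζ), ?_, ?_, ?_, ?_⟩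
  · rw [map_smul, map_smul, LinearMap.smul_apply, h₂₁, map_smul, smul_comm, inv_smul_smul₀ hα]
  · simp [h₃₁]
  · rw [map_smul, h₃₂, inv_smul_smul₀ hζ]
  · simp [h₁]

/-- The case in which `c u₃ u₂` is not in the image of `c · u₁`. This image is at most a line, so
that `u₂, u₃` can be adapted to the kernel. -/
lemma hasLabel_of_not_mem_image (hc : ∀ x, c x x = 0) (hu : Spans3 (ZMod p) u₁ u₂ u₃)
    (h₁ : q u₁ = 0) (hq : Spans2 (ZMod p) (q u₂) (q u₃)) (h₃₁ : c u₃ u₁ = 0)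
    (hn : ∀ s : ZMod p, c u₃ u₂ ≠ s • c u₂ u₁) : HasLabel w c q := by
  obtain ⟨α, β, hαβ⟩ := hq (c u₂ u₁)
  obtain ⟨ε, ζ, hεζ⟩ := hq (c u₃ u₂)
  by_cases hα : α = 0
  · rw [hα, zero_smul, zero_add] at hαβ
    by_cases hβ : β = 0
    · rw [hβ, zero_smul] at hαβ
      by_cases hε : ε = 0
      · have hζ : ζ ≠ 0 := by
          rintro rfl
          exact hn 0 (by simp [hεζ, hε])
        exact ⟨.l7, u₁, _, u₃, hu.smul₂ (inv_ne_zero hζ), by simp [hαβ], h₃₁,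
          by simp [hεζ, hζ, hε], h₁⟩
      · refine ⟨.l7, u₁, _, _, hu.comb₂₃ (x := 0) (y := -ε⁻¹) (z := ε) (v := ζ)
          (by simp [hε]), ?_, ?_, ?_, h₁⟩
        · simp [h₃₁]
        · simp [hαβ, h₃₁]
        · simp only [map_add, map_smul, LinearMap.add_apply, LinearMap.smul_apply, hc,
            alt_swap hc u₂ u₃, map_neg, zero_smul, smul_zero, add_zero, zero_add, neg_smul,
            smul_neg, neg_neg]
          rw [inv_smul_smul₀ hε, hεζ]
    · -- the image and the kernel are spanned by `q u₃`
      have hε : ε ≠ 0 := by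
        rintro rfl
        refine hn (ζ * β⁻¹) ?_
        rw [hαβ, hεζ, zero_smul, zero_add, smul_smul, inv_mul_cancel_right₀ hβ]
      refine hasLabel_of_nilpotent (hu.swap₂₃.add₂ (ζ / β) 0) h₁ (γ := β) (ζ := -ε) ?_ hβ
        (neg_ne_zero.2 hε) ?_ ?_
      · simp [h₃₁, hc]
      · simp [hαβ, h₁]
      · simp only [map_add, map_smul, hαβ, alt_swap hc u₂ u₃, hεζ, zero_smul, add_zero, smul_smul,
          div_mul_cancel₀ _ hβ]
        module
  · -- `α` is an eigenvalue, and `α • q u₂ + β • q u₃` is an eigenvector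
    have hζ : ζ - ε / α * β ≠ 0 := by
      intro h
      refine hn (ε / α) ?_
      rw [hεζ, hαβ, smul_add, smul_smul, smul_smul, div_mul_cancel₀ _ hα, sub_eq_zero.1 h]
    refine hasLabel_of_idempotent
      ((hu.comb₂₃ (x := α) (y := β) (z := 0) (v := 1) (by simp [hα])).add₃ (ε / α) 0) h₁
      (α := α) (ζ := α * (ζ - ε / α * β)) ?_ hα (mul_ne_zero hα hζ) ?_ ?_
    · simp [h₃₁, hc]
    · simp [h₃₁, hαβ]
    · simp only [map_add, map_smul, LinearMap.add_apply, LinearMap.smul_apply, hc, h₁, h₃₁, hεζ,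
        alt_swap hc u₁ u₂, alt_swap hc u₁ u₃, hαβ, zero_smul, add_zero, zero_add, one_smul,
        smul_zero, neg_zero]
      have h : ε = ε / α * α := (div_mul_cancel₀ _ hα).symm
      nth_rw 1 [h]
      module

/-- If `c u₃ u₂` is in the image of `c · u₁`, then multiples of `u₁` can be added to `u₂, u₃` so
that `c u₃ u₂ = 0`, and only the matrix of `c · u₁` matters. -/
lemma hasLabel_of_rank_two (hp : 3 < p) (hw : ∀ x : (ZMod p)ˣ, x ∈ Subgroup.zpowers w)
    (hc : ∀ x, c x x = 0) (hW : Module.finrank (ZMod p) W = 2)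
    (hu : Spans3 (ZMod p) u₁ u₂ u₃) (h₁ : q u₁ = 0) (hq : Spans2 (ZMod p) (q u₂) (q u₃)) :
    HasLabel w c q := by
  by_cases himg : ∃ s t : ZMod p, c u₃ u₂ = s • c u₂ u₁ + t • c u₃ u₁
  · obtain ⟨s, t, hst⟩ := himg
    have hu' := (hu.add₂ (-t) 0).add₃ s 0
    obtain ⟨α, β, hαβ⟩ := hq (c u₂ u₁)
    obtain ⟨γ, δ, hγδ⟩ := hq (c u₃ u₁)
    refine HasMatrix.hasLabel hp hw hc (α := α) (β := β) (γ := γ) (δ := δ) ⟨hu', h₁, ?_, ?_, ?_⟩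
    · simp only [map_add, map_smul, LinearMap.add_apply, LinearMap.smul_apply, hc, hst,
        alt_swap hc u₁ u₂, zero_smul, smul_zero, add_zero]
      module
    · simpa [h₁, hc] using hαβ
    · simpa [h₁, hc] using hγδ
  · push Not at himg
    rcases dependent_or_spans2 (K := ZMod p) hW (c u₂ u₁) (c u₃ u₁) with ⟨x, y, hne, hxy⟩ | hsp
    · by_cases hy : y = 0
      · have hx : x ≠ 0 := hne.resolve_right (by simp [hy])
        rw [hy, zero_smul, add_zero] at hxy
        refine hasLabel_of_not_mem_image hc hu.swap₂₃ h₁ hq.swap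
          ((smul_eq_zero.1 hxy).resolve_left hx) fun s h => himg 0 (-s) ?_
        rw [alt_swap hc, h]
        simp
      · have hu' := hu.comb₂₃ (x := 1) (y := 0) (z := x) (v := y) (by simpa using hy)
        refine hasLabel_of_not_mem_image hc hu' h₁ ?_ (by simpa using hxy) fun s h =>
          himg (s / y) 0 ?_
        · intro v
          obtain ⟨a, b, rfl⟩ := hq v
          refine ⟨a - b / y * x, b / y, ?_⟩
          simp only [map_add, map_smul, zero_smul, add_zero, one_smul, smul_add, smul_smul,
            div_mul_cancel₀ _ hy]
          module
        · simp only [map_add, map_smul, LinearMap.add_apply, LinearMap.smul_apply, hc, one_smul,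
            zero_smul, add_zero, smul_zero, zero_add] at h
          rw [zero_smul, add_zero, div_eq_inv_mul, mul_smul, ← h, inv_smul_smul₀ hy]
    · obtain ⟨s, t, hst⟩ := hsp (c u₃ u₂)
      exact absurd hst (himg s t)

/-- Every pair of an alternating map and a linear map that jointly span a plane satisfies the
relations of some label. -/
theorem exists_label (hp : 3 < p) (hw : ∀ x : (ZMod p)ˣ, x ∈ Subgroup.zpowers w)
    (hc : ∀ x, c x x = 0) (hcq : JointlySpan c q) (hV : Module.finrank (ZMod p) V = 3)
    (hW : Module.finrank (ZMod p) W = 2) : HasLabel w c q := by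
  obtain ⟨a₁, a₂, a₃, ha⟩ : ∃ a₁ a₂ a₃ : V, Spans3 (ZMod p) a₁ a₂ a₃ := by
    have : Module.Finite (ZMod p) V := Module.finite_of_finrank_pos (by omega)
    have b := Module.finBasisOfFinrankEq (ZMod p) V hV
    refine ⟨b 0, b 1, b 2, fun v => ⟨b.repr v 0, b.repr v 1, b.repr v 2, ?_⟩⟩
    conv_lhs => rw [← b.sum_repr v]
    rw [Fin.sum_univ_three]
  obtain ⟨v, hv, hv0⟩ : ∃ v, q v = 0 ∧ v ≠ 0 := by
    obtain ⟨x, y, z, hne, h⟩ := exists_relation₃ (K := ZMod p) hW (q a₁) (q a₂) (q a₃)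
    refine ⟨x • a₁ + y • a₂ + z • a₃, by simpa using h, fun h0 => ?_⟩
    have := ha.indep hV h0
    tauto
  obtain ⟨u₂, u₃, hu⟩ := ha.exists_of_ne_zero hv0
  have key : ∀ {u₁ u₂ u₃ : V}, Spans3 (ZMod p) u₁ u₂ u₃ → q u₁ = 0 → q u₂ = 0 →
      HasLabel w c q := by
    intro u₁ u₂ u₃ hu h₁ h₂
    by_cases h₃ : q u₃ = 0
    · refine hasLabel_of_q_eq_zero hc hW hu fun x => ?_
      obtain ⟨a, b, d, rfl⟩ := hu x
      simp [h₁, h₂, h₃]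
    · exact hasLabel_of_rank_one hc hcq hW hu h₁ h₂ h₃
  rcases dependent_or_spans2 (K := ZMod p) hW (q u₂) (q u₃) with ⟨x, y, hne, hxy⟩ | hsp
  · by_cases hx : x = 0
    · have hy := hne.resolve_left (by simp [hx])
      rw [hx, zero_smul, zero_add] at hxy
      exact key hu.swap₂₃ hv ((smul_eq_zero.1 hxy).resolve_left hy)
    · exact key (hu.comb₂₃ (x := x) (y := y) (z := 0) (v := 1) (by simpa using hx)) hv
        (by simpa using hxy)
  · exact hasLabel_of_rank_two hp hw hc hW hu hv hsp

end Existence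

/-! ### Uniqueness of the label -/

section Uniqueness

variable {p : ℕ} {V W : Type*} [AddCommGroup V] [Module (ZMod p) V]
  [AddCommGroup W] [Module (ZMod p) W]
  [Fact p.Prime] {w : (ZMod p)ˣ} {c : V →ₗ[ZMod p] V →ₗ[ZMod p] W} {q : V →ₗ[ZMod p] W}
  {u₁ u₂ u₃ u₁' u₂' u₃' : V} {l l' : DescLabel p}

/-- The rank of the power map `q` for a triple that satisfies the relations of the label. -/
def DescLabel.powerRank : DescLabel p → ℕ
  | .l1 => 0
  | .l2 | .l3 | .l4 | .l5 | .l6 => 1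
  | _ => 2

/-- The matrix `(α, β, γ, δ)` of `c · u₁` with respect to `q u₂, q u₃` prescribed by a label of
power rank two (and `0` for the other labels). -/
def DescLabel.matrix (w : (ZMod p)ˣ) : DescLabel p → ZMod p × ZMod p × ZMod p × ZMod p
  | .l8 => (0, 0, 1, 0)
  | .l9 => (1, 0, 0, 0)
  | .l11 => (1, 0, 0, 1)
  | .l12 => (0, 1, 0, 0)
  | .l13 => (1, 1, 0, 1)
  | .l14 => (0, 0, 0, 1)
  | .l15 k => (1, 0, 0, (w : ZMod p) ^ (k : ℕ))
  | .l16 => (0, w, 1, 0)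
  | .l17 k => (1, (w : ZMod p) ^ (k : ℕ), (w : ZMod p) ^ ((k : ℕ) - 1), 1)
  | _ => (0, 0, 0, 0)

/-- The trace of the matrix of a label. -/
def DescLabel.trace (w : (ZMod p)ˣ) (l : DescLabel p) : ZMod p :=
  (l.matrix w).1 + (l.matrix w).2.2.2

/-- The determinant of the matrix of a label. -/
def DescLabel.det (w : (ZMod p)ˣ) (l : DescLabel p) : ZMod p :=
  (l.matrix w).1 * (l.matrix w).2.2.2 - (l.matrix w).2.1 * (l.matrix w).2.2.1

/-- If the span of two vectors contains the values of `c` and `q` on a spanning triple, it is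
everything. -/
lemma spans2_of_triple (hc : ∀ x, c x x = 0) (hcq : JointlySpan c q)
    (hu : Spans3 (ZMod p) u₁ u₂ u₃) (a b : W)
    (h₂₁ : c u₂ u₁ ∈ Submodule.span (ZMod p) {a, b})
    (h₃₁ : c u₃ u₁ ∈ Submodule.span (ZMod p) {a, b})
    (h₃₂ : c u₃ u₂ ∈ Submodule.span (ZMod p) {a, b})
    (h₁ : q u₁ ∈ Submodule.span (ZMod p) {a, b})
    (h₂ : q u₂ ∈ Submodule.span (ZMod p) {a, b})
    (h₃ : q u₃ ∈ Submodule.span (ZMod p) {a, b}) : Spans2 (ZMod p) a b := fun v => by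
  have h : v ∈ Submodule.span (ZMod p) {a, b} := by
    rw [eq_top_of_triple hc hcq hu h₂₁ h₃₁ h₃₂ h₁ h₂ h₃]
    exact Submodule.mem_top
  obtain ⟨x, y, h⟩ := Submodule.mem_span_pair.1 h
  exact ⟨x, y, h.symm⟩

lemma mem_span_left (a b : W) : a ∈ Submodule.span (ZMod p) {a, b} :=
  Submodule.subset_span (by simp)

lemma mem_span_right (a b : W) : b ∈ Submodule.span (ZMod p) {a, b} :=
  Submodule.subset_span (by simp)

lemma LabelRel.spans2_of_powerRank_two (hc : ∀ x, c x x = 0) (hcq : JointlySpan c q)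
    (hu : Spans3 (ZMod p) u₁ u₂ u₃) (hl : l.powerRank = 2) (h : LabelRel w c q u₁ u₂ u₃ l) :
    Spans2 (ZMod p) (q u₂) (q u₃) := by
  have hL := mem_span_left (p := p) (q u₂) (q u₃)
  have hR := mem_span_right (p := p) (q u₂) (q u₃)
  refine spans2_of_triple hc hcq hu _ _ ?_ ?_ ?_ ?_ hL hR <;> cases l <;>
    simp only [DescLabel.powerRank, LabelRel, OfNat.zero_ne_ofNat,
      OfNat.one_ne_ofNat] at hl h <;>
    simp only [h, zero_mem, hL, hR, add_mem, Submodule.smul_mem]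

open scoped Classical in
lemma LabelRel.spans2_of_powerRank_one (hc : ∀ x, c x x = 0) (hcq : JointlySpan c q)
    (hu : Spans3 (ZMod p) u₁ u₂ u₃) (hl : l.powerRank = 1) (h : LabelRel w c q u₁ u₂ u₃ l) :
    Spans2 (ZMod p) (q u₃) (if l = .l2 ∨ l = .l3 then c u₂ u₁ else c u₃ u₂) := by
  cases l <;> simp only [DescLabel.powerRank, LabelRel,
      zero_ne_one, OfNat.ofNat_ne_one] at hl h <;>
    simp only [reduceCtorEq, or_self, or_true, or_false, if_true, if_false] <;>
    refine spans2_of_triple hc hcq hu _ _ ?_ ?_ ?_ ?_ ?_ ?_ <;>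
    simp only [h, zero_mem, mem_span_left, mem_span_right]

lemma LabelRel.spans2_of_powerRank_zero (hc : ∀ x, c x x = 0) (hcq : JointlySpan c q)
    (hu : Spans3 (ZMod p) u₁ u₂ u₃) (h : LabelRel w c q u₁ u₂ u₃ .l1) :
    Spans2 (ZMod p) (c u₂ u₁) (c u₃ u₁) := by
  simp only [LabelRel] at h
  refine spans2_of_triple hc hcq hu _ _ ?_ ?_ ?_ ?_ ?_ ?_ <;>
    simp only [h, zero_mem, mem_span_left, mem_span_right]

lemma LabelRel.q₁ (h : LabelRel w c q u₁ u₂ u₃ l) : q u₁ = 0 := by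
  cases l <;> simp only [LabelRel] at h <;> simp only [h]

lemma LabelRel.q₂ (hl : l.powerRank ≠ 2) (h : LabelRel w c q u₁ u₂ u₃ l) : q u₂ = 0 := by
  cases l <;> simp only [LabelRel, DescLabel.powerRank, ne_eq, not_true] at h hl <;> simp only [h]

lemma LabelRel.finrank_range (hc : ∀ x, c x x = 0) (hcq : JointlySpan c q)
    (hW : Module.finrank (ZMod p) W = 2)
    (hu : Spans3 (ZMod p) u₁ u₂ u₃) (h : LabelRel w c q u₁ u₂ u₃ l) :
    Module.finrank (ZMod p) (LinearMap.range q) = l.powerRank := by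
  have hr : l.powerRank = 0 ∨ l.powerRank = 1 ∨ l.powerRank = 2 := by
    cases l <;> simp [DescLabel.powerRank]
  rcases hr with hl | hl | hl
  · have hq : q = 0 := by
      cases l <;> simp only [DescLabel.powerRank, LabelRel, OfNat.ofNat_ne_zero,
        one_ne_zero] at hl h
      ext x
      obtain ⟨a, b, d, rfl⟩ := hu x
      simp [h]
    rw [hl, hq, LinearMap.range_zero, finrank_bot]
  · have hsp := h.spans2_of_powerRank_one hc hcq hu hl
    have h3 : q u₃ ≠ 0 := fun h0 => one_ne_zero (hsp.indep hW (x := 1) (y := 0) (by simp [h0])).1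
    have h1 := h.q₁
    have h2 := h.q₂ (by omega)
    have hr : LinearMap.range q = Submodule.span (ZMod p) {q u₃} := by
      refine le_antisymm ?_ ?_
      · rintro _ ⟨x, rfl⟩
        obtain ⟨a, b, d, rfl⟩ := hu x
        exact Submodule.mem_span_singleton.2 ⟨d, by simp [h1, h2]⟩
      · rw [Submodule.span_singleton_le_iff_mem]
        exact ⟨u₃, rfl⟩
    rw [hl, hr, finrank_span_singleton h3]
  · have hsp := h.spans2_of_powerRank_two hc hcq hu hl
    have : LinearMap.range q = ⊤ := by
      refine eq_top_iff.2 fun v _ => ?_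
      obtain ⟨x, y, rfl⟩ := hsp v
      exact ⟨x • u₂ + y • u₃, by simp⟩
    rw [hl, this, finrank_top, hW]

/-! #### Power rank one -/

lemma mem_ker_of_rank_one (hu : Spans3 (ZMod p) u₁ u₂ u₃) (h₁ : q u₁ = 0) (h₂ : q u₂ = 0)
    (h₃ : q u₃ ≠ 0) {k : V} (hk : q k = 0) : ∃ x y : ZMod p, k = x • u₁ + y • u₂ := by
  obtain ⟨x, y, z, rfl⟩ := hu k
  have hz : z = 0 := by simpa [h₁, h₂, h₃] using hk
  exact ⟨x, y, by rw [hz]; simp⟩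

lemma c_combination (hc : ∀ x, c x x = 0) (x y x' y' : ZMod p) :
    c (x • u₁ + y • u₂) (x' • u₁ + y' • u₂) = (y * x' - x * y') • c u₂ u₁ := by
  simp only [map_add, map_smul, LinearMap.add_apply, LinearMap.smul_apply, hc, alt_swap hc u₁ u₂]
  module

lemma LabelRel.eq_of_powerRank_one (hc : ∀ x, c x x = 0) (hcq : JointlySpan c q)
    (hV : Module.finrank (ZMod p) V = 3) (hW : Module.finrank (ZMod p) W = 2)
    (hu : Spans3 (ZMod p) u₁ u₂ u₃) (hu' : Spans3 (ZMod p) u₁' u₂' u₃')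
    (h : LabelRel w c q u₁ u₂ u₃ l) (h' : LabelRel w c q u₁' u₂' u₃' l')
    (hl : l.powerRank = 1) (hl' : l'.powerRank = 1) : l = l' := by
  -- the invariants that separate the five labels
  have key : ∀ {u₁ u₂ u₃ : V} {l : DescLabel p}, Spans3 (ZMod p) u₁ u₂ u₃ →
      LabelRel w c q u₁ u₂ u₃ l → l.powerRank = 1 →
      ((∃ k k', q k = 0 ∧ q k' = 0 ∧ c k k' ∉ LinearMap.range q) ↔ l = .l2 ∨ l = .l3) ∧
      ((∀ k k', q k = 0 → q k' = 0 → c k k' = 0) ↔ l = .l4 ∨ l = .l5) ∧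
      (l = .l2 ∨ l = .l3 → ((∃ v, q v ≠ 0 ∧ ∀ k, q k = 0 → c v k = 0) ↔ l = .l2)) ∧
      (l = .l4 ∨ l = .l5 → ((∃ k, q k = 0 ∧ k ≠ 0 ∧ ∀ v, c v k = 0) ↔ l = .l4)) := by
    clear hu hu' h h' hl hl'
    intro u₁ u₂ u₃ l hu h hl
    have hsp := h.spans2_of_powerRank_one hc hcq hu hl
    have h₁ := h.q₁
    have h₂ := h.q₂ (by omega)
    have h₃ : q u₃ ≠ 0 := fun h0 => one_ne_zero (hsp.indep hW (x := 1) (y := 0) (by simp [h0])).1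
    have hker : ∀ {k : V}, q k = 0 → ∃ x y : ZMod p, k = x • u₁ + y • u₂ :=
      fun hk => mem_ker_of_rank_one hu h₁ h₂ h₃ hk
    have hran : ∀ b : W, Spans2 (ZMod p) (q u₃) b → b ∉ LinearMap.range q := by
      rintro b hb ⟨x, rfl⟩
      obtain ⟨i, j, d, rfl⟩ := hu x
      exact neg_ne_zero.2 one_ne_zero (hb.indep hW (x := d) (y := -1) (by simp [h₁, h₂])).2
    refine ⟨⟨?_, ?_⟩, ⟨?_, ?_⟩, fun hl => ⟨?_, ?_⟩, fun hl => ⟨?_, ?_⟩⟩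
    · rintro ⟨k, k', hk, hk', hn⟩
      obtain ⟨x, y, rfl⟩ := hker hk
      obtain ⟨x', y', rfl⟩ := hker hk'
      by_contra hcon
      refine hn ?_
      rw [c_combination hc]
      refine Submodule.smul_mem _ _ ?_
      cases l <;> simp_all [LabelRel, DescLabel.powerRank]
    · intro hl
      rw [if_pos hl] at hsp
      exact ⟨u₂, u₁, h₂, h₁, hran _ hsp⟩
    · intro hk
      by_contra hcon
      have h21 := hk u₂ u₁ h₂ h₁
      cases l <;> simp_all [LabelRel, DescLabel.powerRank]
    · intro hl k k' hk hk'
      obtain ⟨x, y, rfl⟩ := hker hk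
      obtain ⟨x', y', rfl⟩ := hker hk'
      rw [c_combination hc]
      cases l <;> simp_all [LabelRel, DescLabel.powerRank]
    · rintro ⟨v, hv, hk⟩
      by_contra hl2
      have hl3 := hl.resolve_left hl2
      subst hl3
      rw [if_pos hl] at hsp
      obtain ⟨-, h32, -⟩ := h
      obtain ⟨x, y, z, rfl⟩ := hu v
      have e1 := hk u₁ h₁
      have e2 := hk u₂ h₂
      simp only [map_add, map_smul, LinearMap.add_apply, LinearMap.smul_apply, hc, h32,
        alt_swap hc u₁ u₂] at e2
      have := (hsp.indep hW (x := z) (y := -x) (by rw [← e2]; module)).1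
      simp [h₁, h₂, this] at hv
    · rintro rfl
      refine ⟨u₃, h₃, fun k hk => ?_⟩
      obtain ⟨x, y, rfl⟩ := hker hk
      simp [h.1, h.2.1]
    · rintro ⟨k, hk, hk0, hkv⟩
      by_contra hl4
      have hl5 := hl.resolve_left hl4
      subst hl5
      obtain ⟨x, y, rfl⟩ := hker hk
      have e := hkv u₃
      simp only [map_add, map_smul, h.2.1] at e
      simp only [reduceCtorEq, or_self, if_false] at hsp
      have := hsp.indep hW e
      simp [this] at hk0
    · rintro rfl
      refine ⟨u₁, h₁, hu.ne_zero₁ hV, fun v => ?_⟩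
      obtain ⟨x, y, z, rfl⟩ := hu v
      simp [h.1, h.2.1, hc]
  obtain ⟨a1, a2, a3, a4⟩ := key hu h hl
  obtain ⟨b1, b2, b3, b4⟩ := key hu' h' hl'
  rw [a1] at b1
  rw [a2] at b2
  clear hu hu' h h' key a1 a2
  cases l <;> simp only [DescLabel.powerRank,
      zero_ne_one, OfNat.ofNat_ne_one] at hl <;> cases l' <;>
    simp only [DescLabel.powerRank,
      zero_ne_one, OfNat.ofNat_ne_one] at hl' <;> simp at b1 b2 <;> simp_all

/-! #### Power rank two -/

lemma LabelRel.matrix_eq (hl : l.powerRank = 2) (h : LabelRel w c q u₁ u₂ u₃ l) :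
    c u₂ u₁ = (l.matrix w).1 • q u₂ + (l.matrix w).2.1 • q u₃ ∧
      c u₃ u₁ = (l.matrix w).2.2.1 • q u₂ + (l.matrix w).2.2.2 • q u₃ := by
  cases l <;> simp only [DescLabel.powerRank, OfNat.zero_ne_ofNat, OfNat.one_ne_ofNat] at hl <;>
    simp only [LabelRel] at h <;> simp [DescLabel.matrix, h]

/-- The matrices of two triples of power rank two are similar up to a scalar. -/
lemma exists_scaling_of_matrix (hW : Module.finrank (ZMod p) W = 2)
    (hV : Module.finrank (ZMod p) V = 3) (hu : Spans3 (ZMod p) u₁ u₂ u₃)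
    (hu' : Spans3 (ZMod p) u₁' u₂' u₃') (h₁ : q u₁ = 0) (h₁' : q u₁' = 0)
    (hc : ∀ x, c x x = 0) (hq : Spans2 (ZMod p) (q u₂) (q u₃))
    (hq' : Spans2 (ZMod p) (q u₂') (q u₃')) {α β γ δ α' β' γ' δ' : ZMod p}
    (h₂₁ : c u₂ u₁ = α • q u₂ + β • q u₃) (h₃₁ : c u₃ u₁ = γ • q u₂ + δ • q u₃)
    (h₂₁' : c u₂' u₁' = α' • q u₂' + β' • q u₃') (h₃₁' : c u₃' u₁' = γ' • q u₂' + δ' • q u₃') :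
    ∃ s : ZMod p, s ≠ 0 ∧ α' + δ' = s * (α + δ) ∧
      α' * δ' - β' * γ' = s ^ 2 * (α * δ - β * γ) := by
  obtain ⟨s, y, z, rfl⟩ := hu u₁'
  have hyz : y • q u₂ + z • q u₃ = 0 := by simpa [h₁] using h₁'
  obtain ⟨rfl, rfl⟩ := hq.indep hW hyz
  have hs : s ≠ 0 := by
    rintro rfl
    exact hu'.ne_zero₁ hV (by simp)
  obtain ⟨x₀, x, y, rfl⟩ := hu u₂'
  obtain ⟨z₀, z, v, rfl⟩ := hu u₃'
  simp only [map_add, map_smul, LinearMap.add_apply, LinearMap.smul_apply, h₁, hc, h₂₁, h₃₁,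
    zero_smul, add_zero, smul_zero, zero_add] at h₂₁' h₃₁' hq'
  obtain ⟨e₁, e₂⟩ := hq.coeff_eq hW (x := s * (x * α + y * γ)) (y := s * (x * β + y * δ))
    (x' := α' * x + β' * z) (y' := α' * y + β' * v) (by
      refine Eq.trans ?_ (h₂₁'.trans ?_) <;> module)
  obtain ⟨e₃, e₄⟩ := hq.coeff_eq hW (x := s * (z * α + v * γ)) (y := s * (z * β + v * δ))
    (x' := γ' * x + δ' * z) (y' := γ' * y + δ' * v) (by
      refine Eq.trans ?_ (h₃₁'.trans ?_) <;> module)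
  have hD : x * v - y * z ≠ 0 := by
    intro hD
    have i1 := hq'.indep hW (x := z) (y := -x) (by
      have : (z * y - x * v) • q u₃ = 0 := by
        rw [show z * y - x * v = 0 by linear_combination -hD, zero_smul]
      rw [← this]; module)
    have i2 := hq'.indep hW (x := v) (y := -y) (by
      have : (x * v - y * z) • q u₂ = 0 := by rw [hD, zero_smul]
      rw [← this]; module)
    exact one_ne_zero (hq'.indep hW (x := 1) (y := 0) (by
      simp [neg_eq_zero.1 i1.2, neg_eq_zero.1 i2.2])).1
  refine ⟨s, hs, mul_right_cancel₀ hD ?_, mul_right_cancel₀ hD ?_⟩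
  · linear_combination -v * e₁ + z * e₂ + y * e₃ - x * e₄
  · have h1 : (α' * x + β' * z) * (γ' * y + δ' * v) - (α' * y + β' * v) * (γ' * x + δ' * z) =
        (α' * δ' - β' * γ') * (x * v - y * z) := by ring
    rw [← h1, ← e₁, ← e₂, ← e₃, ← e₄]
    ring

/-- For `k` in the kernel of `q`, the map `c · k` is a scalar multiple of `q`. -/
lemma LabelRel.scalar_iff (hp : 3 < p) (hw : ∀ x : (ZMod p)ˣ, x ∈ Subgroup.zpowers w)
    (hc : ∀ x, c x x = 0) (hcq : JointlySpan c q)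
    (hW : Module.finrank (ZMod p) W = 2) (hu : Spans3 (ZMod p) u₁ u₂ u₃) (hl : l.powerRank = 2)
    (h : LabelRel w c q u₁ u₂ u₃ l) :
    (∀ k, q k = 0 → ∃ μ : ZMod p, ∀ v, c v k = μ • q v) ↔ l = .l7 ∨ l = .l10 ∨ l = .l11 := by
  have hq := h.spans2_of_powerRank_two hc hcq hu hl
  obtain ⟨h₂₁, h₃₁⟩ := h.matrix_eq hl
  constructor
  · intro hk
    obtain ⟨μ, hμ⟩ := hk u₁ h.q₁
    have e₂ := hq.coeff_eq hW (x := μ) (y := 0) (by rw [← h₂₁, hμ u₂]; simp)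
    have e₃ := hq.coeff_eq hW (x := 0) (y := μ) (by rw [← h₃₁, hμ u₃]; simp)
    replace e₃ := And.intro e₃.1 (e₂.1.symm.trans e₃.2)
    replace e₂ := e₂.2
    clear h h₂₁ h₃₁ hk hq hμ
    cases l <;> simp only [DescLabel.powerRank, OfNat.zero_ne_ofNat, OfNat.one_ne_ofNat] at hl <;>
      simp only [DescLabel.matrix, zero_ne_one, and_false, false_and] at e₂ e₃ <;> simp
    · exact one_ne_zero e₃.2
    · exact primitiveRoot_pow_ne_one hw hp (Subtype.prop _) e₃.2.symm
    · exact pow_ne_zero _ w.ne_zero e₂.symm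
  · intro hl' k hk
    obtain ⟨a, b, d, rfl⟩ := hu k
    have hbd := hq.indep hW (x := b) (y := d) (by simpa [h.q₁] using hk)
    have hμ : ∃ μ : ZMod p, c u₂ u₁ = μ • q u₂ ∧ c u₃ u₁ = μ • q u₃ := by
      rcases hl' with rfl | rfl | rfl
      · exact ⟨0, by simp [h.1, h.2.1]⟩
      · exact ⟨0, by simp [h.1, h.2.1]⟩
      · exact ⟨1, by simp [h.1, h.2.1]⟩
    obtain ⟨μ, h₂, h₃⟩ := hμ
    refine ⟨a * μ, fun v => ?_⟩
    obtain ⟨i, j, k, rfl⟩ := hu v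
    simp only [map_add, map_smul, LinearMap.add_apply, LinearMap.smul_apply, hc, h₂, h₃, hbd,
      h.q₁, zero_smul, smul_zero, add_zero, zero_add]
    module

/-- Every value of `c` is a value of `c · k` with `k` in the kernel of `q`. -/
lemma LabelRel.image_iff (hc : ∀ x, c x x = 0) (hcq : JointlySpan c q)
    (hW : Module.finrank (ZMod p) W = 2) (hu : Spans3 (ZMod p) u₁ u₂ u₃) (hl : l.powerRank = 2)
    (h : LabelRel w c q u₁ u₂ u₃ l) :
    (∀ v v', ∃ k v'', q k = 0 ∧ c v v' = c v'' k) ↔ ¬(l = .l7 ∨ l = .l8 ∨ l = .l9) := by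
  have hq := h.spans2_of_powerRank_two hc hcq hu hl
  constructor
  · intro hk hl'
    obtain ⟨k, v, hk, hv⟩ := hk u₃ u₂
    obtain ⟨a, b, d, rfl⟩ := hu k
    obtain ⟨i, j, k, rfl⟩ := hu v
    have hbd := hq.indep hW (x := b) (y := d) (by simpa [h.q₁] using hk)
    simp only [map_add, map_smul, LinearMap.add_apply, LinearMap.smul_apply, hc, hbd,
      zero_smul, smul_zero, add_zero, zero_add] at hv
    have hex : ∃ t : ZMod p, t • q u₂ + (-1 : ZMod p) • q u₃ = 0 := by
      rcases hl' with rfl | rfl | rfl <;> simp only [LabelRel] at h <;> simp only [h] at hv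
      · exact ⟨0, by rw [hv]; simp⟩
      · exact ⟨a * k, by rw [hv]; module⟩
      · exact ⟨a * j, by rw [hv]; module⟩
    obtain ⟨t, ht⟩ := hex
    exact neg_ne_zero.2 one_ne_zero (hq.indep hW ht).2
  · intro hl' v v'
    obtain ⟨a, b, d, rfl⟩ := hu v
    obtain ⟨a', b', d', rfl⟩ := hu v'
    have h32 : c u₃ u₂ = 0 := by
      cases l <;> simp only [DescLabel.powerRank, OfNat.zero_ne_ofNat, OfNat.one_ne_ofNat] at hl <;>
        simp only [LabelRel] at h <;> simp_all
    refine ⟨u₁, (b * a' - a * b') • u₂ + (d * a' - a * d') • u₃, h.q₁, ?_⟩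
    simp only [map_add, map_smul, LinearMap.add_apply, LinearMap.smul_apply, hc,
      alt_swap hc u₁ u₂, alt_swap hc u₁ u₃, alt_swap hc u₂ u₃, h32]
    module

/-- The labels whose matrices have vanishing determinant. -/
lemma DescLabel.det_eq_zero_iff (hp : 3 < p) (hw : ∀ x : (ZMod p)ˣ, x ∈ Subgroup.zpowers w)
    (l : DescLabel p) : l.det w = 0 ↔ match l with
      | .l11 | .l13 | .l15 _ | .l16 | .l17 _ => False
      | _ => True := by
  cases l with
  | l17 k =>
    simp only [det, matrix, iff_false, mul_one, sub_eq_zero, ← pow_add]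
    intro h
    refine primitiveRoot_odd_pow_ne_sq hp hw ((k : ℕ) - 1) 1 ?_
    rw [one_pow, h]
    congr 1
    have := k.2.1
    omega
  | _ => simp [det, matrix]

/-- The labels whose matrices have vanishing trace. The trace `1 + w ^ k` for `l15 k` vanishes only
for the largest `k`. -/
lemma DescLabel.trace_eq_zero_iff (hp : 3 < p) (l : DescLabel p) (hl : ∀ k, l ≠ .l15 k) :
    l.trace w = 0 ↔ match l with
      | .l9 | .l11 | .l13 | .l14 | .l17 _ => False
      | _ => True := by
  have h2 : (1 + 1 : ZMod p) ≠ 0 := by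
    rw [one_add_one_eq_two]
    exact two_ne_zero_of_three_lt hp
  cases l <;> simp [trace, matrix, h2]
  exact absurd rfl (hl _)

/-- Among the nonscalar invertible matrices of the list, only the one of `l13` has a double
eigenvalue. -/
lemma DescLabel.disc_eq_zero_iff (hp : 3 < p) (hw : ∀ x : (ZMod p)ˣ, x ∈ Subgroup.zpowers w)
    (l : DescLabel p) (hl : l = .l13 ∨ (∃ k, l = .l15 k) ∨ l = .l16 ∨ ∃ k, l = .l17 k) :
    l.trace w ^ 2 - 4 * l.det w = 0 ↔ l = .l13 := by
  have h2 := two_ne_zero_of_three_lt hp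
  have h4 : (4 : ZMod p) ≠ 0 := by
    rw [show (4 : ZMod p) = 2 * 2 by norm_num]
    exact mul_ne_zero h2 h2
  rcases hl with rfl | ⟨k, rfl⟩ | rfl | ⟨k, rfl⟩
  · simp only [trace, det, matrix, iff_true]
    norm_num
  · simp only [trace, det, matrix, reduceCtorEq, iff_false]
    intro h
    refine primitiveRoot_pow_ne_one hw hp k.2 ?_
    have : (1 - (w : ZMod p) ^ (k : ℕ)) ^ 2 = 0 := by linear_combination h
    exact (sub_eq_zero.1 (pow_eq_zero_iff two_ne_zero |>.1 this)).symm
  · simp [trace, det, matrix, h4]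
  · simp only [trace, det, matrix, reduceCtorEq, iff_false]
    intro h
    refine mul_ne_zero (mul_ne_zero h4 (pow_ne_zero (k : ℕ) w.ne_zero))
      (pow_ne_zero ((k : ℕ) - 1) w.ne_zero) (a := (4 * (w : ZMod p) ^ (k : ℕ))) ?_
    linear_combination h

/-- Among the invertible matrices of the list with distinct eigenvalues, those of `l15` are the ones
with eigenvalues in `𝔽_p`. -/
lemma DescLabel.disc_isSquare_iff (hp : 3 < p) (hw : ∀ x : (ZMod p)ˣ, x ∈ Subgroup.zpowers w)
    (l : DescLabel p) (hl : (∃ k, l = .l15 k) ∨ l = .l16 ∨ ∃ k, l = .l17 k) :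
    (∃ r, l.trace w ^ 2 - 4 * l.det w = r ^ 2) ↔ ∃ k, l = .l15 k := by
  have h2 := two_ne_zero_of_three_lt hp
  rcases hl with ⟨k, rfl⟩ | rfl | ⟨k, rfl⟩
  · refine iff_of_true ⟨1 - (w : ZMod p) ^ (k : ℕ), ?_⟩ ⟨k, rfl⟩
    simp only [trace, det, matrix]
    ring
  · simp only [reduceCtorEq, exists_false, iff_false, trace, det, matrix]
    rintro ⟨r, hr⟩
    refine primitiveRoot_odd_pow_ne_sq hp hw 0 (r / 2) ?_
    rw [div_pow, eq_div_iff (pow_ne_zero 2 h2), ← hr]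
    ring
  · simp only [reduceCtorEq, exists_false, iff_false, trace, det, matrix]
    rintro ⟨r, hr⟩
    refine primitiveRoot_odd_pow_ne_sq hp hw ((k : ℕ) - 1) (r / 2) ?_
    rw [div_pow, eq_div_iff (pow_ne_zero 2 h2), ← hr,
      show 2 * ((k : ℕ) - 1) + 1 = k + (k - 1) by have := k.2.1; omega, pow_add]
    ring

/-- Diagonal matrices `diag(1, a)` and `diag(1, b)` are similar up to a scalar only if `a = b` or
`a b = 1`. -/
lemma DescLabel.l15_injective (hp : 3 < p) (hw : ∀ x : (ZMod p)ˣ, x ∈ Subgroup.zpowers w)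
    {k k' : Set.Icc (1 : ℕ) ((p - 1) / 2)} {s : ZMod p}
    (htr : (DescLabel.l15 k').trace w = s * (DescLabel.l15 k).trace w)
    (hdet : (DescLabel.l15 k').det w = s ^ 2 * (DescLabel.l15 k).det w) : k = k' := by
  simp only [trace, det, matrix] at htr hdet
  have h1 : ((w : ZMod p) ^ (k : ℕ) - (w : ZMod p) ^ (k' : ℕ)) *
      ((w : ZMod p) ^ (k : ℕ) * (w : ZMod p) ^ (k' : ℕ) - 1) = 0 := by
    generalize (w : ZMod p) ^ (k : ℕ) = a at *
    generalize (w : ZMod p) ^ (k' : ℕ) = b at *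
    linear_combination (1 + a) ^ 2 * hdet - a * (1 + b + s * (1 + a)) * htr
  have hk := k.2
  have hk' := k'.2
  simp only [Set.mem_Icc] at hk hk'
  have h2 := sub_one_eq_two_mul hp
  apply Subtype.ext
  rcases mul_eq_zero.1 h1 with h | h
  · have := primitiveRoot_pow_inj hw (sub_eq_zero.1 h)
    exact this.eq_of_lt_of_lt (by omega) (by omega)
  · rw [sub_eq_zero, ← pow_add, ← pow_zero (w : ZMod p)] at h
    have := Nat.le_of_dvd (by omega) ((Nat.modEq_zero_iff_dvd).1 (primitiveRoot_pow_inj hw h))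
    omega

/-- The common trace `2` forces the scalar to be `1`, and the determinants `1 - w ^ (2 k - 1)` are
distinct. -/
lemma DescLabel.l17_injective (hp : 3 < p) (hw : ∀ x : (ZMod p)ˣ, x ∈ Subgroup.zpowers w)
    {k k' : Set.Icc (1 : ℕ) ((p - 1) / 2)} {s : ZMod p}
    (htr : (DescLabel.l17 k').trace w = s * (DescLabel.l17 k).trace w)
    (hdet : (DescLabel.l17 k').det w = s ^ 2 * (DescLabel.l17 k).det w) : k = k' := by
  simp only [trace, det, matrix] at htr hdet
  have hs : s = 1 := by
    refine mul_right_cancel₀ (two_ne_zero_of_three_lt hp) ?_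
    linear_combination -htr
  subst hs
  have h1 : (w : ZMod p) ^ ((k : ℕ) + (k - 1)) = (w : ZMod p) ^ ((k' : ℕ) + (k' - 1)) := by
    rw [pow_add, pow_add]
    linear_combination hdet
  have hk := k.2
  have hk' := k'.2
  simp only [Set.mem_Icc] at hk hk'
  have h2 := sub_one_eq_two_mul hp
  have h3 := (primitiveRoot_pow_inj hw h1).eq_of_lt_of_lt (by omega) (by omega)
  apply Subtype.ext
  omega

set_option maxHeartbeats 1000000 in
/-- The labels of power rank two are separated by whether `T = c · u₁` is scalar, whether its image
contains all values of `c`, and by its trace and determinant up to scaling. -/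
lemma LabelRel.eq_of_powerRank_two (hp : 3 < p) (hw : ∀ x : (ZMod p)ˣ, x ∈ Subgroup.zpowers w)
    (hc : ∀ x, c x x = 0) (hcq : JointlySpan c q)
    (hV : Module.finrank (ZMod p) V = 3) (hW : Module.finrank (ZMod p) W = 2)
    (hu : Spans3 (ZMod p) u₁ u₂ u₃) (hu' : Spans3 (ZMod p) u₁' u₂' u₃')
    (h : LabelRel w c q u₁ u₂ u₃ l) (h' : LabelRel w c q u₁' u₂' u₃' l')
    (hl : l.powerRank = 2) (hl' : l'.powerRank = 2) : l = l' := by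
  have hsc := (h.scalar_iff hp hw hc hcq hW hu hl).symm.trans
    (h'.scalar_iff hp hw hc hcq hW hu' hl')
  have him := (h.image_iff hc hcq hW hu hl).symm.trans (h'.image_iff hc hcq hW hu' hl')
  obtain ⟨s, hs, htr, hdet⟩ := exists_scaling_of_matrix hW hV hu hu' h.q₁ h'.q₁ hc
    (h.spans2_of_powerRank_two hc hcq hu hl) (h'.spans2_of_powerRank_two hc hcq hu' hl')
    (h.matrix_eq hl).1 (h.matrix_eq hl).2 (h'.matrix_eq hl').1 (h'.matrix_eq hl').2
  change l'.trace w = s * l.trace w at htr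
  change l'.det w = s ^ 2 * l.det w at hdet
  clear h h' hu hu' hcq hc hV hW
  have hdisc : l'.trace w ^ 2 - 4 * l'.det w = s ^ 2 * (l.trace w ^ 2 - 4 * l.det w) := by
    rw [htr, hdet]
    ring
  have hd0 : l.det w = 0 ↔ l'.det w = 0 := by simp [hdet, hs]
  have ht0 : l.trace w = 0 ↔ l'.trace w = 0 := by simp [htr, hs]
  have hD0 : l.trace w ^ 2 - 4 * l.det w = 0 ↔ l'.trace w ^ 2 - 4 * l'.det w = 0 := by
    simp [hdisc, hs]
  have hDs : (∃ r, l.trace w ^ 2 - 4 * l.det w = r ^ 2) ↔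
      ∃ r, l'.trace w ^ 2 - 4 * l'.det w = r ^ 2 := by
    rw [hdisc]
    refine ⟨fun ⟨r, hr⟩ => ⟨s * r, by rw [hr]; ring⟩, fun ⟨r, hr⟩ => ⟨r / s, ?_⟩⟩
    rw [div_pow, eq_div_iff (pow_ne_zero 2 hs), ← hr]
    ring
  rw [DescLabel.det_eq_zero_iff hp hw, DescLabel.det_eq_zero_iff hp hw] at hd0
  have hT := fun a b => (DescLabel.trace_eq_zero_iff hp l a).symm.trans
    (ht0.trans (DescLabel.trace_eq_zero_iff hp l' b))
  have hX := fun a b => (DescLabel.disc_eq_zero_iff hp hw l a).symm.trans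
    (hD0.trans (DescLabel.disc_eq_zero_iff hp hw l' b))
  have hY := fun a b => (DescLabel.disc_isSquare_iff hp hw l a).symm.trans
    (hDs.trans (DescLabel.disc_isSquare_iff hp hw l' b))
  have h₁₅ : ∀ k k', l = .l15 k → l' = .l15 k' → k = k' := by
    rintro k k' rfl rfl
    exact DescLabel.l15_injective hp hw htr hdet
  have h₁₇ : ∀ k k', l = .l17 k → l' = .l17 k' → k = k' := by
    rintro k k' rfl rfl
    exact DescLabel.l17_injective hp hw htr hdet
  clear hDs hD0 ht0 hdisc htr hdet
  cases l <;> simp only [DescLabel.powerRank, OfNat.zero_ne_ofNat, OfNat.one_ne_ofNat] at hl <;>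
    cases l' <;>
    simp only [DescLabel.powerRank, OfNat.zero_ne_ofNat, OfNat.one_ne_ofNat] at hl' <;>
    simp only [iff_true, iff_false, not_true] at hd0 <;>
    simp only [reduceCtorEq, or_self, or_true, or_false, iff_true, iff_false, not_true] at hsc <;>
    simp only [reduceCtorEq, or_self, or_true, or_false, iff_true, iff_false, not_true,
      not_false_iff] at him <;>
    simp at hT hX hY h₁₅ h₁₇ ⊢
  all_goals assumption

/-- The label is determined by the alternating map and the linear map. -/
theorem LabelRel.unique (hp : 3 < p) (hw : ∀ x : (ZMod p)ˣ, x ∈ Subgroup.zpowers w)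
    (hc : ∀ x, c x x = 0) (hcq : JointlySpan c q)
    (hV : Module.finrank (ZMod p) V = 3) (hW : Module.finrank (ZMod p) W = 2)
    (hu : Spans3 (ZMod p) u₁ u₂ u₃) (hu' : Spans3 (ZMod p) u₁' u₂' u₃')
    (h : LabelRel w c q u₁ u₂ u₃ l) (h' : LabelRel w c q u₁' u₂' u₃' l') : l = l' := by
  have h1 := h.finrank_range hc hcq hW hu
  have h2 := h'.finrank_range hc hcq hW hu'
  have hr : l.powerRank = 0 ∨ l.powerRank = 1 ∨ l.powerRank = 2 := by
    cases l <;> simp [DescLabel.powerRank]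
  rcases hr with hl | hl | hl
  · have key : ∀ l : DescLabel p, l.powerRank = 0 → l = .l1 := by
      intro l hl
      cases l <;> simp [DescLabel.powerRank] at hl ⊢
    rw [key l hl, key l' (by omega)]
  · exact LabelRel.eq_of_powerRank_one hc hcq hV hW hu hu' h h' hl (by omega)
  · exact LabelRel.eq_of_powerRank_two hp hw hc hcq hV hW hu hu' h h' hl (by omega)

end Uniqueness

/-! ### The exponent-`p` central step -/

section PStep

variable {p : ℕ} {H K : Type*} [Group H] [Group K]

lemma map_pcomm (f : H →* K) (x y : H) : f (pcomm x y) = pcomm (f x) (f y) := by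
  simp [pcomm]

lemma pcomm_eq_one_iff {x y : H} : pcomm x y = 1 ↔ x * y = y * x := by
  rw [pcomm, mul_assoc, ← mul_inv_rev, inv_mul_eq_one, eq_comm]

lemma pcomm_mem_pStep {N : Subgroup H} {x : H} (hx : x ∈ N) (y : H) : pcomm x y ∈ pStep p N :=
  Subgroup.subset_closure ⟨x, hx, 1, N.one_mem, y, by simp⟩

lemma pow_mem_pStep {N : Subgroup H} {x : H} (hx : x ∈ N) : x ^ p ∈ pStep p N :=
  Subgroup.subset_closure ⟨1, N.one_mem, x, hx, 1, by simp [pcomm]⟩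

lemma pStep_le_iff {N T : Subgroup H} :
    pStep p N ≤ T ↔ (∀ x ∈ N, ∀ y, pcomm x y ∈ T) ∧ ∀ x ∈ N, x ^ p ∈ T := by
  refine ⟨fun h => ⟨fun x hx y => h (pcomm_mem_pStep hx y), fun x hx => h (pow_mem_pStep hx)⟩,
    fun h => (Subgroup.closure_le _).2 ?_⟩
  rintro _ ⟨x, hx, k, hk, y, rfl⟩
  exact T.mul_mem (h.1 x hx y) (h.2 k hk)

lemma pStep_le (N : Subgroup H) [hN : N.Normal] : pStep p N ≤ N := by
  refine pStep_le_iff.2 ⟨fun x hx y => ?_, fun x hx => N.pow_mem hx p⟩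
  have h : pcomm x y = x⁻¹ * (y⁻¹ * x * y⁻¹⁻¹) := by simp [pcomm, mul_assoc]
  rw [h]
  exact N.mul_mem (N.inv_mem hx) (hN.conj_mem x hx y⁻¹)

lemma map_pStep_le (f : H →* K) {N : Subgroup H} {T : Subgroup K} (h : N ≤ T.comap f) :
    pStep p N ≤ (pStep p T).comap f := by
  refine pStep_le_iff.2 ⟨fun x hx y => ?_, fun x hx => ?_⟩
  · rw [Subgroup.mem_comap, map_pcomm]
    exact pcomm_mem_pStep (show f x ∈ T from h hx) _
  · rw [Subgroup.mem_comap, map_pow]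
    exact pow_mem_pStep (show f x ∈ T from h hx)

lemma pStep_eq_bot_iff {N : Subgroup H} :
    pStep p N = ⊥ ↔ (∀ x ∈ N, ∀ y, x * y = y * x) ∧ ∀ x ∈ N, x ^ p = 1 := by
  rw [eq_bot_iff, pStep_le_iff]
  simp only [Subgroup.mem_bot, pcomm_eq_one_iff]

end PStep

/-! ### A model of the `p`-cover -/

/-- A central extension of `ℤ³` by `𝔽_p³`: the second component of a product is twisted by the
bilinear map with the values `x₂ y₁`, `x₃ y₁`, `x₃ y₂`. The `p`-cover of `C_p³` embeds into its
quotient by `(p² ℤ)³`. -/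
@[ext] structure CoverModel (p : ℕ) where
  /-- the exponent of `a₁` -/
  e₁ : ℤ
  /-- the exponent of `a₂` -/
  e₂ : ℤ
  /-- the exponent of `a₃` -/
  e₃ : ℤ
  /-- the exponent of `a₄` -/
  c₄ : ZMod p
  /-- the exponent of `a₅` -/
  c₅ : ZMod p
  /-- the exponent of `a₆` -/
  c₆ : ZMod p

namespace CoverModel

variable {p : ℕ}

instance : Mul (CoverModel p) := ⟨fun a b => ⟨a.e₁ + b.e₁, a.e₂ + b.e₂, a.e₃ + b.e₃,
  a.c₄ + b.c₄ + a.e₂ * b.e₁, a.c₅ + b.c₅ + a.e₃ * b.e₁, a.c₆ + b.c₆ + a.e₃ * b.e₂⟩⟩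

instance : One (CoverModel p) := ⟨⟨0, 0, 0, 0, 0, 0⟩⟩

instance : Inv (CoverModel p) := ⟨fun a => ⟨-a.e₁, -a.e₂, -a.e₃,
  -a.c₄ + a.e₂ * a.e₁, -a.c₅ + a.e₃ * a.e₁, -a.c₆ + a.e₃ * a.e₂⟩⟩

lemma mul_def (a b : CoverModel p) : a * b = ⟨a.e₁ + b.e₁, a.e₂ + b.e₂, a.e₃ + b.e₃,
  a.c₄ + b.c₄ + a.e₂ * b.e₁, a.c₅ + b.c₅ + a.e₃ * b.e₁, a.c₆ + b.c₆ + a.e₃ * b.e₂⟩ := rfl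

lemma one_def : (1 : CoverModel p) = ⟨0, 0, 0, 0, 0, 0⟩ := rfl

lemma inv_def (a : CoverModel p) : a⁻¹ = ⟨-a.e₁, -a.e₂, -a.e₃,
  -a.c₄ + a.e₂ * a.e₁, -a.c₅ + a.e₃ * a.e₁, -a.c₆ + a.e₃ * a.e₂⟩ := rfl

instance : Group (CoverModel p) := Group.ofLeftAxioms
  (fun a b d => by ext <;> simp only [mul_def, Int.cast_add] <;> ring)
  (fun a => by ext <;> simp [mul_def, one_def])
  (fun a => by ext <;> simp [mul_def, one_def, inv_def])

lemma pcomm_def (a b : CoverModel p) : pcomm a b = ⟨0, 0, 0, a.e₂ * b.e₁ - b.e₂ * a.e₁,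
    a.e₃ * b.e₁ - b.e₃ * a.e₁, a.e₃ * b.e₂ - b.e₃ * a.e₂⟩ := by
  ext <;> simp only [pcomm, mul_def, inv_def] <;> push_cast <;> ring

lemma pow_def (a : CoverModel p) (n : ℕ) : a ^ n = ⟨n * a.e₁, n * a.e₂, n * a.e₃,
    n * a.c₄ + n.choose 2 * (a.e₂ * a.e₁), n * a.c₅ + n.choose 2 * (a.e₃ * a.e₁),
    n * a.c₆ + n.choose 2 * (a.e₃ * a.e₂)⟩ := by
  induction n with
  | zero => simp [one_def]
  | succ n ih =>
    rw [pow_succ, ih]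
    ext <;> simp only [mul_def, Nat.choose_succ_succ' n 1, Nat.choose_one_right] <;> push_cast <;>
      ring

/-- As `p` is odd, `p` divides `p.choose 2`, so that `p`-th powers have no commutator part. -/
lemma pow_prime [Fact p.Prime] (hp : 3 < p) (a : CoverModel p) :
    a ^ p = ⟨p * a.e₁, p * a.e₂, p * a.e₃, 0, 0, 0⟩ := by
  have h : ((p.choose 2 : ℕ) : ZMod p) = 0 :=
    (ZMod.natCast_eq_zero_iff _ _).2
      ((Fact.out : p.Prime).dvd_choose_self two_ne_zero (by omega))
  rw [pow_def]
  simp [h]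

/-- The homomorphism from the free group that maps the generators to the standard generators of
the model. -/
def ofFree (p : ℕ) : FreeGroup (Fin 3) →* CoverModel p :=
  FreeGroup.lift ![⟨1, 0, 0, 0, 0, 0⟩, ⟨0, 1, 0, 0, 0, 0⟩, ⟨0, 0, 1, 0, 0, 0⟩]

/-- The reduction of the model to `C_p³`. -/
def toCp3 (p : ℕ) : CoverModel p →* Cp3 p where
  toFun a := Multiplicative.ofAdd ![(a.e₁ : ZMod p), a.e₂, a.e₃]
  map_one' := by
    rw [← ofAdd_zero]
    congr 1
    ext i
    fin_cases i <;> simp [one_def]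
  map_mul' a b := by
    rw [← ofAdd_add]
    congr 1
    ext i
    fin_cases i <;> simp [mul_def]

lemma toCp3_ofFree (f : FreeGroup (Fin 3)) :
    toCp3 p (ofFree p f) = FreeGroup.lift (stdGen p) f := by
  have h : (toCp3 p).comp (ofFree p) = FreeGroup.lift (stdGen p) := by
    refine FreeGroup.ext_hom _ _ fun i => ?_
    simp only [MonoidHom.comp_apply, ofFree, FreeGroup.lift_apply_of, stdGen, toCp3,
      MonoidHom.coe_mk, OneHom.coe_mk]
    congr 1
    ext j
    fin_cases i <;> fin_cases j <;> simp
  exact DFunLike.congr_fun h f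

end CoverModel

section PCover

variable {p : ℕ}

/-- The kernel of the map from the free group to `C_p³`. -/
abbrev relKer (p : ℕ) : Subgroup (FreeGroup (Fin 3)) := (FreeGroup.lift (stdGen p)).ker

lemma mem_relKer_iff {f : FreeGroup (Fin 3)} : f ∈ relKer p ↔
    (p : ℤ) ∣ (CoverModel.ofFree p f).e₁ ∧ (p : ℤ) ∣ (CoverModel.ofFree p f).e₂ ∧
      (p : ℤ) ∣ (CoverModel.ofFree p f).e₃ := by
  rw [MonoidHom.mem_ker, ← CoverModel.toCp3_ofFree]
  simp only [CoverModel.toCp3, MonoidHom.coe_mk, OneHom.coe_mk, ofAdd_eq_one, funext_iff,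
    Fin.forall_fin_succ, ← ZMod.intCast_zmod_eq_zero_iff_dvd]
  simp

/-- A homomorphism that maps the generators to commuting elements of order dividing `p` factors
through `C_p³`. -/
lemma relKer_le_ker {Q : Type*} [Group Q] (f : FreeGroup (Fin 3) →* Q)
    (hcomm : ∀ i j, i < j → Commute (f (.of j)) (f (.of i))) (hpow : ∀ i, f (.of i) ^ p = 1) :
    relKer p ≤ f.ker := by
  have h10 := fun i j : ℤ => (hcomm 0 1 (by decide)).zpow_zpow i j
  have h20 := fun i j : ℤ => (hcomm 0 2 (by decide)).zpow_zpow i j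
  have h21 := fun i j : ℤ => (hcomm 1 2 (by decide)).zpow_zpow i j
  let g : FreeGroup (Fin 3) →* Q := MonoidHom.mk' (fun x => f (.of 0) ^ (CoverModel.ofFree p x).e₁ *
    (f (.of 1) ^ (CoverModel.ofFree p x).e₂ * f (.of 2) ^ (CoverModel.ofFree p x).e₃)) (by
      intro x y
      simp only [map_mul, CoverModel.mul_def, zpow_add, mul_assoc]
      rw [(h20 _ _).left_comm, (h10 _ _).left_comm, (h21 _ _).left_comm])
  have hg : g = f := by
    refine FreeGroup.ext_hom _ _ fun i => ?_
    fin_cases i <;> simp [g, CoverModel.ofFree]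
  intro x hx
  obtain ⟨⟨i, hi⟩, ⟨j, hj⟩, ⟨k, hk⟩⟩ := mem_relKer_iff.1 hx
  rw [MonoidHom.mem_ker, ← hg]
  simp [g, hi, hj, hk, zpow_mul, hpow]

/-- The natural map from the `p`-cover to `C_p³`. -/
def coverToCp3 (p : ℕ) : P3 p →* Cp3 p :=
  QuotientGroup.lift _ (FreeGroup.lift (stdGen p)) (pStep_le (relKer p))

lemma coverToCp3_mk (f : FreeGroup (Fin 3)) :
    coverToCp3 p (QuotientGroup.mk f) = FreeGroup.lift (stdGen p) f := rfl

lemma mk_mem_multiplicator_iff {f : FreeGroup (Fin 3)} :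
    (QuotientGroup.mk f : P3 p) ∈ multiplicator p (stdGen p) ↔ f ∈ relKer p := by
  constructor
  · rintro ⟨g, hg, h⟩
    have h1 := QuotientGroup.eq.1 h
    have h2 := (relKer p).mul_mem hg (pStep_le _ h1)
    rwa [mul_inv_cancel_left] at h2
  · exact fun h => ⟨f, h, rfl⟩

lemma mem_multiplicator_iff {x : P3 p} :
    x ∈ multiplicator p (stdGen p) ↔ coverToCp3 p x = 1 := by
  induction x using QuotientGroup.induction_on with
  | H f => rw [mk_mem_multiplicator_iff, coverToCp3_mk, MonoidHom.mem_ker]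

/-- The coordinate space of the multiplicator: the exponents of `a₄, a₅, a₆` and those of
`a₇, a₈, a₉`. -/
abbrev CoverCoord (p : ℕ) : Type := (Fin 3 → ZMod p) × (Fin 3 → ZMod p)

/-- The coordinates of an element of the model whose exponents of `a₁, a₂, a₃` are divisible
by `p`. -/
def CoverModel.coord (a : CoverModel p) : CoverCoord p :=
  (![a.c₄, a.c₅, a.c₆], ![((a.e₁ / p : ℤ) : ZMod p), ((a.e₂ / p : ℤ) : ZMod p),
    ((a.e₃ / p : ℤ) : ZMod p)])

variable [Fact p.Prime]

/-- The words that vanish in the `p`-cover have exponents divisible by `p²` and no commutator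
part. -/
lemma ofFree_of_mem_pStep (hp : 3 < p) {f : FreeGroup (Fin 3)} (hf : f ∈ pStep p (relKer p)) :
    ∃ i j k : ℤ, CoverModel.ofFree p f = ⟨p * (p * i), p * (p * j), p * (p * k), 0, 0, 0⟩ := by
  let T : Subgroup (CoverModel p) :=
    { carrier := {a | ∃ i j k : ℤ, a = ⟨p * (p * i), p * (p * j), p * (p * k), 0, 0, 0⟩}
      one_mem' := ⟨0, 0, 0, by simp [CoverModel.one_def]⟩
      mul_mem' := by
        rintro _ _ ⟨i, j, k, rfl⟩ ⟨i', j', k', rfl⟩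
        refine ⟨i + i', j + j', k + k', ?_⟩
        ext <;> simp [CoverModel.mul_def] <;> ring
      inv_mem' := by
        rintro _ ⟨i, j, k, rfl⟩
        refine ⟨-i, -j, -k, ?_⟩
        ext <;> simp [CoverModel.inv_def] }
  have h : pStep p (relKer p) ≤ T.comap (CoverModel.ofFree p) := by
    refine pStep_le_iff.2 ⟨fun x hx y => ⟨0, 0, 0, ?_⟩, fun x hx => ?_⟩
    · obtain ⟨⟨i, hi⟩, ⟨j, hj⟩, ⟨k, hk⟩⟩ := mem_relKer_iff.1 hx
      rw [map_pcomm, CoverModel.pcomm_def]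
      simp [hi, hj, hk]
    · obtain ⟨⟨i, hi⟩, ⟨j, hj⟩, ⟨k, hk⟩⟩ := mem_relKer_iff.1 hx
      refine ⟨i, j, k, ?_⟩
      rw [map_pow, CoverModel.pow_prime hp, hi, hj, hk]
  exact h hf

/-- The coordinates of an element of the multiplicator. Outside the multiplicator the value has no
meaning. -/
noncomputable def coverCoord (hp : 3 < p) (x : P3 p) : CoverCoord p :=
  Quotient.liftOn' x (fun f => (CoverModel.ofFree p f).coord) (by
    intro f g hfg
    rw [QuotientGroup.leftRel_apply] at hfg
    obtain ⟨i, j, k, h⟩ := ofFree_of_mem_pStep hp hfg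
    have hg : g = f * (f⁻¹ * g) := by group
    have hp0 : (p : ℤ) ≠ 0 := by exact_mod_cast (Fact.out : p.Prime).ne_zero
    rw [hg, map_mul, h]
    simp only [CoverModel.coord, CoverModel.mul_def]
    simp [Int.add_mul_ediv_left _ _ hp0])

end PCover

/-! ### Coordinates on the multiplicator -/

section Multiplicator

variable {p : ℕ}

lemma multiplicator_mul_comm {x : P3 p} (hx : x ∈ multiplicator p (stdGen p)) (y : P3 p) :
    x * y = y * x := by
  obtain ⟨r, hr, rfl⟩ := hx
  induction y using QuotientGroup.induction_on with
  | H f =>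
    rw [← pcomm_eq_one_iff]
    exact (QuotientGroup.eq_one_iff (pcomm r f)).2 (pcomm_mem_pStep hr f)

lemma multiplicator_pow {x : P3 p} (hx : x ∈ multiplicator p (stdGen p)) : x ^ p = 1 := by
  obtain ⟨r, hr, rfl⟩ := hx
  exact (QuotientGroup.eq_one_iff (r ^ p)).2 (pow_mem_pStep hr)

lemma normal_of_le_multiplicator {U : Subgroup (P3 p)} (hU : U ≤ multiplicator p (stdGen p)) :
    U.Normal :=
  ⟨fun x hx y => by rwa [← multiplicator_mul_comm (hU hx) y, mul_inv_cancel_right]⟩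

lemma pow_mem_multiplicator (x : P3 p) : x ^ p ∈ multiplicator p (stdGen p) := by
  rw [mem_multiplicator_iff, map_pow]
  refine Multiplicative.toAdd.injective (funext fun i => ?_)
  simp

lemma pcomm_mem_multiplicator (x y : P3 p) : pcomm x y ∈ multiplicator p (stdGen p) := by
  rw [mem_multiplicator_iff, map_pcomm, pcomm_eq_one_iff, mul_comm]

lemma a4_mem : a4 p ∈ multiplicator p (stdGen p) := pcomm_mem_multiplicator _ _
lemma a5_mem : a5 p ∈ multiplicator p (stdGen p) := pcomm_mem_multiplicator _ _
lemma a6_mem : a6 p ∈ multiplicator p (stdGen p) := pcomm_mem_multiplicator _ _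
lemma a7_mem : a7 p ∈ multiplicator p (stdGen p) := pow_mem_multiplicator _
lemma a8_mem : a8 p ∈ multiplicator p (stdGen p) := pow_mem_multiplicator _
lemma a9_mem : a9 p ∈ multiplicator p (stdGen p) := pow_mem_multiplicator _

/-- The multiplicator is contained in every normal subgroup that contains `a₄, …, a₉`, because
modulo such a subgroup the relations of `C_p³` hold. -/
lemma multiplicator_le_of_mem {S : Subgroup (P3 p)} (hS : S.Normal) (h4 : a4 p ∈ S) (h5 : a5 p ∈ S)
    (h6 : a6 p ∈ S) (h7 : a7 p ∈ S) (h8 : a8 p ∈ S) (h9 : a9 p ∈ S) :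
    multiplicator p (stdGen p) ≤ S := by
  rintro _ ⟨r, hr, rfl⟩
  have h := relKer_le_ker (p := p)
    ((QuotientGroup.mk' S).comp (QuotientGroup.mk' (pStep p (relKer p)))) ?_ ?_ hr
  · exact (QuotientGroup.eq_one_iff _).1 h
  · intro i j hij
    have hc : pcomm (coverGen p j) (coverGen p i) ∈ S := by
      fin_cases i <;> fin_cases j <;> first | exact absurd hij (by decide) | assumption
    have h1 := (QuotientGroup.eq_one_iff (N := S) _).2 hc
    exact pcomm_eq_one_iff.1 h1
  · intro i
    have hc : coverGen p i ^ p ∈ S := by fin_cases i <;> assumption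
    exact (QuotientGroup.eq_one_iff (N := S) _).2 hc

/-- The image of an element of the `p`-cover in `C_p³`, as a vector. -/
def coverVec (x : P3 p) : Fin 3 → ZMod p := (coverToCp3 p x).toAdd

lemma coverVec_mk (f : FreeGroup (Fin 3)) :
    coverVec (QuotientGroup.mk f : P3 p) = ![((CoverModel.ofFree p f).e₁ : ZMod p),
      (CoverModel.ofFree p f).e₂, (CoverModel.ofFree p f).e₃] := by
  rw [coverVec, coverToCp3_mk, ← CoverModel.toCp3_ofFree]
  rfl

/-- The alternating map that describes commutators in the `p`-cover. -/
def wedge (x y : Fin 3 → ZMod p) : Fin 3 → ZMod p :=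
  ![x 1 * y 0 - y 1 * x 0, x 2 * y 0 - y 2 * x 0, x 2 * y 1 - y 2 * x 1]

variable [Fact p.Prime] (hp : 3 < p)

lemma coverCoord_mul {x y : P3 p} (hx : x ∈ multiplicator p (stdGen p))
    (hy : y ∈ multiplicator p (stdGen p)) :
    coverCoord hp (x * y) = coverCoord hp x + coverCoord hp y := by
  obtain ⟨f, hf, rfl⟩ := hx
  obtain ⟨g, hg, rfl⟩ := hy
  have hp0 : (p : ℤ) ≠ 0 := by exact_mod_cast (Fact.out : p.Prime).ne_zero
  obtain ⟨⟨i, hi⟩, ⟨j, hj⟩, ⟨k, hk⟩⟩ := mem_relKer_iff.1 hf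
  obtain ⟨⟨i', hi'⟩, ⟨j', hj'⟩, ⟨k', hk'⟩⟩ := mem_relKer_iff.1 hg
  change CoverModel.coord (CoverModel.ofFree p (f * g)) = CoverModel.coord (CoverModel.ofFree p f) +
    CoverModel.coord (CoverModel.ofFree p g)
  rw [map_mul]
  simp only [CoverModel.coord, CoverModel.mul_def, hi, hj, hk, hi', hj', hk', ← mul_add,
    Int.mul_ediv_cancel_left _ hp0]
  simp

lemma coverCoord_pcomm (x y : P3 p) :
    coverCoord hp (pcomm x y) = (wedge (coverVec x) (coverVec y), 0) := by
  induction x using QuotientGroup.induction_on with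
  | H f =>
    induction y using QuotientGroup.induction_on with
    | H g =>
      rw [coverVec_mk, coverVec_mk]
      change CoverModel.coord (CoverModel.ofFree p (pcomm f g)) = _
      rw [map_pcomm, CoverModel.pcomm_def]
      simp [CoverModel.coord, wedge]

lemma coverCoord_pow (x : P3 p) : coverCoord hp (x ^ p) = (0, coverVec x) := by
  have hp0 : (p : ℤ) ≠ 0 := by exact_mod_cast (Fact.out : p.Prime).ne_zero
  induction x using QuotientGroup.induction_on with
  | H f =>
    rw [coverVec_mk]
    change CoverModel.coord (CoverModel.ofFree p (f ^ p)) = _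
    rw [map_pow, CoverModel.pow_prime hp]
    simp [CoverModel.coord, Int.mul_ediv_cancel_left _ hp0]

instance : CommGroup (multiplicator p (stdGen p)) :=
  { (inferInstance : Group (multiplicator p (stdGen p))) with
    mul_comm := fun x y => Subtype.ext (multiplicator_mul_comm x.2 y) }

/-- The multiplicator, written additively, is a vector space over `𝔽_p`. -/
noncomputable instance : Module (ZMod p) (Additive (multiplicator p (stdGen p))) :=
  AddCommGroup.zmodModule fun x => Subtype.ext (multiplicator_pow (Additive.toMul x).2)

/-- The coordinates as a linear map. -/
noncomputable def coverCoordLin :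
    Additive (multiplicator p (stdGen p)) →ₗ[ZMod p] CoverCoord p :=
  AddMonoidHom.toZModLinearMap p
    { toFun := fun x => coverCoord hp (Additive.toMul x : multiplicator p (stdGen p)).1
      map_zero' := by
        have h := coverCoord_mul hp (one_mem (multiplicator p (stdGen p)))
          (one_mem (multiplicator p (stdGen p)))
        rw [mul_one] at h
        exact left_eq_add.1 h
      map_add' := fun x y => coverCoord_mul hp (Additive.toMul x).2 (Additive.toMul y).2 }

lemma coverCoordLin_apply (x : multiplicator p (stdGen p)) :
    coverCoordLin hp (Additive.ofMul x) = coverCoord hp x.1 := rfl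

lemma coverVec_coverGen (i : Fin 3) : coverVec (coverGen p i) = Pi.single i 1 := by
  rw [coverVec, coverGen, coverToCp3_mk, FreeGroup.lift_apply_of]
  rfl

lemma coverCoordLin_surjective : Function.Surjective (coverCoordLin (p := p) hp) := by
  rintro ⟨c, q⟩
  refine ⟨c 0 • .ofMul ⟨a4 p, a4_mem⟩ + c 1 • .ofMul ⟨a5 p, a5_mem⟩ +
    c 2 • .ofMul ⟨a6 p, a6_mem⟩ + q 0 • .ofMul ⟨a7 p, a7_mem⟩ + q 1 • .ofMul ⟨a8 p, a8_mem⟩ +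
    q 2 • .ofMul ⟨a9 p, a9_mem⟩, ?_⟩
  simp only [map_add, map_smul, coverCoordLin_apply, a4, a5, a6, a7, a8, a9, coverCoord_pcomm,
    coverCoord_pow, coverVec_coverGen, wedge]
  ext i <;> fin_cases i <;> simp

/-- The elements `a₄, …, a₉` of the multiplicator. -/
def multGen (p : ℕ) : Fin 6 → Additive (multiplicator p (stdGen p)) :=
  ![.ofMul ⟨a4 p, a4_mem⟩, .ofMul ⟨a5 p, a5_mem⟩, .ofMul ⟨a6 p, a6_mem⟩, .ofMul ⟨a7 p, a7_mem⟩,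
    .ofMul ⟨a8 p, a8_mem⟩, .ofMul ⟨a9 p, a9_mem⟩]

lemma span_multGen : Submodule.span (ZMod p) (Set.range (multGen p)) = ⊤ := by
  let B : AddSubgroup (Additive (multiplicator p (stdGen p))) :=
    (Submodule.span (ZMod p) (Set.range (multGen p))).toAddSubgroup
  let S : Subgroup (P3 p) :=
    (Subgroup.toAddSubgroup.symm B).map (multiplicator p (stdGen p)).subtype
  have hS : S ≤ multiplicator p (stdGen p) := by
    rintro _ ⟨x, -, rfl⟩
    exact x.2
  have hmem : ∀ i, ((multGen p i).toMul : P3 p) ∈ S := fun i => by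
    have h : multGen p i ∈ Submodule.span (ZMod p) (Set.range (multGen p)) :=
      Submodule.subset_span ⟨i, rfl⟩
    exact ⟨(multGen p i).toMul, h, rfl⟩
  have hle := multiplicator_le_of_mem (normal_of_le_multiplicator hS) (hmem 0) (hmem 1) (hmem 2)
    (hmem 3) (hmem 4) (hmem 5)
  refine eq_top_iff.2 fun x _ => ?_
  obtain ⟨y, hy, hyx⟩ := hle x.toMul.2
  have : y = x.toMul := Subtype.ext hyx
  subst this
  exact hy

lemma coverCoordLin_injective : Function.Injective (coverCoordLin (p := p) hp) := by
  have hfin : Module.Finite (ZMod p) (Additive (multiplicator p (stdGen p))) :=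
    .of_surjective (Fintype.linearCombination (ZMod p) (multGen p)) (by
      rw [← LinearMap.range_eq_top, Fintype.range_linearCombination, span_multGen])
  have h1 := finrank_range_le_card (R := ZMod p) (multGen p)
  rw [Set.finrank, span_multGen, finrank_top, Fintype.card_fin] at h1
  have h2 : Module.finrank (ZMod p) (CoverCoord p) = 6 := by simp
  have h3 := LinearMap.finrank_le_finrank_of_surjective (coverCoordLin_surjective hp)
  exact (LinearMap.injective_iff_surjective_of_finrank_eq_finrank (by omega)).2
    (coverCoordLin_surjective hp)

lemma coverCoord_injOn {x y : P3 p} (hx : x ∈ multiplicator p (stdGen p))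
    (hy : y ∈ multiplicator p (stdGen p)) (h : coverCoord hp x = coverCoord hp y) : x = y :=
  congrArg (fun z : Additive (multiplicator p (stdGen p)) => (z.toMul : P3 p))
    (coverCoordLin_injective hp (a₁ := .ofMul ⟨x, hx⟩) (a₂ := .ofMul ⟨y, hy⟩) h)

include hp in
lemma card_multiplicator : Nat.card (multiplicator p (stdGen p)) = p ^ 6 := by
  have h : Nat.card (multiplicator p (stdGen p)) = Nat.card (CoverCoord p) :=
    Nat.card_eq_of_bijective (coverCoordLin hp)
      ⟨coverCoordLin_injective hp, coverCoordLin_surjective hp⟩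
  rw [h, Nat.card_prod, Nat.card_fun, Nat.card_zmod, Nat.card_fin]
  ring

/-- The subspace of the coordinate space that corresponds to a subgroup of the multiplicator. -/
noncomputable def coordSub (U : Subgroup (P3 p)) (hU : U ≤ multiplicator p (stdGen p)) :
    Submodule (ZMod p) (CoverCoord p) :=
  AddSubgroup.toZModSubmodule p
    { carrier := {v | ∃ x ∈ U, coverCoord hp x = v}
      zero_mem' := ⟨1, U.one_mem, (coverCoordLin hp).map_zero⟩
      add_mem' := by
        rintro _ _ ⟨x, hx, rfl⟩ ⟨y, hy, rfl⟩
        exact ⟨x * y, U.mul_mem hx hy, coverCoord_mul hp (hU hx) (hU hy)⟩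
      neg_mem' := by
        rintro _ ⟨x, hx, rfl⟩
        exact ⟨x⁻¹, U.inv_mem hx, (coverCoordLin hp).map_neg (.ofMul ⟨x, hU hx⟩)⟩ }

lemma coverCoord_mem_coordSub_iff {U : Subgroup (P3 p)} (hU : U ≤ multiplicator p (stdGen p))
    {x : P3 p} (hx : x ∈ multiplicator p (stdGen p)) :
    coverCoord hp x ∈ coordSub hp U hU ↔ x ∈ U := by
  constructor
  · rintro ⟨y, hy, h⟩
    rwa [← coverCoord_injOn hp (hU hy) hx h]
  · exact fun h => ⟨x, h, rfl⟩

lemma card_coordSub {U : Subgroup (P3 p)} (hU : U ≤ multiplicator p (stdGen p)) :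
    Nat.card (coordSub hp U hU) = Nat.card U := by
  refine (Nat.card_eq_of_bijective (fun x : U => (⟨coverCoord hp x, x, x.2, rfl⟩ :
    coordSub hp U hU)) ⟨fun x y h => ?_, ?_⟩).symm
  · exact Subtype.ext (coverCoord_injOn hp (hU x.2) (hU y.2) (congrArg Subtype.val h))
  · rintro ⟨_, x, hx, rfl⟩
    exact ⟨⟨x, hx⟩, rfl⟩

/-- The quotient of the multiplicator by `U`, in coordinates. -/
abbrev CoordQuot (U : Subgroup (P3 p)) (hU : U ≤ multiplicator p (stdGen p)) : Type :=
  CoverCoord p ⧸ coordSub hp U hU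

lemma card_eq_iff_finrank_coordQuot {U : Subgroup (P3 p)} (hU : U ≤ multiplicator p (stdGen p)) :
    Nat.card U = p ^ 4 ↔ Module.finrank (ZMod p) (CoordQuot hp U hU) = 2 := by
  have h1 := Submodule.finrank_quotient_add_finrank (coordSub hp U hU)
  have h2 : Module.finrank (ZMod p) (CoverCoord p) = 6 := by simp
  have h3 := Module.natCard_eq_pow_finrank (K := ZMod p) (V := coordSub hp U hU)
  rw [card_coordSub, Nat.card_zmod] at h3
  rw [h3, (Nat.pow_right_injective (Fact.out : p.Prime).two_le).eq_iff]
  rw [h2] at h1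
  change _ ↔ Module.finrank (ZMod p) (CoverCoord p ⧸ coordSub hp U hU) = 2
  omega

/-- The commutator map of `P(G) / U`, in coordinates. -/
noncomputable def coordComm (U : Subgroup (P3 p)) (hU : U ≤ multiplicator p (stdGen p)) :
    (Fin 3 → ZMod p) →ₗ[ZMod p] (Fin 3 → ZMod p) →ₗ[ZMod p] CoordQuot hp U hU :=
  (LinearMap.mk₂ (ZMod p) (fun x y => ((wedge x y, 0) : CoverCoord p))
    (fun x x' y => by ext i <;> fin_cases i <;> simp [wedge] <;> ring)
    (fun a x y => by ext i <;> fin_cases i <;> simp [wedge] <;> ring)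
    (fun x y y' => by ext i <;> fin_cases i <;> simp [wedge] <;> ring)
    (fun a x y => by ext i <;> fin_cases i <;> simp [wedge] <;> ring)).compr₂
      (coordSub hp U hU).mkQ

/-- The power map of `P(G) / U`, in coordinates. -/
noncomputable def coordPow (U : Subgroup (P3 p)) (hU : U ≤ multiplicator p (stdGen p)) :
    (Fin 3 → ZMod p) →ₗ[ZMod p] CoordQuot hp U hU :=
  (coordSub hp U hU).mkQ ∘ₗ LinearMap.inr (ZMod p) _ _

variable {U : Subgroup (P3 p)} {hU : U ≤ multiplicator p (stdGen p)}

lemma coordComm_coverVec (x y : P3 p) : coordComm hp U hU (coverVec x) (coverVec y) =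
    (coordSub hp U hU).mkQ (coverCoord hp (pcomm x y)) := by
  rw [coverCoord_pcomm]
  rfl

lemma coordPow_coverVec (x : P3 p) : coordPow hp U hU (coverVec x) =
    (coordSub hp U hU).mkQ (coverCoord hp (x ^ p)) := by
  rw [coverCoord_pow]
  rfl

lemma coordComm_self (x : Fin 3 → ZMod p) : coordComm hp U hU x x = 0 := by
  have h : wedge x x = 0 := by ext i; fin_cases i <;> simp [wedge]
  change (coordSub hp U hU).mkQ (wedge x x, 0) = 0
  rw [h]
  exact map_zero _

lemma jointlySpan_coord : JointlySpan (coordComm hp U hU) (coordPow hp U hU) := by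
  intro S hc hq
  refine eq_top_iff.2 fun v _ => ?_
  obtain ⟨⟨c, q⟩, rfl⟩ := Submodule.mkQ_surjective _ v
  have h : (c, q) = c 0 • (wedge (Pi.single 1 1) (Pi.single 0 1), (0 : Fin 3 → ZMod p)) +
      c 1 • (wedge (Pi.single 2 1) (Pi.single 0 1), (0 : Fin 3 → ZMod p)) +
      c 2 • (wedge (Pi.single 2 1) (Pi.single 1 1), (0 : Fin 3 → ZMod p)) + (0, q) := by
    ext i <;> fin_cases i <;> simp [wedge]
  rw [h]
  simp only [map_add, map_smul]
  exact S.add_mem (S.add_mem (S.add_mem (S.smul_mem _ (hc _ _)) (S.smul_mem _ (hc _ _)))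
    (S.smul_mem _ (hc _ _))) (hq _)

end Multiplicator

/-! ### Extension automorphisms -/

section PStep

variable {p : ℕ} {H : Type*} [Group H]

/-- Modulo a central subgroup of exponent `p`, commutators and `p`-th powers are well defined: a
subgroup that meets every coset of such a subgroup contains all of them. -/
lemma pStep_top_le_of_supplement {S Z : Subgroup H} (hZ : pStep p Z = ⊥)
    (h : ∀ x, ∃ s ∈ S, ∃ z ∈ Z, x = s * z) : pStep p (⊤ : Subgroup H) ≤ S := by
  obtain ⟨hc, hpow⟩ := pStep_eq_bot_iff.1 hZ
  refine pStep_le_iff.2 ⟨fun x _ y => ?_, fun x _ => ?_⟩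
  · obtain ⟨s, hs, z, hz, rfl⟩ := h x
    obtain ⟨t, ht, z', hz', rfl⟩ := h y
    have e : pcomm (s * z) (t * z') = pcomm s t := by
      have h1 : ∀ a, a * z = z * a := fun a => (hc z hz a).symm
      have h2 : ∀ a, a * z' = z' * a := fun a => (hc z' hz' a).symm
      simp only [pcomm, mul_inv_rev]
      calc z⁻¹ * s⁻¹ * (z'⁻¹ * t⁻¹) * (s * z) * (t * z')
          = z⁻¹ * (s⁻¹ * z'⁻¹) * t⁻¹ * (s * (z * t)) * z' := by group
        _ = z⁻¹ * (z'⁻¹ * s⁻¹) * t⁻¹ * (s * (t * z)) * z' := by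
            rw [h1 t, ← Commute.inv_inv (h2 s)]
        _ = z⁻¹ * (z'⁻¹ * ((s⁻¹ * t⁻¹ * s * t) * z * z')) := by group
        _ = s⁻¹ * t⁻¹ * s * t := by rw [h2, h1]; group
    rw [e]
    simp only [pcomm]
    exact S.mul_mem (S.mul_mem (S.mul_mem (S.inv_mem hs) (S.inv_mem ht)) hs) ht
  · obtain ⟨s, hs, z, hz, rfl⟩ := h x
    have hcomm : Commute s z := (hc z hz s).symm
    rw [hcomm.mul_pow, hpow z hz, mul_one]
    exact S.pow_mem hs p

end PStep

section ExtensionAut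

variable {p : ℕ}

lemma multiplicator_eq_ker : multiplicator p (stdGen p) = (coverToCp3 p).ker := by
  ext x
  exact mem_multiplicator_iff

lemma pStep_multiplicator : pStep p (multiplicator p (stdGen p)) = ⊥ :=
  pStep_eq_bot_iff.2 ⟨fun _ hx => multiplicator_mul_comm hx, fun _ hx => multiplicator_pow hx⟩

lemma pStep_top_cover : pStep p (⊤ : Subgroup (P3 p)) = multiplicator p (stdGen p) := by
  refine le_antisymm (pStep_le_iff.2 ⟨fun x _ y => pcomm_mem_multiplicator x y,
    fun x _ => pow_mem_multiplicator x⟩) ?_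
  exact multiplicator_le_of_mem inferInstance (pcomm_mem_pStep (Subgroup.mem_top _) _)
    (pcomm_mem_pStep (Subgroup.mem_top _) _) (pcomm_mem_pStep (Subgroup.mem_top _) _)
    (pow_mem_pStep (Subgroup.mem_top _))
    (pow_mem_pStep (Subgroup.mem_top _)) (pow_mem_pStep (Subgroup.mem_top _))

/-- A homomorphism out of the elementary abelian group is linear in the exponents. -/
lemma hom_cp3_apply (α : Cp3 p →* Cp3 p) (x : Cp3 p) : (α x).toAdd =
    x.toAdd 0 • (α (stdGen p 0)).toAdd + x.toAdd 1 • (α (stdGen p 1)).toAdd +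
      x.toAdd 2 • (α (stdGen p 2)).toAdd := by
  let f : (Fin 3 → ZMod p) →ₗ[ZMod p] (Fin 3 → ZMod p) :=
    AddMonoidHom.toZModLinearMap p (AddMonoidHom.toMultiplicative.symm α)
  have h := congrArg f (show x.toAdd = x.toAdd 0 • Pi.single 0 (1 : ZMod p) +
    x.toAdd 1 • Pi.single 1 (1 : ZMod p) + x.toAdd 2 • Pi.single 2 (1 : ZMod p) by
      ext i; fin_cases i <;> simp)
  simp only [map_add, map_smul] at h
  exact h

/-- The vectors of the images of the generators under an extension automorphism span. -/
lemma IsExtensionAut.spans {α : MulAut (Cp3 p)} {β : MulAut (P3 p)}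
    (h : IsExtensionAut p (stdGen p) α β) [Fact p.Prime] : Spans3 (ZMod p)
      (coverVec (β (coverGen p 0))) (coverVec (β (coverGen p 1)))
      (coverVec (β (coverGen p 2))) := by
  obtain ⟨v, hv, hβ⟩ := h
  have hgen : ∀ i, coverVec (β (coverGen p i)) = (α (stdGen p i)).toAdd := fun i => by
    rw [coverGen, hβ, FreeGroup.lift_apply_of, coverVec, coverToCp3_mk, hv]
  intro x
  let y : Fin 3 → ZMod p := (α.symm (Multiplicative.ofAdd x)).toAdd
  refine ⟨y 0, y 1, y 2, ?_⟩
  rw [hgen, hgen, hgen]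
  refine Eq.trans ?_ (hom_cp3_apply α.toMonoidHom (α.symm (Multiplicative.ofAdd x)))
  simp

lemma eq_top_of_stdGen_mem {S : Subgroup (Cp3 p)} (h : ∀ i, stdGen p i ∈ S) : S = ⊤ := by
  refine eq_top_iff.2 fun x _ => ?_
  have hx : x = stdGen p 0 ^ ((x.toAdd 0).cast : ℤ) * stdGen p 1 ^ ((x.toAdd 1).cast : ℤ) *
      stdGen p 2 ^ ((x.toAdd 2).cast : ℤ) := by
    refine Multiplicative.toAdd.injective ?_
    funext i
    fin_cases i <;> simp [stdGen, -ZMod.intCast_cast] <;> simp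
  rw [hx]
  exact S.mul_mem (S.mul_mem (S.zpow_mem (h 0) _) (S.zpow_mem (h 1) _)) (S.zpow_mem (h 2) _)

lemma coverToCp3_surjective : Function.Surjective (coverToCp3 p) := by
  rw [← MonoidHom.range_eq_top]
  exact eq_top_of_stdGen_mem fun i => ⟨coverGen p i, by simp [coverGen, coverToCp3_mk]⟩

variable [Fact p.Prime] (hp : 3 < p)

include hp in
lemma card_cover : Nat.card (P3 p) = p ^ 9 := by
  have h1 := Subgroup.card_eq_card_quotient_mul_card_subgroup (multiplicator p (stdGen p))
  have h2 := Nat.card_congr (QuotientGroup.quotientKerEquivOfSurjective (coverToCp3 p)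
    coverToCp3_surjective).toEquiv
  rw [← multiplicator_eq_ker] at h2
  rw [h1, h2, card_multiplicator hp, Nat.card_congr (Multiplicative.toAdd), Nat.card_fun,
    Nat.card_zmod, Nat.card_fin, ← pow_add]

include hp in
lemma finite_cover : Finite (P3 p) :=
  Nat.finite_of_card_ne_zero (by rw [card_cover hp]; exact pow_ne_zero _ (NeZero.ne p))

include hp in
/-- Words whose vectors span define an extension automorphism. -/
lemma exists_extensionAut {v : Fin 3 → FreeGroup (Fin 3)}
    (hv : Spans3 (ZMod p) (coverVec (QuotientGroup.mk (v 0) : P3 p))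
      (coverVec (QuotientGroup.mk (v 1) : P3 p)) (coverVec (QuotientGroup.mk (v 2) : P3 p))) :
    ∃ α β, IsExtensionAut p (stdGen p) α β ∧
      ∀ x : FreeGroup (Fin 3), β (QuotientGroup.mk x) = QuotientGroup.mk (FreeGroup.lift v x) := by
  -- the automorphism `α` of `C_p³`
  let f : (Fin 3 → ZMod p) →ₗ[ZMod p] (Fin 3 → ZMod p) :=
    Fintype.linearCombination (ZMod p) fun i => coverVec (QuotientGroup.mk (v i) : P3 p)
  have hfs : Function.Surjective f := by
    intro x
    obtain ⟨a, b, d, rfl⟩ := hv x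
    exact ⟨![a, b, d], by simp [f, Fintype.linearCombination_apply, Fin.sum_univ_three]⟩
  let α : MulAut (Cp3 p) := MulEquiv.ofBijective (AddMonoidHom.toMultiplicative f.toAddMonoidHom)
    ⟨LinearMap.injective_iff_surjective.2 hfs, hfs⟩
  have hα : ∀ i, FreeGroup.lift (stdGen p) (v i) = α (stdGen p i) := by
    intro i
    refine Multiplicative.toAdd.injective ?_
    change coverVec (QuotientGroup.mk (v i) : P3 p) = f (Pi.single i 1)
    simp [f]
  have hlift : (FreeGroup.lift (stdGen p)).comp (FreeGroup.lift v) =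
      α.toMonoidHom.comp (FreeGroup.lift (stdGen p)) :=
    FreeGroup.ext_hom _ _ fun i => by simpa using hα i
  have hker : relKer p ≤ (relKer p).comap (FreeGroup.lift v) := by
    intro x hx
    rw [Subgroup.mem_comap, MonoidHom.mem_ker, ← MonoidHom.comp_apply, hlift, MonoidHom.comp_apply,
      MonoidHom.mem_ker.1 hx, map_one]
  let b : P3 p →* P3 p := QuotientGroup.map _ _ (FreeGroup.lift v) (map_pStep_le _ hker)
  have hb : ∀ x, b (QuotientGroup.mk x) = QuotientGroup.mk (FreeGroup.lift v x) := fun _ => rfl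
  have hbα : ∀ y, coverToCp3 p (b y) = α (coverToCp3 p y) := by
    intro y
    induction y using QuotientGroup.induction_on with
    | H y => exact DFunLike.congr_fun hlift y
  -- the range of `b` supplements the multiplicator, hence is everything
  have hsupp : ∀ x, ∃ s ∈ b.range, ∃ z ∈ multiplicator p (stdGen p), x = s * z := by
    intro x
    obtain ⟨y, hy⟩ := coverToCp3_surjective (α.symm (coverToCp3 p x))
    refine ⟨b y, ⟨y, rfl⟩, (b y)⁻¹ * x, ?_, by group⟩
    rw [mem_multiplicator_iff, map_mul, map_inv, hbα, hy]
    simp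
  have hle : multiplicator p (stdGen p) ≤ b.range := by
    rw [← pStep_top_cover]
    exact pStep_top_le_of_supplement pStep_multiplicator hsupp
  have hbs : Function.Surjective b := by
    intro x
    obtain ⟨s, hs, z, hz, rfl⟩ := hsupp x
    exact b.range.mul_mem hs (hle hz)
  have := finite_cover hp
  exact ⟨α, MulEquiv.ofBijective b ⟨Finite.injective_iff_surjective.2 hbs, hbs⟩,
    ⟨v, hα, fun x => hb x⟩, hb⟩

/-- The class of `z` in the quotient of the multiplicator by `U`, in coordinates. -/
noncomputable def coordMk (U : Subgroup (P3 p)) (hU : U ≤ multiplicator p (stdGen p)) :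
    Additive (multiplicator p (stdGen p)) →ₗ[ZMod p] CoordQuot hp U hU :=
  (coordSub hp U hU).mkQ ∘ₗ coverCoordLin hp

lemma coordMk_eq_zero_iff {U : Subgroup (P3 p)} (hU : U ≤ multiplicator p (stdGen p))
    (z : multiplicator p (stdGen p)) : coordMk hp U hU (.ofMul z) = 0 ↔ (z : P3 p) ∈ U := by
  rw [coordMk, LinearMap.comp_apply, ← LinearMap.mem_ker, Submodule.ker_mkQ, coverCoordLin_apply,
    coverCoord_mem_coordSub_iff hp hU z.2]

lemma wexp_nsmul {W : Type*} [AddCommGroup W] [Module (ZMod p) W] (w : (ZMod p)ˣ) (k : ℕ) (x : W) :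
    wexp w k • x = (w : ZMod p) ^ k • x := by
  rw [wexp, ← Nat.cast_smul_eq_nsmul (ZMod p), ZMod.natCast_zmod_val]

/-- A homomorphism maps the `l`-th subgroup of the list into `U` if and only if the images of the
generators satisfy the relations of the label `l` modulo `U`. -/
lemma map_repSubgroup_le_iff (w : (ZMod p)ˣ) {U : Subgroup (P3 p)}
    (hU : U ≤ multiplicator p (stdGen p)) (f : P3 p →* P3 p) (l : DescLabel p) :
    (repSubgroup p w l).map f ≤ U ↔ LabelRel w (coordComm hp U hU) (coordPow hp U hU)
      (coverVec (f (coverGen p 0))) (coverVec (f (coverGen p 1)))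
      (coverVec (f (coverGen p 2))) l := by
  have hC : ∀ x y, ∃ X : multiplicator p (stdGen p), f (pcomm x y) = X ∧
      coordMk hp U hU (.ofMul X) = coordComm hp U hU (coverVec (f x)) (coverVec (f y)) :=
    fun x y => ⟨⟨_, pcomm_mem_multiplicator (f x) (f y)⟩, map_pcomm f x y,
      (coordComm_coverVec hp (f x) (f y)).symm⟩
  have hP : ∀ x, ∃ X : multiplicator p (stdGen p), f (x ^ p) = X ∧
      coordMk hp U hU (.ofMul X) = coordPow hp U hU (coverVec (f x)) :=
    fun x => ⟨⟨_, pow_mem_multiplicator (f x)⟩, map_pow f x p, (coordPow_coverVec hp (f x)).symm⟩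
  obtain ⟨X₄, h4, h4'⟩ := hC (coverGen p 1) (coverGen p 0)
  obtain ⟨X₅, h5, h5'⟩ := hC (coverGen p 2) (coverGen p 0)
  obtain ⟨X₆, h6, h6'⟩ := hC (coverGen p 2) (coverGen p 1)
  obtain ⟨X₇, h7, h7'⟩ := hP (coverGen p 0)
  obtain ⟨X₈, h8, h8'⟩ := hP (coverGen p 1)
  obtain ⟨X₉, h9, h9'⟩ := hP (coverGen p 2)
  rw [← a4] at h4
  rw [← a5] at h5
  rw [← a6] at h6
  rw [← a7] at h7
  rw [← a8] at h8
  rw [← a9] at h9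
  rw [Subgroup.map_le_iff_le_comap]
  cases l <;>
    simp only [repSubgroup, Subgroup.closure_le, Set.insert_subset_iff, Set.singleton_subset_iff,
      SetLike.mem_coe, Subgroup.mem_comap, map_mul, map_inv, map_pow, h4, h5, h6, h7, h8, h9,
      ← Subgroup.coe_mul, ← Subgroup.coe_inv, ← Subgroup.coe_pow, ← coordMk_eq_zero_iff hp hU,
      ofMul_mul, ofMul_inv, ofMul_pow, map_add, map_sub, map_smul, h4', h5', h6', h7', h8', h9',
      wexp_nsmul, ← sub_eq_add_neg, sub_sub, sub_eq_zero, pow_one, LabelRel]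

end ExtensionAut

/-! ### The orbits of the subgroups of order `p⁴` -/

section Orbits

variable {p : ℕ} [Fact p.Prime] (hp : 3 < p) (w : (ZMod p)ˣ)

lemma exists_repSubgroup_eq_closure (l : DescLabel p) : ∃ a ∈ multiplicator p (stdGen p),
    ∃ b ∈ multiplicator p (stdGen p), ∃ c ∈ multiplicator p (stdGen p),
    ∃ d ∈ multiplicator p (stdGen p), repSubgroup p w l = .closure {a, b, c, d} := by
  have h4 := a4_mem (p := p)
  have h5 := a5_mem (p := p)
  have h6 := a6_mem (p := p)
  have h7 := a7_mem (p := p)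
  have h8 := a8_mem (p := p)
  have h9 := a9_mem (p := p)
  cases l <;> refine ⟨_, ?_, _, ?_, _, ?_, _, ?_, rfl⟩ <;>
    repeat first
      | assumption
      | apply Subgroup.mul_mem
      | apply Subgroup.inv_mem
      | apply Subgroup.pow_mem

lemma repSubgroup_le_multiplicator (l : DescLabel p) :
    repSubgroup p w l ≤ multiplicator p (stdGen p) := by
  obtain ⟨a, ha, b, hb, c, hc, d, hd, h⟩ := exists_repSubgroup_eq_closure w l
  rw [h, Subgroup.closure_le]
  simp [Set.insert_subset_iff, ha, hb, hc, hd]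

/-- The listed subgroups satisfy their own relations with respect to the standard basis. -/
lemma labelRel_repSubgroup (l : DescLabel p) : LabelRel w
    (coordComm hp _ (repSubgroup_le_multiplicator w l))
    (coordPow hp _ (repSubgroup_le_multiplicator w l))
    (coverVec (coverGen p 0)) (coverVec (coverGen p 1)) (coverVec (coverGen p 2)) l :=
  (map_repSubgroup_le_iff hp w (repSubgroup_le_multiplicator w l) (MonoidHom.id _) l).1
    (by rw [Subgroup.map_id])

lemma spans3_coverVec_coverGen : Spans3 (ZMod p) (coverVec (coverGen p 0))
    (coverVec (coverGen p 1)) (coverVec (coverGen p 2)) := by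
  intro v
  refine ⟨v 0, v 1, v 2, ?_⟩
  simp only [coverVec_coverGen]
  ext i
  fin_cases i <;> simp

lemma finrank_le_two_of_spans2 {W : Type*} [AddCommGroup W] [Module (ZMod p) W] {a b : W}
    (h : Spans2 (ZMod p) a b) : Module.finrank (ZMod p) W ≤ 2 := by
  have h1 := finrank_range_le_card (R := ZMod p) ![a, b]
  rw [Set.finrank, Matrix.range_cons_cons_empty, h.span_eq_top, finrank_top, Fintype.card_fin] at h1
  exact h1

/-- The relations of a label determine all commutators and powers up to two of them. -/
lemma LabelRel.finrank_le_two {V W : Type*} [AddCommGroup V] [Module (ZMod p) V] [AddCommGroup W]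
    [Module (ZMod p) W] {c : V →ₗ[ZMod p] V →ₗ[ZMod p] W} {q : V →ₗ[ZMod p] W} {u₁ u₂ u₃ : V}
    (hc : ∀ x, c x x = 0) (hcq : JointlySpan c q) (hu : Spans3 (ZMod p) u₁ u₂ u₃) {l : DescLabel p}
    (h : LabelRel w c q u₁ u₂ u₃ l) : Module.finrank (ZMod p) W ≤ 2 := by
  have hl : l = .l1 ∨ l.powerRank = 1 ∨ l.powerRank = 2 := by
    cases l <;> simp [DescLabel.powerRank]
  obtain rfl | hl | hl := hl
  · exact finrank_le_two_of_spans2 (h.spans2_of_powerRank_zero hc hcq hu)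
  · exact finrank_le_two_of_spans2 (h.spans2_of_powerRank_one hc hcq hu hl)
  · exact finrank_le_two_of_spans2 (h.spans2_of_powerRank_two hc hcq hu hl)

include hp in
lemma card_repSubgroup (l : DescLabel p) : Nat.card (repSubgroup p w l) = p ^ 4 := by
  rw [card_eq_iff_finrank_coordQuot hp (repSubgroup_le_multiplicator w l)]
  refine le_antisymm ((labelRel_repSubgroup hp w l).finrank_le_two w (coordComm_self hp)
    (jointlySpan_coord hp) spans3_coverVec_coverGen) ?_
  obtain ⟨a, ha, b, hb, c, hc, d, hd, h⟩ := exists_repSubgroup_eq_closure w l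
  have hU := repSubgroup_le_multiplicator w l
  let S := Submodule.span (ZMod p) (Set.range
    ![coverCoord hp a, coverCoord hp b, coverCoord hp c, coverCoord hp d])
  have hS : ∀ i, ![coverCoord hp a, coverCoord hp b, coverCoord hp c, coverCoord hp d] i ∈ S :=
    fun i => Submodule.subset_span ⟨i, rfl⟩
  -- the elements of the multiplicator with coordinates in `S` form a subgroup
  have hle : coordSub hp _ hU ≤ S := by
    let T : Subgroup (P3 p) := ((S.comap (coverCoordLin hp)).toAddSubgroup.toSubgroup').map
      (multiplicator p (stdGen p)).subtype
    have hT : repSubgroup p w l ≤ T := by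
      rw [h, Subgroup.closure_le]
      simp only [Set.insert_subset_iff, Set.singleton_subset_iff]
      exact ⟨⟨⟨a, ha⟩, hS 0, rfl⟩, ⟨⟨b, hb⟩, hS 1, rfl⟩, ⟨⟨c, hc⟩, hS 2, rfl⟩, ⟨⟨d, hd⟩, hS 3, rfl⟩⟩
    rintro _ ⟨x, hx, rfl⟩
    obtain ⟨y, hy, rfl⟩ := hT hx
    exact hy
  have h1 := (Submodule.finrank_mono hle).trans (finrank_range_le_card _)
  have h2 := Submodule.finrank_quotient_add_finrank (coordSub hp _ hU)
  have h3 : Module.finrank (ZMod p) (CoverCoord p) = 6 := by simp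
  rw [Fintype.card_fin] at h1
  change 2 ≤ Module.finrank (ZMod p) (CoverCoord p ⧸ coordSub hp _ hU)
  omega

variable {w}

include hp in
lemma map_eq_of_le {U V : Subgroup (P3 p)} (hU : Nat.card U = p ^ 4) (hV : Nat.card V = p ^ 4)
    {β : MulAut (P3 p)} (h : U.map β.toMonoidHom ≤ V) : V = U.map β.toMonoidHom := by
  have := finite_cover hp
  refine (Subgroup.eq_of_le_of_card_ge h ?_).symm
  rw [hV, ← hU, Subgroup.card_map_of_injective β.injective]

lemma exists_word_coverVec {p : ℕ} (u : Fin 3 → ZMod p) :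
    ∃ v : FreeGroup (Fin 3), coverVec (QuotientGroup.mk v : P3 p) = u := by
  obtain ⟨x, hx⟩ := coverToCp3_surjective (Multiplicative.ofAdd u)
  obtain ⟨v, rfl⟩ := QuotientGroup.mk_surjective x
  exact ⟨v, by rw [coverVec, hx]; rfl⟩

include hp in
/-- Every subgroup of order `p⁴` of the multiplicator lies in the orbit of a listed one. -/
theorem exists_mem_extOrbit (hw : ∀ x : (ZMod p)ˣ, x ∈ Subgroup.zpowers w) {U : Subgroup (P3 p)}
    (hU : U ≤ multiplicator p (stdGen p)) (hcard : Nat.card U = p ^ 4) :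
    ∃ l, U ∈ extOrbit p (stdGen p) (repSubgroup p w l) := by
  obtain ⟨l, u₁, u₂, u₃, hu, h⟩ := exists_label hp hw (coordComm_self hp (hU := hU))
    (jointlySpan_coord hp) (by simp) ((card_eq_iff_finrank_coordQuot hp hU).1 hcard)
  obtain ⟨v₁, rfl⟩ := exists_word_coverVec u₁
  obtain ⟨v₂, rfl⟩ := exists_word_coverVec u₂
  obtain ⟨v₃, rfl⟩ := exists_word_coverVec u₃
  obtain ⟨α, β, hβ, hv⟩ := exists_extensionAut hp (v := ![v₁, v₂, v₃]) hu
  have hg : ∀ i, β.toMonoidHom (coverGen p i) = QuotientGroup.mk (![v₁, v₂, v₃] i) := fun i =>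
    (hv (.of i)).trans (by rw [FreeGroup.lift_apply_of])
  refine ⟨l, α, β, hβ, map_eq_of_le hp (card_repSubgroup hp w l) hcard ?_⟩
  rw [map_repSubgroup_le_iff hp w hU, hg, hg, hg]
  exact h

include hp in
theorem extOrbit_label_unique (hw : ∀ x : (ZMod p)ˣ, x ∈ Subgroup.zpowers w) {U : Subgroup (P3 p)}
    (hU : U ≤ multiplicator p (stdGen p)) (hcard : Nat.card U = p ^ 4) {l l' : DescLabel p}
    (h : U ∈ extOrbit p (stdGen p) (repSubgroup p w l))
    (h' : U ∈ extOrbit p (stdGen p) (repSubgroup p w l')) : l = l' := by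
  obtain ⟨α, β, hβ, e⟩ := h
  obtain ⟨α', β', hβ', e'⟩ := h'
  have r := (map_repSubgroup_le_iff hp w hU β.toMonoidHom l).1 e.ge
  have r' := (map_repSubgroup_le_iff hp w hU β'.toMonoidHom l').1 e'.ge
  have hV : Module.finrank (ZMod p) (Fin 3 → ZMod p) = 3 := by simp
  exact LabelRel.unique hp hw (coordComm_self hp) (jointlySpan_coord hp) hV
    ((card_eq_iff_finrank_coordQuot hp hU).1 hcard) hβ.spans hβ'.spans r r'

lemma IsExtensionAut.one : IsExtensionAut p (stdGen p) 1 1 :=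
  ⟨FreeGroup.of, by simp, fun x => by simp [FreeGroup.lift_of_eq_id]⟩

lemma IsExtensionAut.mul {α α' : MulAut (Cp3 p)} {β β' : MulAut (P3 p)}
    (h : IsExtensionAut p (stdGen p) α β) (h' : IsExtensionAut p (stdGen p) α' β') :
    IsExtensionAut p (stdGen p) (α * α') (β * β') := by
  obtain ⟨v, hv, hβ⟩ := h
  obtain ⟨v', hv', hβ'⟩ := h'
  have hlift : (FreeGroup.lift (stdGen p)).comp (FreeGroup.lift v) =
      α.toMonoidHom.comp (FreeGroup.lift (stdGen p)) :=
    FreeGroup.ext_hom _ _ fun i => by simpa using hv i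
  refine ⟨fun i => FreeGroup.lift v (v' i), fun i => ?_, fun x => ?_⟩
  · exact (DFunLike.congr_fun hlift (v' i)).trans (congrArg α (hv' i))
  · rw [MulAut.mul_apply, hβ', hβ, ← MonoidHom.comp_apply (FreeGroup.lift v)]
    congr 2
    exact FreeGroup.ext_hom _ _ fun i => by simp

lemma IsExtensionAut.inv {α : MulAut (Cp3 p)} {β : MulAut (P3 p)}
    (h : IsExtensionAut p (stdGen p) α β) : IsExtensionAut p (stdGen p) α⁻¹ β⁻¹ := by
  obtain ⟨v, hv, hβ⟩ := h
  have hlift : ∀ y, coverToCp3 p (β y) = α (coverToCp3 p y) := by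
    have : (FreeGroup.lift (stdGen p)).comp (FreeGroup.lift v) =
      α.toMonoidHom.comp (FreeGroup.lift (stdGen p)) :=
        FreeGroup.ext_hom _ _ fun i => by simpa using hv i
    intro y
    induction y using QuotientGroup.induction_on with
    | H y => rw [hβ]; exact DFunLike.congr_fun this y
  choose v' hv' using fun i => QuotientGroup.mk_surjective (β⁻¹ (coverGen p i))
  refine ⟨v', fun i => ?_, fun x => ?_⟩
  · apply α.injective
    rw [← coverToCp3_mk, hv', ← hlift]
    simp [coverGen, coverToCp3_mk]
  · have : β⁻¹.toMonoidHom.comp (QuotientGroup.mk' (pStep p (relKer p))) =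
        (QuotientGroup.mk' (pStep p (relKer p))).comp (FreeGroup.lift v') :=
      FreeGroup.ext_hom _ _ fun i => by
          rw [MonoidHom.comp_apply, MonoidHom.comp_apply, FreeGroup.lift_apply_of]
          exact (hv' i).symm
    exact DFunLike.congr_fun this x

lemma mem_extOrbit_self (U : Subgroup (P3 p)) : U ∈ extOrbit p (stdGen p) U :=
  ⟨1, 1, .one, (Subgroup.map_id U).symm⟩

lemma extOrbit_subset {U V : Subgroup (P3 p)} (h : V ∈ extOrbit p (stdGen p) U) :
    extOrbit p (stdGen p) V ⊆ extOrbit p (stdGen p) U := by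
  obtain ⟨α, β, hβ, rfl⟩ := h
  rintro _ ⟨α', β', hβ', rfl⟩
  exact ⟨α' * α, β' * β, hβ'.mul hβ, Subgroup.map_map _ _ _⟩

lemma extOrbit_eq_of_mem {U V : Subgroup (P3 p)} (h : V ∈ extOrbit p (stdGen p) U) :
    extOrbit p (stdGen p) U = extOrbit p (stdGen p) V := by
  refine (extOrbit_subset ?_).antisymm (extOrbit_subset h)
  obtain ⟨α, β, hβ, rfl⟩ := h
  refine ⟨α⁻¹, β⁻¹, hβ.inv, ?_⟩
  rw [Subgroup.map_map]
  refine (Subgroup.map_id U).symm.trans (congrArg U.map ?_)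
  ext x
  simp

lemma card_descLabel {p : ℕ} [Fact p.Prime] (hp : 3 < p) : Nat.card (DescLabel p) = 14 + p := by
  let K := Set.Icc (1 : ℕ) ((p - 1) / 2)
  let e : DescLabel p ≃ Fin 15 ⊕ K ⊕ K :=
    { toFun := fun l => match l with
        | .l1 => .inl 0 | .l2 => .inl 1 | .l3 => .inl 2 | .l4 => .inl 3 | .l5 => .inl 4
        | .l6 => .inl 5 | .l7 => .inl 6 | .l8 => .inl 7 | .l9 => .inl 8 | .l10 => .inl 9
        | .l11 => .inl 10 | .l12 => .inl 11 | .l13 => .inl 12 | .l14 => .inl 13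
        | .l16 => .inl 14 | .l15 k => .inr (.inl k) | .l17 k => .inr (.inr k)
      invFun := fun x => match x with
        | .inl i => ![.l1, .l2, .l3, .l4, .l5, .l6, .l7, .l8, .l9, .l10, .l11, .l12, .l13, .l14,
            .l16] i
        | .inr (.inl k) => .l15 k
        | .inr (.inr k) => .l17 k
      left_inv := fun l => by cases l <;> rfl
      right_inv := fun x => by
        rcases x with i | k | k
        · fin_cases i <;> rfl
        · rfl
        · rfl }
  have hK : Nat.card K = (p - 1) / 2 := by simp [K]
  have hodd := (Fact.out : p.Prime).eq_two_or_odd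
  rw [Nat.card_congr e, Nat.card_sum, Nat.card_sum, Nat.card_fin, hK]
  omega

end Orbits

/-! ### The exponent-`p` class and the rank -/

section PClass

variable {p : ℕ} {H K : Type*} [Group H] [Group K]

lemma map_pStep_of_surjective {f : H →* K} (hf : Function.Surjective f) (N : Subgroup H) :
    (pStep p N).map f = pStep p (N.map f) := by
  refine le_antisymm (Subgroup.map_le_iff_le_comap.2 (map_pStep_le f (Subgroup.le_comap_map f N)))
    (pStep_le_iff.2 ⟨?_, ?_⟩)
  · rintro _ ⟨x, hx, rfl⟩ y
    obtain ⟨y, rfl⟩ := hf y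
    exact ⟨_, pcomm_mem_pStep hx y, map_pcomm f x y⟩
  · rintro _ ⟨x, hx, rfl⟩
    exact ⟨_, pow_mem_pStep hx, map_pow f x p⟩

lemma map_lowerPSeries {f : H →* K} (hf : Function.Surjective f) (i : ℕ) :
    (lowerPSeries p H i).map f = lowerPSeries p K i := by
  induction i with
  | zero => exact Subgroup.map_top_of_surjective f hf
  | succ i ih => rw [lowerPSeries, lowerPSeries, map_pStep_of_surjective hf, ih]

lemma HasPClass.congr (e : H ≃* K) {c : ℕ} (h : HasPClass p H c) : HasPClass p K c := by
  have hs : {i | lowerPSeries p K i = ⊥} = {i | lowerPSeries p H i = ⊥} := by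
    ext i
    rw [Set.mem_ofPred_eq, Set.mem_ofPred_eq,
      ← map_lowerPSeries (f := e.toMonoidHom) e.surjective i,
      Subgroup.map_eq_bot_iff_of_injective _ e.injective]
  rw [HasPClass, hs]
  exact h

lemma hasPClass_two_iff : HasPClass p H 2 ↔
    pStep p (pStep p (⊤ : Subgroup H)) = ⊥ ∧ pStep p (⊤ : Subgroup H) ≠ ⊥ := by
  constructor
  · refine fun h => ⟨h.1, fun h1 => ?_⟩
    have := h.2 (show lowerPSeries p H 1 = ⊥ from h1)
    omega
  · refine fun h => ⟨h.1, fun i hi => ?_⟩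
    by_contra! hlt
    interval_cases i
    · have h0 : (⊤ : Subgroup H) = ⊥ := hi
      exact h.2 (le_bot_iff.1 ((pStep_le _).trans h0.le))
    · exact h.2 hi

/-- The largest subgroup that the exponent-`p` central step annihilates. -/
def centralTorsion (p : ℕ) (H : Type*) [Group H] : Subgroup H where
  carrier := {x | (∀ y, x * y = y * x) ∧ x ^ p = 1}
  one_mem' := ⟨by simp, one_pow p⟩
  mul_mem' := fun {a b} ha hb => ⟨fun y => by rw [mul_assoc, hb.1, ← mul_assoc, ha.1, mul_assoc],
    by rw [Commute.mul_pow (ha.1 b), ha.2, hb.2, one_mul]⟩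
  inv_mem' := fun {a} ha => ⟨fun y => (Commute.inv_left (show Commute a y from ha.1 y)),
    by rw [inv_pow, ha.2, inv_one]⟩

instance : (centralTorsion p H).Normal :=
  ⟨fun x hx g => by rwa [← hx.1 g, mul_inv_cancel_right]⟩

lemma le_centralTorsion_iff {N : Subgroup H} : N ≤ centralTorsion p H ↔ pStep p N = ⊥ := by
  rw [pStep_eq_bot_iff]
  exact ⟨fun h => ⟨fun x hx => (h hx).1, fun x hx => (h hx).2⟩, fun h x hx => ⟨h.1 x hx, h.2 x hx⟩⟩

lemma pStep_centralTorsion : pStep p (centralTorsion p H) = ⊥ :=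
  le_centralTorsion_iff.1 le_rfl

lemma rank_le_of_closure_range {n : ℕ} [Group.FG H] (x : Fin n → H)
    (hx : Subgroup.closure (Set.range x) = ⊤) : Group.rank H ≤ n := by
  classical
  refine (Group.rank_le (S := Finset.univ.image x) (by simpa using hx)).trans ?_
  simpa using Finset.card_image_le (s := Finset.univ) (f := x)

lemma exists_closure_eq_top_of_rank [Group.FG H] (h : Group.rank H = 3) :
    ∃ x : Fin 3 → H, Subgroup.closure (Set.range x) = ⊤ := by
  classical
  obtain ⟨S, hS, hS'⟩ := Group.rank_spec H
  rw [h, Finset.card_eq_three] at hS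
  obtain ⟨a, b, c, -, -, -, rfl⟩ := hS
  refine ⟨![a, b, c], ?_⟩
  rw [← hS']
  congr 1
  ext y
  simp [eq_comm, or_left_comm, or_comm]

end PClass

section Cp3

variable {p : ℕ} [Fact p.Prime]

lemma cp3_pow (x : Cp3 p) : x ^ p = 1 := by
  refine Multiplicative.toAdd.injective ?_
  funext i
  simp

lemma hasPClass_cp3 : HasPClass p (Cp3 p) 1 := by
  have h1 : pStep p (⊤ : Subgroup (Cp3 p)) = ⊥ :=
    pStep_eq_bot_iff.2 ⟨fun x _ y => mul_comm x y, fun x _ => cp3_pow x⟩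
  refine ⟨h1, fun i hi => Nat.one_le_iff_ne_zero.2 ?_⟩
  rintro rfl
  exact top_ne_bot (α := Subgroup (Cp3 p)) hi

lemma rank_cp3 : Group.rank (Cp3 p) = 3 := by
  classical
  refine le_antisymm (rank_le_of_closure_range (stdGen p) (eq_top_of_stdGen_mem fun i =>
    Subgroup.subset_closure ⟨i, rfl⟩)) ?_
  obtain ⟨S, hS, hS'⟩ := Group.rank_spec (Cp3 p)
  let S' : Finset (Fin 3 → ZMod p) := S.image Multiplicative.toAdd
  let T := Submodule.span (ZMod p) (S' : Set (Fin 3 → ZMod p))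
  have hT : T = ⊤ := by
    refine eq_top_iff.2 fun x _ => ?_
    have h : Subgroup.closure (S : Set (Cp3 p)) ≤ AddSubgroup.toSubgroup T.toAddSubgroup := by
      rw [Subgroup.closure_le]
      intro y hy
      have hy' : y.toAdd ∈ T :=
        Submodule.subset_span (Finset.mem_coe.2 (Finset.mem_image_of_mem _ hy))
      exact hy'
    rw [hS'] at h
    exact h (Subgroup.mem_top (Multiplicative.ofAdd x))
  have h1 := finrank_span_finset_le_card (R := ZMod p) S'
  rw [Set.finrank] at h1
  change Module.finrank (ZMod p) T ≤ _ at h1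
  rw [hT, finrank_top, Module.finrank_fin_fun] at h1
  exact (h1.trans Finset.card_image_le).trans hS.le

/-- A descendant of `C_p³` has class `2` because `C_p³` has class `1`. -/
lemma isImmediateDescendant_cp3_iff {H : Type*} [Group H] [Finite H] :
    IsImmediateDescendant p (Cp3 p) H ↔ IsPGroup p H ∧ Group.rank H = 3 ∧
      Nonempty (H ⧸ pStep p (⊤ : Subgroup H) ≃* Cp3 p) ∧ HasPClass p H 2 := by
  constructor
  · rintro ⟨_, _, -, hH, hr, c, hc, he, hc'⟩
    obtain rfl := hc.unique hasPClass_cp3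
    exact ⟨hH, hr.trans rank_cp3, he, hc'⟩
  · rintro ⟨hH, hr, he, hc⟩
    exact ⟨inferInstance, inferInstance, IsPGroup.of_card (n := 3) (by
      rw [Nat.card_congr Multiplicative.toAdd, Nat.card_fun, Nat.card_zmod, Nat.card_fin]), hH,
      hr.trans rank_cp3.symm, 1, hasPClass_cp3, he, hc⟩

end Cp3

/-! ### Descendants as quotients of the `p`-cover -/

section Quotients

variable {p : ℕ}

/-- Elements of a group of class at most `2` are the images of the generators of the cover, if
their commutators and powers lie in a subgroup that the central step annihilates. -/
lemma exists_coverHom {H : Type*} [Group H] {Z : Subgroup H} [Z.Normal] (hZ : pStep p Z = ⊥)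
    (x : Fin 3 → H) (hc : ∀ i j, i < j → pcomm (x j) (x i) ∈ Z) (hq : ∀ i, x i ^ p ∈ Z) :
    ∃ f : P3 p →* H, (∀ i, f (coverGen p i) = x i) ∧
      ∀ z ∈ multiplicator p (stdGen p), f z ∈ Z := by
  have hker : relKer p ≤ Z.comap (FreeGroup.lift x) := by
    have := relKer_le_ker (p := p) ((QuotientGroup.mk' Z).comp (FreeGroup.lift x))
      (fun i j hij => by
        rw [Commute, SemiconjBy, ← pcomm_eq_one_iff, ← map_pcomm]
        refine (QuotientGroup.eq_one_iff _).2 ?_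
        rw [map_pcomm, FreeGroup.lift_apply_of, FreeGroup.lift_apply_of]
        exact hc i j hij)
      (fun i => by
        rw [← map_pow]
        refine (QuotientGroup.eq_one_iff _).2 ?_
        rw [map_pow, FreeGroup.lift_apply_of]
        exact hq i)
    rwa [← MonoidHom.comap_ker, QuotientGroup.ker_mk'] at this
  have hker' := map_pStep_le (p := p) (FreeGroup.lift x) hker
  rw [hZ] at hker'
  refine ⟨QuotientGroup.lift _ (FreeGroup.lift x) hker', fun i => FreeGroup.lift_apply_of .., ?_⟩
  rintro _ ⟨z, hz, rfl⟩
  exact hker hz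

lemma closure_coverGen : Subgroup.closure (Set.range (coverGen p)) = ⊤ := by
  have h := congrArg (Subgroup.map (QuotientGroup.mk' (pStep p (relKer p))))
    (FreeGroup.closure_range_of (Fin 3))
  rw [MonoidHom.map_closure, ← Set.range_comp, Subgroup.map_top_of_surjective _
    (QuotientGroup.mk'_surjective _)] at h
  exact h

lemma coverHom_surjective {H : Type*} [Group H] {f : P3 p →* H}
    (h : Subgroup.closure (Set.range fun i => f (coverGen p i)) = ⊤) : Function.Surjective f := by
  rw [← MonoidHom.range_eq_top, eq_top_iff, ← h, Subgroup.closure_le]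
  rintro _ ⟨i, rfl⟩
  exact ⟨_, rfl⟩

/-- A group with three generators in which the central step vanishes twice is a quotient of the
`p`-cover. -/
lemma exists_surjective_coverHom {H : Type*} [Group H]
    (h2 : pStep p (pStep p (⊤ : Subgroup H)) = ⊥) {x : Fin 3 → H}
    (hx : Subgroup.closure (Set.range x) = ⊤) : ∃ f : P3 p →* H, Function.Surjective f := by
  obtain ⟨f, hf, -⟩ := exists_coverHom h2 x
    (fun i j _ => pcomm_mem_pStep (Subgroup.mem_top _) _)
    (fun i => pow_mem_pStep (Subgroup.mem_top _))
  exact ⟨f, coverHom_surjective (by simpa only [hf] using hx)⟩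

variable [Fact p.Prime]

/-- The linear combination formula for homomorphisms from the cover to `C_p³`. -/
lemma hom_cover_apply (g : P3 p →* Cp3 p) (x : P3 p) : (g x).toAdd =
    coverVec x 0 • (g (coverGen p 0)).toAdd + coverVec x 1 • (g (coverGen p 1)).toAdd +
      coverVec x 2 • (g (coverGen p 2)).toAdd := by
  have hM : (coverToCp3 p).ker ≤ g.ker := by
    rw [← multiplicator_eq_ker, ← pStep_top_cover]
    exact pStep_le_iff.2 ⟨fun x _ y => by rw [MonoidHom.mem_ker, map_pcomm, pcomm_eq_one_iff,
      mul_comm], fun x _ => by rw [MonoidHom.mem_ker, map_pow, cp3_pow]⟩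
  obtain ⟨α, rfl⟩ : ∃ α : Cp3 p →* Cp3 p, g = α.comp (coverToCp3 p) :=
    ⟨(coverToCp3 p).liftOfSurjective coverToCp3_surjective ⟨g, hM⟩,
      (MonoidHom.liftOfRightInverse_comp _ _ _ ⟨g, hM⟩).symm⟩
  have hs : ∀ i, coverToCp3 p (coverGen p i) = stdGen p i := fun i => by
    simp [coverGen, coverToCp3_mk]
  simp only [MonoidHom.comp_apply, hs]
  exact hom_cp3_apply α _

lemma spans3_of_surjective {g : P3 p →* Cp3 p} (hg : Function.Surjective g) : Spans3 (ZMod p)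
    (g (coverGen p 0)).toAdd (g (coverGen p 1)).toAdd (g (coverGen p 2)).toAdd := by
  intro v
  obtain ⟨x, hx⟩ := hg (Multiplicative.ofAdd v)
  exact ⟨_, _, _, (congrArg Multiplicative.toAdd hx).symm.trans (hom_cover_apply g x)⟩

/-- If a quotient of the cover cannot be generated by two elements, then its largest elementary
abelian quotient is `C_p³`: a relation between the images of the three generators modulo
commutators and powers would make one of them superfluous. -/
lemma comap_pStep_top_eq {H : Type*} [Group H] [Finite H]
    (h2 : pStep p (pStep p (⊤ : Subgroup H)) = ⊥) (hr : 2 < Group.rank H) {f : P3 p →* H}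
    (hf : Function.Surjective f) :
    (pStep p (⊤ : Subgroup H)).comap f = multiplicator p (stdGen p) := by
  refine le_antisymm (fun x hx => ?_) ?_
  · by_contra hxM
    -- `x, y₂, y₃` generate the cover modulo the multiplicator; as `f x` lies in the central step of
    -- `H`, the images of `y₂, y₃` generate `H`
    have hx0 : coverVec x ≠ 0 := fun h => hxM (mem_multiplicator_iff.2 h)
    obtain ⟨v₂, v₃, hv⟩ := (spans3_coverVec_coverGen (p := p)).exists_of_ne_zero hx0
    obtain ⟨y₂, rfl⟩ := exists_word_coverVec v₂
    obtain ⟨y₃, rfl⟩ := exists_word_coverVec v₃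
    let S : Subgroup H := Subgroup.closure (Set.range ![f y₂, f y₃])
    have h₂ : f y₂ ∈ S := Subgroup.subset_closure ⟨0, rfl⟩
    have h₃ : f y₃ ∈ S := Subgroup.subset_closure ⟨1, rfl⟩
    have hsupp : ∀ h, ∃ s ∈ S, ∃ z ∈ pStep p (⊤ : Subgroup H), h = s * z := by
      intro h
      obtain ⟨t, rfl⟩ := hf h
      obtain ⟨a, b, d, e⟩ := hv (coverVec t)
      let s : P3 p := (QuotientGroup.mk y₂) ^ b.val * (QuotientGroup.mk y₃) ^ d.val
      have hz : (s * x ^ a.val)⁻¹ * t ∈ multiplicator p (stdGen p) := by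
        rw [mem_multiplicator_iff, map_mul, map_inv, inv_mul_eq_one]
        refine Multiplicative.toAdd.injective (Eq.trans ?_ e.symm)
        simp only [s, map_mul, map_pow, toAdd_mul, toAdd_pow, coverVec,
          ← Nat.cast_smul_eq_nsmul (ZMod p), ZMod.natCast_zmod_val]
        abel
      refine ⟨f s, ?_, f (x ^ a.val) * f ((s * x ^ a.val)⁻¹ * t), ?_, ?_⟩
      · simp only [s, map_mul, map_pow]
        exact S.mul_mem (S.pow_mem h₂ _) (S.pow_mem h₃ _)
      · rw [map_pow]
        refine Subgroup.mul_mem _ (Subgroup.pow_mem _ (show f x ∈ _ from hx) _) ?_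
        rw [← pStep_top_cover] at hz
        exact map_pStep_le f le_top hz
      · rw [← map_mul, ← map_mul]
        congr 1
        group
    have hS : S = ⊤ := by
      refine eq_top_iff.2 fun h _ => ?_
      obtain ⟨s, hs, z, hz, rfl⟩ := hsupp h
      exact S.mul_mem hs (pStep_top_le_of_supplement h2 hsupp hz)
    have := rank_le_of_closure_range _ hS
    omega
  · rw [← pStep_top_cover]
    exact map_pStep_le f le_top

lemma nonempty_quotient_equiv_cp3 {H : Type*} [Group H] {f : P3 p →* H}
    (hf : Function.Surjective f)
    (h : (pStep p (⊤ : Subgroup H)).comap f = multiplicator p (stdGen p)) :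
    Nonempty (H ⧸ pStep p (⊤ : Subgroup H) ≃* Cp3 p) := by
  let π := (QuotientGroup.mk' (pStep p (⊤ : Subgroup H))).comp f
  have hπ : Function.Surjective π := (QuotientGroup.mk'_surjective _).comp hf
  have hker : π.ker = (coverToCp3 p).ker := by
    rw [← multiplicator_eq_ker, ← h, ← MonoidHom.comap_ker, QuotientGroup.ker_mk']
  exact ⟨(QuotientGroup.quotientKerEquivOfSurjective π hπ).symm.trans
    ((QuotientGroup.quotientMulEquivOfEq hker).trans
      (QuotientGroup.quotientKerEquivOfSurjective _ coverToCp3_surjective))⟩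

/-- For groups of order `p⁵`, the conditions on the rank and the class suffice. -/
theorem isImmediateDescendant_iff_rank_class {H : Type*} [Group H] [Finite H]
    (hcard : Nat.card H = p ^ 5) :
    IsImmediateDescendant p (Cp3 p) H ↔ Group.rank H = 3 ∧ HasPClass p H 2 := by
  rw [isImmediateDescendant_cp3_iff]
  refine ⟨fun h => ⟨h.2.1, h.2.2.2⟩, fun h => ⟨IsPGroup.of_card hcard, h.1, ?_, h.2⟩⟩
  obtain ⟨x, hx⟩ := exists_closure_eq_top_of_rank h.1
  have h2 := (hasPClass_two_iff.1 h.2).1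
  obtain ⟨f, hf⟩ := exists_surjective_coverHom h2 hx
  exact nonempty_quotient_equiv_cp3 hf (comap_pStep_top_eq h2 (by omega) hf)

lemma IsImmediateDescendant.congr {H K : Type*} [Group H] [Group K] (e : H ≃* K)
    (h : IsImmediateDescendant p (Cp3 p) H) (hcard : Nat.card H = p ^ 5) :
    IsImmediateDescendant p (Cp3 p) K := by
  have : Finite H := h.2.1
  have : Finite K := Finite.of_equiv H e.toEquiv
  rw [isImmediateDescendant_iff_rank_class hcard] at h
  rw [isImmediateDescendant_iff_rank_class ((Nat.card_congr e.toEquiv).symm.trans hcard)]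
  exact ⟨(Group.rank_congr e).symm.trans h.1, h.2.congr e⟩

variable (hp : 3 < p)

include hp in
lemma card_quotient {U : Subgroup (P3 p)} (hcard : Nat.card U = p ^ 4) :
    Nat.card (P3 p ⧸ U) = p ^ 5 := by
  have h := Subgroup.card_eq_card_quotient_mul_card_subgroup U
  rw [card_cover hp, hcard] at h
  refine Nat.eq_of_mul_eq_mul_right (pow_pos (Fact.out : p.Prime).pos 4) (h.symm.trans ?_)
  rw [← pow_add]

include hp in
theorem isAdmissible_of_card {U : Subgroup (P3 p)} (hU : U ≤ multiplicator p (stdGen p))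
    (hcard : Nat.card U = p ^ 4) : IsAdmissible p (stdGen p) U := by
  have hN := normal_of_le_multiplicator hU
  have := finite_cover hp
  refine ⟨hU, hN, ?_⟩
  rw [isImmediateDescendant_iff_rank_class (card_quotient hp hcard), hasPClass_two_iff]
  have hs := QuotientGroup.mk'_surjective U
  have h1 : pStep p (⊤ : Subgroup (P3 p ⧸ U)) =
      (multiplicator p (stdGen p)).map (QuotientGroup.mk' U) := by
    rw [← pStep_top_cover, map_pStep_of_surjective hs, Subgroup.map_top_of_surjective _ hs]
  refine ⟨le_antisymm ?_ ?_, ?_, fun hb => ?_⟩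
  · refine rank_le_of_closure_range (fun i => (QuotientGroup.mk' U) (coverGen p i)) ?_
    have h := congrArg (Subgroup.map (QuotientGroup.mk' U)) (closure_coverGen (p := p))
    rwa [MonoidHom.map_closure, ← Set.range_comp, Subgroup.map_top_of_surjective _ hs] at h
  · refine (rank_cp3 (p := p)).ge.trans ?_
    refine Group.rank_le_of_surjective (QuotientGroup.lift U (coverToCp3 p) fun x hx =>
      mem_multiplicator_iff.1 (hU hx)) fun y => ?_
    obtain ⟨x, rfl⟩ := coverToCp3_surjective y
    exact ⟨QuotientGroup.mk x, rfl⟩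
  · rw [h1, ← map_pStep_of_surjective hs, pStep_multiplicator, Subgroup.map_bot]
  · rw [h1, Subgroup.map_eq_bot_iff, QuotientGroup.ker_mk'] at hb
    have hle := Subgroup.card_le_of_le hb
    rw [card_multiplicator hp, hcard] at hle
    exact absurd hle (not_le.2 (Nat.pow_lt_pow_right (Fact.out : p.Prime).one_lt (by norm_num)))

include hp in
/-- A descendant of order `p⁵` is the quotient of the cover by a subgroup of order `p⁴` of the
multiplicator. -/
theorem exists_quotient_equiv {H : Type*} [Group H] (h : IsImmediateDescendant p (Cp3 p) H)
    (hcard : Nat.card H = p ^ 5) : ∃ U : Subgroup (P3 p), U ≤ multiplicator p (stdGen p) ∧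
      Nat.card U = p ^ 4 ∧ ∃ _ : U.Normal, Nonempty (P3 p ⧸ U ≃* H) := by
  have : Finite H := h.2.1
  rw [isImmediateDescendant_iff_rank_class hcard] at h
  obtain ⟨x, hx⟩ := exists_closure_eq_top_of_rank h.1
  have h2 := (hasPClass_two_iff.1 h.2).1
  obtain ⟨f, hf⟩ := exists_surjective_coverHom h2 hx
  let e := QuotientGroup.quotientKerEquivOfSurjective f hf
  refine ⟨f.ker, ?_, ?_, inferInstance, ⟨e⟩⟩
  · rw [← comap_pStep_top_eq h2 (by omega) hf]
    exact Subgroup.comap_mono bot_le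
  · have h := Subgroup.card_eq_card_quotient_mul_card_subgroup f.ker
    rw [card_cover hp, Nat.card_congr e.toEquiv, hcard] at h
    refine (Nat.eq_of_mul_eq_mul_left (pow_pos (Fact.out : p.Prime).pos 5) (Eq.trans ?_ h)).symm
    rw [← pow_add]

include hp in
/-- Isomorphisms between quotients of the cover lift to extension automorphisms. -/
theorem mem_extOrbit_of_equiv {U V : Subgroup (P3 p)} [U.Normal] [V.Normal]
    (hV : V ≤ multiplicator p (stdGen p)) (hUc : Nat.card U = p ^ 4) (hVc : Nat.card V = p ^ 4)
    (e : P3 p ⧸ U ≃* P3 p ⧸ V) : V ∈ extOrbit p (stdGen p) U := by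
  have hv : ∀ i, ∃ v : FreeGroup (Fin 3),
      QuotientGroup.mk' V (QuotientGroup.mk v) = e (QuotientGroup.mk (coverGen p i)) := fun i => by
    obtain ⟨y, hy⟩ := QuotientGroup.mk'_surjective V (e (QuotientGroup.mk (coverGen p i)))
    obtain ⟨v, rfl⟩ := QuotientGroup.mk_surjective y
    exact ⟨v, hy⟩
  choose v hv using hv
  let π : P3 p ⧸ V →* Cp3 p := QuotientGroup.lift V (coverToCp3 p) fun x hx =>
    mem_multiplicator_iff.1 (hV hx)
  have hπ : Function.Surjective π := fun y => by
    obtain ⟨x, rfl⟩ := coverToCp3_surjective y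
    exact ⟨QuotientGroup.mk x, rfl⟩
  let g : P3 p →* Cp3 p := (π.comp e.toMonoidHom).comp (QuotientGroup.mk' U)
  have hg : Function.Surjective g := (hπ.comp e.surjective).comp (QuotientGroup.mk'_surjective U)
  have hgv : ∀ i, coverVec (QuotientGroup.mk (v i) : P3 p) = (g (coverGen p i)).toAdd := fun i =>
    congrArg Multiplicative.toAdd (congrArg π (hv i))
  obtain ⟨α, β, hβ, hβv⟩ := exists_extensionAut hp (v := v) (by
    rw [hgv, hgv, hgv]
    exact spans3_of_surjective hg)
  refine ⟨α, β, hβ, map_eq_of_le hp hUc hVc ?_⟩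
  have hcomp : (QuotientGroup.mk' V).comp β.toMonoidHom =
      e.toMonoidHom.comp (QuotientGroup.mk' U) := by
    refine QuotientGroup.monoidHom_ext _ (FreeGroup.ext_hom _ _ fun i => ?_)
    refine Eq.trans ?_ (hv i)
    exact congrArg (QuotientGroup.mk' V) ((hβv (.of i)).trans (by rw [FreeGroup.lift_apply_of]))
  rintro _ ⟨x, hx, rfl⟩
  rw [← QuotientGroup.ker_mk' V, MonoidHom.mem_ker]
  refine (DFunLike.congr_fun hcomp x).trans ?_
  exact (congrArg e ((QuotientGroup.eq_one_iff x).2 hx)).trans (map_one e)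

end Quotients

/-! ### The presented groups as quotients of the `p`-cover -/

section Presentation

variable {p : ℕ}

/-- The relations of a descendant presentation, read off for a homomorphism from the free group. -/
lemma forall_descRels_iff {Q : Type*} [Group Q] (t : FreeGroup (Fin 5) →* Q)
    (c21 c31 c32 q2 q3 : FreeGroup (Fin 5)) :
    (∀ r ∈ descRels p c21 c31 c32 q2 q3, t r = 1) ↔
      (pcomm (t (.of 1)) (t (.of 0)) = t c21 ∧ pcomm (t (.of 2)) (t (.of 0)) = t c31 ∧
        pcomm (t (.of 2)) (t (.of 1)) = t c32) ∧
      (t (.of 0) ^ p = 1 ∧ t (.of 1) ^ p = t q2 ∧ t (.of 2) ^ p = t q3) ∧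
      (t (.of 3) ^ p = 1 ∧ t (.of 4) ^ p = 1) ∧
      ∀ i j : Fin 5, i < j → 3 ≤ j → t (.of j) * t (.of i) = t (.of i) * t (.of j) := by
  have h1 : (∀ r ∈ descRels p c21 c31 c32 q2 q3, t r = 1) ↔
      (∀ i, t (.of i) ^ p = t (![1, q2, q3, 1, 1] i)) ∧
      ∀ i j : Fin 5, i < j → pcomm (t (.of j)) (t (.of i)) = t ((![![1, 1, 1, 1, 1],
      ![c21, 1, 1, 1, 1], ![c31, c32, 1, 1, 1], ![1, 1, 1, 1, 1], ![1, 1, 1, 1, 1]] :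
        Fin 5 → Fin 5 → FreeGroup (Fin 5)) j i) := by
    constructor
    · intro h
      refine ⟨fun i => ?_, fun i j hij => ?_⟩
      · have := h _ (.inl ⟨i, rfl⟩)
        rwa [map_mul, map_inv, mul_inv_eq_one, map_pow] at this
      · have := h _ (.inr ⟨i, j, hij, rfl⟩)
        rwa [map_mul, map_inv, mul_inv_eq_one, map_pcomm] at this
    · rintro ⟨h, h'⟩ r (⟨i, rfl⟩ | ⟨i, j, hij, rfl⟩)
      · rw [map_mul, map_inv, mul_inv_eq_one, map_pow, h]
      · rw [map_mul, map_inv, mul_inv_eq_one, map_pcomm, h' i j hij]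
  rw [h1]
  simp only [← pcomm_eq_one_iff]
  simp [Fin.forall_fin_succ]
  tauto

/-- A descendant presentation whose relations hold in `P(G) / U`, where `g₄, g₅` come from the
multiplicator, presents `P(G) / U` as soon as `U` vanishes in the presented group and `g₄, g₅` are
redundant generators. -/
lemma nonempty_quotient_equiv_presented [Fact p.Prime] {c21 c31 c32 q2 q3 : FreeGroup (Fin 5)}
    (hw : {c21, c31, c32, q2, q3} ⊆ (Subgroup.closure {g4, g5} : Set (FreeGroup (Fin 5))))
    {U : Subgroup (P3 p)} [U.Normal]
    (hker : ∀ f : P3 p →* PresentedGroup (descRels p c21 c31 c32 q2 q3),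
      Commute (PresentedGroup.mk (descRels p c21 c31 c32 q2 q3) g4) (PresentedGroup.mk _ g5) →
      f (a4 p) = PresentedGroup.mk _ c21 → f (a5 p) = PresentedGroup.mk _ c31 →
      f (a6 p) = PresentedGroup.mk _ c32 → f (a7 p) = 1 → f (a8 p) = PresentedGroup.mk _ q2 →
      f (a9 p) = PresentedGroup.mk _ q3 → U ≤ f.ker)
    (hgen : {g4, g5} ⊆ (Subgroup.closure {c21, c31, c32, q2, q3} : Set (FreeGroup (Fin 5))))
    (hz : ∃ z₄ ∈ multiplicator p (stdGen p), ∃ z₅ ∈ multiplicator p (stdGen p),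
      ∀ {Q : Type} [Group Q] (π : P3 p →* Q) (t : FreeGroup (Fin 5) →* Q), U ≤ π.ker →
        t g4 = π z₄ → t g5 = π z₅ → (π (a4 p) = t c21 ∧ π (a5 p) = t c31 ∧ π (a6 p) = t c32) ∧
        π (a7 p) = 1 ∧ π (a8 p) = t q2 ∧ π (a9 p) = t q3) :
    Nonempty (P3 p ⧸ U ≃* PresentedGroup (descRels p c21 c31 c32 q2 q3)) := by
  set rels := descRels p c21 c31 c32 q2 q3 with hrels
  let t := PresentedGroup.mk rels
  have hts : Function.Surjective t := PresentedGroup.mk_surjective rels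
  obtain ⟨⟨h21, h31, h32⟩, ⟨h1, h2, h3⟩, ⟨h4, h5⟩, hcom⟩ :=
    (forall_descRels_iff t c21 c31 c32 q2 q3).1 fun r hr => PresentedGroup.one_of_mem hr
  -- `g₄` and `g₅` are central
  have hcent : ∀ j : Fin 5, 3 ≤ j → ∀ y, t (.of j) * y = y * t (.of j) := by
    intro j hj y
    obtain ⟨y, rfl⟩ := hts y
    have hle : (⊤ : Subgroup (FreeGroup (Fin 5))) ≤
        (Subgroup.centralizer {t (.of j)}).comap t := by
      rw [← FreeGroup.closure_range_of, Subgroup.closure_le]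
      rintro _ ⟨i, rfl⟩
      rw [SetLike.mem_coe, Subgroup.mem_comap, Subgroup.mem_centralizer_singleton_iff]
      rcases lt_trichotomy i j with hij | rfl | hij
      · exact (hcom i j hij hj).symm
      · rfl
      · exact hcom j i hij (hj.trans hij.le)
    exact (Subgroup.mem_centralizer_singleton_iff.1 (hle (Subgroup.mem_top y))).symm
  have hZ : Subgroup.closure {g4, g5} ≤ (centralTorsion p (PresentedGroup rels)).comap t := by
    rw [Subgroup.closure_le, Set.insert_subset_iff, Set.singleton_subset_iff]
    exact ⟨⟨hcent 3 (by decide), h4⟩, ⟨hcent 4 (by decide), h5⟩⟩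
  simp only [Set.insert_subset_iff, Set.singleton_subset_iff] at hw
  obtain ⟨w21, w31, w32, w2, w3⟩ := hw
  obtain ⟨f, hf, -⟩ := exists_coverHom (pStep_centralTorsion (p := p) (H := PresentedGroup rels))
    ![t (.of 0), t (.of 1), t (.of 2)]
    (by
      intro i j hij
      fin_cases i <;> fin_cases j <;> first | exact absurd hij (by decide) | skip
      · exact h21 ▸ hZ w21
      · exact h31 ▸ hZ w31
      · exact h32 ▸ hZ w32)
    (by
      intro i
      fin_cases i
      · exact h1 ▸ Subgroup.one_mem _
      · exact h2 ▸ hZ w2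
      · exact h3 ▸ hZ w3)
  have f0 : f (coverGen p 0) = t (.of 0) := hf 0
  have f1 : f (coverGen p 1) = t (.of 1) := hf 1
  have f2 : f (coverGen p 2) = t (.of 2) := hf 2
  have e4 : f (a4 p) = t c21 := by rw [a4, map_pcomm, f1, f0, h21]
  have e5 : f (a5 p) = t c31 := by rw [a5, map_pcomm, f2, f0, h31]
  have e6 : f (a6 p) = t c32 := by rw [a6, map_pcomm, f2, f1, h32]
  have e7 : f (a7 p) = 1 := by rw [a7, map_pow, f0, h1]
  have e8 : f (a8 p) = t q2 := by rw [a8, map_pow, f1, h2]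
  have e9 : f (a9 p) = t q3 := by rw [a9, map_pow, f2, h3]
  have hUf : U ≤ f.ker := hker f (hcent 3 (by decide) _) e4 e5 e6 e7 e8 e9
  have hfs : Function.Surjective f := by
    have hle : Subgroup.closure {c21, c31, c32, q2, q3} ≤ f.range.comap t := by
      rw [Subgroup.closure_le]
      simp only [Set.insert_subset_iff, Set.singleton_subset_iff]
      exact ⟨⟨_, e4⟩, ⟨_, e5⟩, ⟨_, e6⟩, ⟨_, e8⟩, ⟨_, e9⟩⟩
    have htop : (⊤ : Subgroup (FreeGroup (Fin 5))) ≤ f.range.comap t := by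
      rw [← FreeGroup.closure_range_of, Subgroup.closure_le]
      rintro _ ⟨i, rfl⟩
      fin_cases i
      · exact ⟨_, f0⟩
      · exact ⟨_, f1⟩
      · exact ⟨_, f2⟩
      · exact hle (hgen (.inl rfl))
      · exact hle (hgen (.inr rfl))
    intro y
    obtain ⟨y, rfl⟩ := hts y
    exact htop (Subgroup.mem_top y)
  -- the homomorphism in the other direction
  obtain ⟨z₄, hz₄, z₅, hz₅, hz⟩ := hz
  let x : Fin 5 → P3 p := ![coverGen p 0, coverGen p 1, coverGen p 2, z₄, z₅]
  let s : FreeGroup (Fin 5) →* P3 p ⧸ U := FreeGroup.lift fun i => QuotientGroup.mk' U (x i)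
  have hs : ∀ i, s (.of i) = QuotientGroup.mk' U (x i) := fun i => FreeGroup.lift_apply_of ..
  obtain ⟨⟨k21, k31, k32⟩, k1, k2, k3⟩ :=
    hz (QuotientGroup.mk' U) s (QuotientGroup.ker_mk' U).ge (hs 3) (hs 4)
  have hxM : ∀ j : Fin 5, 3 ≤ j → x j ∈ multiplicator p (stdGen p) := by
    intro j hj
    fin_cases j
    · exact absurd hj (by decide)
    · exact absurd hj (by decide)
    · exact absurd hj (by decide)
    · exact hz₄
    · exact hz₅
  have hsr : ∀ r ∈ rels, s r = 1 := by
    refine (forall_descRels_iff s c21 c31 c32 q2 q3).2 ⟨⟨?_, ?_, ?_⟩, ⟨?_, ?_, ?_⟩, ⟨?_, ?_⟩, ?_⟩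
    · rw [hs, hs, ← map_pcomm]; exact k21
    · rw [hs, hs, ← map_pcomm]; exact k31
    · rw [hs, hs, ← map_pcomm]; exact k32
    · rw [hs, ← map_pow]; exact k1
    · rw [hs, ← map_pow]; exact k2
    · rw [hs, ← map_pow]; exact k3
    · rw [hs, ← map_pow, multiplicator_pow (hxM 3 (by decide)), map_one]
    · rw [hs, ← map_pow, multiplicator_pow (hxM 4 (by decide)), map_one]
    · intro i j _ hj
      rw [hs, hs, ← map_mul, ← map_mul, multiplicator_mul_comm (hxM j hj)]
  let ψ : PresentedGroup rels →* P3 p ⧸ U := PresentedGroup.toGroup hsr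
  have hψ : ∀ i, ψ (t (.of i)) = QuotientGroup.mk' U (x i) := fun i => PresentedGroup.toGroup.of hsr
  have hψf : ψ.comp f = QuotientGroup.mk' U := by
    refine QuotientGroup.monoidHom_ext _ (FreeGroup.ext_hom _ _ fun i => ?_)
    change ψ (f (coverGen p i)) = QuotientGroup.mk' U (coverGen p i)
    fin_cases i
    · exact (congrArg ψ f0).trans (hψ 0)
    · exact (congrArg ψ f1).trans (hψ 1)
    · exact (congrArg ψ f2).trans (hψ 2)
  have hkU : U = f.ker := by
    refine le_antisymm hUf fun y hy => ?_
    rw [← QuotientGroup.ker_mk' U, ← hψf, MonoidHom.mem_ker, MonoidHom.comp_apply,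
      MonoidHom.mem_ker.1 hy, map_one]
  exact ⟨(QuotientGroup.quotientMulEquivOfEq hkU).trans
    (QuotientGroup.quotientKerEquivOfSurjective f hfs)⟩

/-- The words of the multiplicator by which `g₄` and `g₅` are eliminated. -/
def DescLabel.elim (p : ℕ) : DescLabel p → P3 p × P3 p
  | .l1 => (a4 p, a5 p)
  | .l2 => (a4 p, a9 p)
  | .l3 => (a4 p, a9 p)
  | .l4 => (a6 p, a9 p)
  | .l5 => (a6 p, a9 p)
  | .l6 => (a4 p, a6 p)
  | _ => (a8 p, a9 p)

/-- In presentations with `[g₂, g₁] = g₁^p = g₂^p = 1`, the first two generators may be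
exchanged. -/
lemma exists_swapHom {x y z : FreeGroup (Fin 5)}
    (hw : {x, y, z} ⊆ (Subgroup.closure {g4, g5} : Set (FreeGroup (Fin 5)))) :
    ∃ φ : PresentedGroup (descRels p 1 x y 1 z) →* PresentedGroup (descRels p 1 y x 1 z),
      ∀ i, φ (.of i) = .of (Equiv.swap 0 1 i) := by
  let t := PresentedGroup.mk (descRels p 1 y x 1 z)
  let s : FreeGroup (Fin 5) →* PresentedGroup (descRels p 1 y x 1 z) :=
    FreeGroup.lift fun i => t (.of (Equiv.swap 0 1 i))
  have hs : ∀ i, s (.of i) = t (.of (Equiv.swap 0 1 i)) := fun i => FreeGroup.lift_apply_of ..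
  obtain ⟨⟨h21, h31, h32⟩, ⟨h1, h2, h3⟩, ⟨h4, h5⟩, hcom⟩ :=
    (forall_descRels_iff t 1 y x 1 z).1 fun r hr => PresentedGroup.one_of_mem hr
  have hst : Set.EqOn s t (Subgroup.closure {g4, g5}) := by
    refine MonoidHom.eqOn_closure ?_
    rintro r (rfl | rfl)
    · exact hs 3
    · exact hs 4
  rw [Set.insert_subset_iff, Set.insert_subset_iff, Set.singleton_subset_iff] at hw
  rw [map_one] at h21 h2
  have hsr : ∀ r ∈ descRels p 1 x y 1 z, s r = 1 := by
    rw [forall_descRels_iff, hst hw.1, hst hw.2.1, hst hw.2.2, map_one, hs, hs, hs, hs, hs]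
    refine ⟨⟨?_, h32, h31⟩, ⟨h2, h1, h3⟩, ⟨h4, h5⟩, fun i j hij hj => ?_⟩
    · exact pcomm_eq_one_iff.2 (pcomm_eq_one_iff.1 h21).symm
    · rw [hs, hs]
      have hj' : Equiv.swap 0 1 j = j := Equiv.swap_apply_of_ne_of_ne (by omega) (by omega)
      rw [hj']
      refine hcom _ j ?_ hj
      rw [Equiv.swap_apply_def]
      split_ifs <;> omega
  exact ⟨PresentedGroup.toGroup hsr, fun i => PresentedGroup.toGroup.of hsr⟩

lemma nonempty_swap_equiv {x y z : FreeGroup (Fin 5)}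
    (hw : {x, y, z} ⊆ (Subgroup.closure {g4, g5} : Set (FreeGroup (Fin 5)))) :
    Nonempty (PresentedGroup (descRels p 1 x y 1 z) ≃*
      PresentedGroup (descRels p 1 y x 1 z)) := by
  obtain ⟨φ, hφ⟩ := exists_swapHom (p := p) hw
  obtain ⟨ψ, hψ⟩ := exists_swapHom (p := p) (x := y) (y := x) (z := z) (by
    rwa [Set.insert_comm])
  exact ⟨MonoidHom.toMulEquiv φ ψ
    (PresentedGroup.ext fun i => by simp [hφ, hψ])
    (PresentedGroup.ext fun i => by simp [hφ, hψ])⟩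

/-- The values of `[g₂, g₁]`, `[g₃, g₁]`, `[g₃, g₂]`, `g₂^p`, `g₃^p` in the quotients of the
cover by the listed subgroups. They differ from those of the listed presentations only for the
label `l5`, by an exchange of the first two generators. -/
def quotRels (p : ℕ) (w : (ZMod p)ˣ) : DescLabel p → Set (FreeGroup (Fin 5))
  | .l5 => descRels p 1 g5 g4 1 g5
  | l => repRels p w l

theorem nonempty_quotient_equiv_quotRels [Fact p.Prime] (w : (ZMod p)ˣ) (l : DescLabel p)
    [(repSubgroup p w l).Normal] :
    Nonempty (P3 p ⧸ repSubgroup p w l ≃* PresentedGroup (quotRels p w l)) := by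
  have hz₄ : (l.elim p).1 ∈ multiplicator p (stdGen p) := by
    cases l <;> first | exact a4_mem | exact a6_mem | exact a8_mem
  have hz₅ : (l.elim p).2 ∈ multiplicator p (stdGen p) := by
    cases l <;> first | exact a5_mem | exact a6_mem | exact a9_mem
  have h4 : g4 ∈ Subgroup.closure {g4, g5} := Subgroup.subset_closure (.inl rfl)
  have h5 : g5 ∈ Subgroup.closure {g4, g5} := Subgroup.subset_closure (.inr rfl)
  have hinv : ∀ {G : Type} [Group G] {a b : G}, Commute a b → a * b * a⁻¹ * b⁻¹ = 1 := by
    intro G _ a b h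
    rw [h.eq]
    group
  cases l <;> refine nonempty_quotient_equiv_presented ?_ ?_
    (Set.insert_subset_iff.2 ⟨Subgroup.subset_closure (by simp),
      Set.singleton_subset_iff.2 (Subgroup.subset_closure (by simp))⟩) ⟨_, hz₄, _, hz₅, ?_⟩ <;>
    first
    | -- the words lie in the subgroup generated by `g₄` and `g₅`
      (simp only [Set.insert_subset_iff, Set.singleton_subset_iff, SetLike.mem_coe]
       and_intros <;> repeat first
        | exact h4
        | exact h5
        | exact Subgroup.one_mem _
        | apply Subgroup.mul_mem
        | apply Subgroup.pow_mem)
    | -- the generators of `U` vanish in the presented group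
      (intro f hc e4 e5 e6 e7 e8 e9
       simp [repSubgroup, Set.insert_subset_iff, MonoidHom.mem_ker, e4, e5, e6, e7, e8, e9, hinv,
        hc, hc.pow_left, hc.pow_right])
    | -- the relations hold in the quotient
      (intro Q _ π t hU k4 k5
       have hcomm : Commute (π (a8 p)) (π (a9 p)) :=
         Commute.map (multiplicator_mul_comm a8_mem (a9 p)) π
       have hc₁ : ∀ m : ℕ, π (a8 p) * π (a9 p) ^ m = π (a9 p) ^ m * π (a8 p) :=
         fun m => (hcomm.pow_right m).eq
       have hc₂ : ∀ m : ℕ, π (a8 p) ^ m * π (a9 p) = π (a9 p) * π (a8 p) ^ m :=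
         fun m => (hcomm.pow_left m).eq
       simp only [repSubgroup, Subgroup.closure_le, Set.insert_subset_iff,
        Set.singleton_subset_iff, SetLike.mem_coe, MonoidHom.mem_ker, map_mul, map_inv, map_pow,
        mul_inv_eq_iff_eq_mul] at hU
       simp [DescLabel.elim, hU, k4, k5, hc₁, hc₂, hcomm.eq])

theorem nonempty_quotient_equiv_repGroup [Fact p.Prime] (w : (ZMod p)ˣ) (l : DescLabel p)
    [(repSubgroup p w l).Normal] : Nonempty (P3 p ⧸ repSubgroup p w l ≃* RepGroup p w l) := by
  obtain ⟨e⟩ := nonempty_quotient_equiv_quotRels w l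
  cases l
  case l5 =>
    obtain ⟨e'⟩ := nonempty_swap_equiv (p := p) (x := g5) (y := g4) (z := g5) (by
      rw [Set.insert_comm, Set.pair_eq_singleton]
      exact Subgroup.subset_closure)
    exact ⟨e.trans e'⟩
  all_goals exact ⟨e⟩

end Presentation

/-! ### The classification -/

section Classification

variable {p : ℕ} [Fact p.Prime] (hp : 3 < p) {w : (ZMod p)ˣ}

include hp in
theorem repGroup_isImmediateDescendant (w : (ZMod p)ˣ) (l : DescLabel p) :
    IsImmediateDescendant p (Cp3 p) (RepGroup p w l) ∧ Nat.card (RepGroup p w l) = p ^ 5 := by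
  have hc := card_repSubgroup hp w l
  obtain ⟨-, hN, h⟩ := isAdmissible_of_card hp (repSubgroup_le_multiplicator w l) hc
  obtain ⟨e⟩ := nonempty_quotient_equiv_repGroup w l
  exact ⟨h.congr e (card_quotient hp hc),
    (Nat.card_congr e.toEquiv).symm.trans (card_quotient hp hc)⟩

include hp in
lemma repGroup_label_unique (hw : ∀ x : (ZMod p)ˣ, x ∈ Subgroup.zpowers w) {l l' : DescLabel p}
    (e : RepGroup p w l ≃* RepGroup p w l') : l = l' := by
  have hU := repSubgroup_le_multiplicator w l
  have hU' := repSubgroup_le_multiplicator w l'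
  have := normal_of_le_multiplicator hU
  have := normal_of_le_multiplicator hU'
  obtain ⟨f⟩ := nonempty_quotient_equiv_repGroup w l
  obtain ⟨f'⟩ := nonempty_quotient_equiv_repGroup w l'
  have hc' := card_repSubgroup hp w l'
  exact extOrbit_label_unique hp hw hU' hc' (mem_extOrbit_of_equiv hp hU'
    (card_repSubgroup hp w l) hc' ((f.trans e).trans f'.symm)) (mem_extOrbit_self _)

/-- Subgroups in the same orbit have isomorphic quotients. -/
lemma nonempty_quotient_equiv_of_mem_extOrbit {U V : Subgroup (P3 p)} [U.Normal] [V.Normal]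
    (h : V ∈ extOrbit p (stdGen p) U) : Nonempty (P3 p ⧸ U ≃* P3 p ⧸ V) := by
  obtain ⟨α, β, -, rfl⟩ := h
  exact ⟨QuotientGroup.congr U _ β rfl⟩

include hp in
theorem existsUnique_repGroup (hw : ∀ x : (ZMod p)ˣ, x ∈ Subgroup.zpowers w) {H : Type*} [Group H]
    (h : IsImmediateDescendant p (Cp3 p) H) (hcard : Nat.card H = p ^ 5) :
    ∃! l, Nonempty (H ≃* RepGroup p w l) := by
  obtain ⟨U, hU, hUc, _, ⟨e⟩⟩ := exists_quotient_equiv hp h hcard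
  obtain ⟨l, hl⟩ := exists_mem_extOrbit hp hw hU hUc
  have := normal_of_le_multiplicator (repSubgroup_le_multiplicator w l)
  obtain ⟨f⟩ := nonempty_quotient_equiv_of_mem_extOrbit hl
  obtain ⟨g⟩ := nonempty_quotient_equiv_repGroup w l
  let k := (e.symm.trans f.symm).trans g
  exact ⟨l, ⟨k⟩, fun l' ⟨k'⟩ => repGroup_label_unique hp hw (k'.symm.trans k)⟩

include hp in
theorem existsUnique_mem_extOrbit (hw : ∀ x : (ZMod p)ˣ, x ∈ Subgroup.zpowers w)
    {U : Subgroup (P3 p)} (hU : U ≤ multiplicator p (stdGen p)) (hcard : Nat.card U = p ^ 4) :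
    ∃! l, U ∈ extOrbit p (stdGen p) (repSubgroup p w l) := by
  obtain ⟨l, hl⟩ := exists_mem_extOrbit hp hw hU hcard
  exact ⟨l, hl, fun l' hl' => extOrbit_label_unique hp hw hU hcard hl' hl⟩

include hp in
theorem ncard_extOrbit (hw : ∀ x : (ZMod p)ˣ, x ∈ Subgroup.zpowers w) :
    Set.ncard {O | ∃ U, IsAdmissible p (stdGen p) U ∧ Nat.card U = p ^ 4 ∧
      O = extOrbit p (stdGen p) U} = 14 + p := by
  have hrange : {O | ∃ U, IsAdmissible p (stdGen p) U ∧ Nat.card U = p ^ 4 ∧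
      O = extOrbit p (stdGen p) U} =
      Set.range fun l : DescLabel p => extOrbit p (stdGen p) (repSubgroup p w l) := by
    ext O
    constructor
    · rintro ⟨U, hU, hc, rfl⟩
      obtain ⟨l, hl⟩ := exists_mem_extOrbit hp hw hU.1 hc
      exact ⟨l, extOrbit_eq_of_mem hl⟩
    · rintro ⟨l, rfl⟩
      exact ⟨_, isAdmissible_of_card hp (repSubgroup_le_multiplicator w l)
        (card_repSubgroup hp w l), card_repSubgroup hp w l, rfl⟩
  have hinj : Function.Injective
      fun l : DescLabel p => extOrbit p (stdGen p) (repSubgroup p w l) := by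
    intro l l' h
    have hl : repSubgroup p w l ∈ extOrbit p (stdGen p) (repSubgroup p w l') :=
      (Set.ext_iff.1 h _).1 (mem_extOrbit_self _)
    exact extOrbit_label_unique hp hw (repSubgroup_le_multiplicator w l) (card_repSubgroup hp w l)
      (mem_extOrbit_self _) hl
  rw [hrange, ← Nat.card_coe_set_eq, Nat.card_range_of_injective hinj, card_descLabel hp]

include hp in
theorem card_desc5Classes (w : (ZMod p)ˣ) (hw : ∀ x : (ZMod p)ˣ, x ∈ Subgroup.zpowers w) :
    Nat.card (Desc5Classes.{u} p) = 14 + p := by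
  rw [← card_descLabel hp]
  have hrep : ∀ l, IsImmediateDescendant p (Cp3 p) (ULift.{u} (RepGroup p w l)) ∧
      Nat.card (ULift.{u} (RepGroup p w l)) = p ^ 5 := fun l => by
    obtain ⟨h, hc⟩ := repGroup_isImmediateDescendant hp w l
    exact ⟨h.congr MulEquiv.ulift.symm hc, (Nat.card_ulift _).trans hc⟩
  let F : DescLabel p → Desc5Classes.{u} p := fun l =>
    Quotient.mk (desc5Setoid p) ⟨GrpCat.of (ULift.{u} (RepGroup p w l)), hrep l⟩
  refine (Nat.card_eq_of_bijective F ⟨fun l l' h => ?_, fun x => ?_⟩).symm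
  · obtain ⟨e⟩ : Nonempty (ULift.{u} (RepGroup p w l) ≃* ULift.{u} (RepGroup p w l')) :=
      Quotient.exact h
    exact repGroup_label_unique hp hw ((MulEquiv.ulift.symm.trans e).trans MulEquiv.ulift)
  · induction x using Quotient.inductionOn with
    | h H =>
      obtain ⟨l, ⟨e⟩, -⟩ := existsUnique_repGroup hp hw H.2.1 H.2.2
      exact ⟨l, Quotient.sound ⟨MulEquiv.ulift.trans e.symm⟩⟩

end Classification

theorem mainTheorem4 (p : ℕ) [Fact p.Prime] (hp : 3 < p)
    (w : (ZMod p)ˣ) (hw : ∀ x : (ZMod p)ˣ, x ∈ Subgroup.zpowers w) :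
    -- the multiplicator is central, elementary abelian of order `p⁶`,
    -- and all its subgroups of order `p⁴` are admissible
    ((∀ x ∈ multiplicator p (stdGen p), ∀ y, x * y = y * x) ∧
      (∀ x ∈ multiplicator p (stdGen p), x ^ p = 1) ∧
      Nat.card (multiplicator p (stdGen p)) = p ^ 6 ∧
      ∀ U ≤ multiplicator p (stdGen p), Nat.card U = p ^ 4 → IsAdmissible p (stdGen p) U) ∧
    -- the admissible subgroups of order `p⁴` form exactly `14 + p` orbits,
    -- of which the list is a system of representatives
    (Set.ncard {O | ∃ U, IsAdmissible p (stdGen p) U ∧ Nat.card U = p ^ 4 ∧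
        O = extOrbit p (stdGen p) U} = 14 + p ∧
      (∀ l, IsAdmissible p (stdGen p) (repSubgroup p w l) ∧
        Nat.card (repSubgroup p w l) = p ^ 4) ∧
      ∀ U, IsAdmissible p (stdGen p) U → Nat.card U = p ^ 4 →
        ∃! l, U ∈ extOrbit p (stdGen p) (repSubgroup p w l)) ∧
    -- the immediate descendants of order `p⁵` are the groups of order `p⁵` with
    -- minimal number of generators 3 and `p`-class 2
    (∀ (H : Type u) [Group H] [Finite H], Nat.card H = p ^ 5 →
      (IsImmediateDescendant p (Cp3 p) H ↔ Group.rank H = 3 ∧ HasPClass p H 2)) ∧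
    -- they form exactly `14 + p` isomorphism classes,
    -- of which the list of presentations is a system of representatives
    Nat.card (Desc5Classes.{u} p) = 14 + p ∧
    (∀ l, IsImmediateDescendant p (Cp3 p) (RepGroup p w l) ∧
      Nat.card (RepGroup p w l) = p ^ 5) ∧
    ∀ (H : Type u) [Group H], IsImmediateDescendant p (Cp3 p) H → Nat.card H = p ^ 5 →
      ∃! l, Nonempty (H ≃* RepGroup p w l) := by
  refine ⟨⟨fun x hx => multiplicator_mul_comm hx, fun x hx => multiplicator_pow hx,
    card_multiplicator hp, fun U hU hc => isAdmissible_of_card hp hU hc⟩,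
    ⟨ncard_extOrbit hp hw, fun l => ⟨isAdmissible_of_card hp (repSubgroup_le_multiplicator w l)
      (card_repSubgroup hp w l), card_repSubgroup hp w l⟩,
      fun U hU hc => existsUnique_mem_extOrbit hp hw hU.1 hc⟩,
    fun H _ _ hc => isImmediateDescendant_iff_rank_class hc, card_desc5Classes hp w hw,
    repGroup_isImmediateDescendant hp w, fun H _ h hc => existsUnique_repGroup hp hw h hc⟩
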